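/- Setting. Let $G$ be a finite $n$-player extensive-form game with perfect recall, in which utility $u_i(h)$ may be gained at every node; write $u_i(h\to z)$ for the sum of $u_i$ along the path from $h$ to $z$, both included. $G$ is accessible only through a black box that plays $G$ once under a given profile and that reports, for every node $h$ it reveals and every player $i$, bounds $\alpha_i(h\to *)\le u_i(h\to z)\le\beta_i(h\to *)$ valid for all terminal descendants $z$ of $h$, with $\Delta_i(h\to *):=\beta_i(h\to *)-\alpha_i(h\to *)\le 1$ (normalized rewards). Algorithm (certificate finding with regret minimization). In each round $t=1,2,\dots$ every player $i$ chooses a behavior strategy $\sigma_i^t$ from the information of the earlier rounds (for instance by an extendable regret minimizer), and $G$ is played once under $\sigma^t$. Let $\hat G^t$ be the part of the tree consisting of the root and the children of all nodes visited so far (the visited nodes are "expanded"), $N_t$ its number of nodes, $C_t$ its number of expanded chance nodes. Let nature play in $\hat G^t$ by the empirical frequencies, and let $$\rho_t(h)=\sqrt{\tfrac1{2t_h}\bigl(|A_h|\log 2+\log(t^2C_tn)\bigr)}$$ for expanded chance nodes $h$, where $t_h$ is the number of visits of $h$ and $|A_h|$ its number of actions. The bounds at a node $h$ are $\hat\beta_i^t(h)=u_i(h)+\rho_t(h)\Delta_i(h\to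 *)$, $\hat\alpha_i^t(h)=u_i(h)-\rho_t(h)\Delta_i(h\to *)$ if $h$ is an expanded chance node, $\hat\beta^t_i(h)=\hat\alpha^t_i(h)=u_i(h)$ if $h$ is another expanded node, and $\beta_i(h\to *)$, $\alpha_i(h\to *)$ if $h$ is unexpanded; $\hat\beta^t_i(\sigma)$, $\hat\alpha_i^t(\sigma)$ are the expected sums of these along the path of play. Let $G^t$ be the pseudogame with the same tree, the exact nature probabilities and $\rho=0$, with bounds $\alpha^t,\beta^t$. After the playthrough, player $i$ receives the loss $-\tilde\beta_i^t(\cdot)$, where $\tilde\beta_i^t$ is a random linear function on the sequence-form strategies, and an estimate $\tilde\alpha_i^t$; given the past and the playthrough, the conditional expectations are $\mathbb E\,\tilde\beta_i^t(\sigma_i)=\hat\beta_i^t(\sigma_i,\sigma_{-i}^t)$ and $\mathbb E\,\tilde\alpha_i^t=\hat\alpha_i^t(\sigma^t)$ (exact values are allowed). Let $M_{i,t}\ge 1$ be nondecreasing in $t$, known before the estimates of round $t$ are drawn, with $|\tilde\beta_i^t(\sigma_i)-\tilde\beta_i^t(\sigma_i')|\le M_{i,t}$ and $|\tilde\beta_i^t(\sigma_i)-\tilde\alpha_i^t|\le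 M_{i,t}$ for all $\sigma_i,\sigma_i'$. Let $\bar\sigma^T$ be the correlated profile that is uniform over $\sigma^1,\dots,\sigma^T$. For an absolute constant $c$ put $$\varepsilon_{i,T}=\max_{\sigma_i}\hat\beta^T_i(\sigma_i,\bar\sigma^T_{-i})-\hat\alpha_i^T(\bar\sigma^T),$$ $$\tilde\varepsilon_{i,T}=\max_{\sigma_i}\frac1T\sum_{t=1}^T\bigl[\tilde\beta_i^t(\sigma_i)-\tilde\alpha_i^t\bigr]+c\,M_{i,T}\sqrt{\tfrac{\log T}{T}},$$ $$\varepsilon^*_{i,T}=\min(\varepsilon_{i,T},\tilde\varepsilon_{i,T}).$$ Statement. There are absolute constants $c,K>0$ for which the following holds. (1) Correctness. For every game with its reported bounds there is $T_0$ such that for every run and every $T\ge T_0$, with probability at least $1-K/\sqrt T$, simultaneously for all players $i$: the (coarse-correlated) equilibrium gap $\max_{\sigma_i}u_i(\sigma_i,\bar\sigma^T_{-i})-u_i(\bar\sigma^T)$ in $G$ is at most $\varepsilon^*_{i,T}$; and, if the reported bounds are nested (i.e. $\alpha_i(h\to *)\le u_i(h)+\alpha_i(h'\to *)$ and $u_i(h)+\beta_i(h'\to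 *)\le\beta_i(h\to *)$ for every child $h'$ of $h$), the equilibrium gap $\max_{\sigma_i}\beta_i^T(\sigma_i,\bar\sigma^T_{-i})-\alpha_i^T(\bar\sigma^T)$ in $G^T$ is also at most $\varepsilon^*_{i,T}$. (2) Rate. $\varepsilon^*_{i,T}=\tilde O(N_T/\sqrt T)$ in expectation, if the minimizer of player $i$ has regret $\tilde O(N_T\sqrt T)$ and the estimates have norm $\tilde O(N_T)$: for all $B,p$ there are $K',q$, depending only on $B,p$, such that for every game with its reported bounds there is $T_0$ such that for every run, every player $i$ and every $T\ge T_0$ with $M_{i,T}\le B\log^p(T)\,N_T$ and $$\mathbb E\max_{\sigma_i}\sum_{t=1}^T\bigl[\tilde\beta_i^t(\sigma_i)-\tilde\beta_i^t(\sigma_i^t)\bigr]\le B\log^p(T)\sqrt T\;\mathbb E N_T,$$ $\varepsilon_{i,T}^*$ is integrable and $\mathbb E\,\varepsilon^*_{i,T}\le K'\,\frac{\log^q T}{\sqrt T}\,\mathbb E N_T$. No lower bound on the reach probabilities under the strategies that are played is assumed. -/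

import Mathlib

open MeasureTheory
open scoped Classical

universe u v w

namespace EFG

noncomputable section

/-- The actions available at `h` in a tree of histories. A node of the tree is the list of the
actions leading to it, most recent action first: the root is `[]`, the child of `h` reached by
action `a` is `a :: h`, and `h <:+ z` says that `z` is `h` or a descendant of `h`. -/
def childActions {A : Type u} (tree : Finset (List A)) (h : List A) : Finset A :=
  tree.preimage (fun a => a :: h) (fun _ _ _ _ e => (List.cons.inj e).1)

/-- The sequence of a player at a node: the information sets at which the player acted on the way
to the node and the actions taken there, most recent first. -/
def sequenceAt {n : ℕ} {A : Type u} {I : Type v} (player : List A → Option (Fin n))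
    (infoset : List A → I) (i : Fin n) : List A → List (I × A)
  | [] => []
  | a :: h =>
      if player h = some i then (infoset h, a) :: sequenceAt player infoset i h
      else sequenceAt player infoset i h

/-- A finite `n`-player extensive-form game with perfect recall. -/
structure Game (n : ℕ) (A : Type u) (I : Type v) where
  /-- the nodes -/
  tree : Finset (List A)
  root_mem : [] ∈ tree
  parent_mem : ∀ a h, a :: h ∈ tree → h ∈ tree
  /-- who acts at a node; `none` is nature -/
  player : List A → Option (Fin n)
  /-- The information set of a decision node. Two decision nodes of the same player are in the same
  information set iff they have the same label. -/
  infoset : List A → I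
  /-- the utility gained at a node (possibly an internal one) -/
  util : Fin n → List A → ℝ
  /-- the action distribution of nature -/
  chance : List A → A → ℝ
  chance_nonneg : ∀ h ∈ tree, player h = none → ∀ a ∈ childActions tree h, 0 ≤ chance h a
  chance_sum : ∀ h ∈ tree, player h = none → (childActions tree h).Nonempty →
    ∑ a ∈ childActions tree h, chance h a = 1
  infoset_actions : ∀ (i : Fin n), ∀ h ∈ tree, ∀ h' ∈ tree,
    player h = some i → player h' = some i →
    (childActions tree h).Nonempty → (childActions tree h').Nonempty →
    infoset h = infoset h' → childActions tree h = childActions tree h'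
  perfect_recall : ∀ (i : Fin n), ∀ h ∈ tree, ∀ h' ∈ tree,
    player h = some i → player h' = some i →
    (childActions tree h).Nonempty → (childActions tree h').Nonempty →
    infoset h = infoset h' →
    sequenceAt player infoset i h = sequenceAt player infoset i h'

namespace Game

variable {n : ℕ} {A : Type u} {I : Type v} (G : Game n A I)

/-- the actions available at a node -/
def actions (h : List A) : Finset A := childActions G.tree h

/-- the terminal nodes of the game -/
def terminals : Finset (List A) := {z ∈ G.tree | G.actions z = ∅}

/-- `h` is a decision node of player `i`. -/
def IsDecision (i : Fin n) (h : List A) : Prop :=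
  h ∈ G.tree ∧ (G.actions h).Nonempty ∧ G.player h = some i

/-- `h` is a chance node. -/
def IsChance (h : List A) : Prop :=
  h ∈ G.tree ∧ (G.actions h).Nonempty ∧ G.player h = none

/-- The behavior strategies of player `i`: a distribution over the available actions at every
information set of `i`. The values elsewhere play no role. -/
def Strategy (i : Fin n) : Set (I → A → ℝ) :=
  {s | ∀ h, G.IsDecision i h →
    (∀ a ∈ G.actions h, 0 ≤ s (G.infoset h) a) ∧ ∑ a ∈ G.actions h, s (G.infoset h) a = 1}

/-- The probability of reaching a node when nature plays by `nat` and the players play by `σ`. -/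
def reach (nat : List A → A → ℝ) (σ : Fin n → I → A → ℝ) : List A → ℝ
  | [] => 1
  | a :: h => reach nat σ h *
      (match G.player h with
        | none => nat h a
        | some i => σ i (G.infoset h) a)

/-- `f(h → z)`: the sum of `f` over the nodes on the path from `h` to `z`, both included. -/
def along (f : List A → ℝ) (h z : List A) : ℝ :=
  ∑ g ∈ G.tree with h <:+ g ∧ g <:+ z, f g

/-- the sequences of player `i` -/
def sequences (i : Fin n) : Finset (List (I × A)) :=
  G.tree.image (sequenceAt G.player G.infoset i)

end Game

/-- The sequence form of a behavior strategy: the product of the probabilities of the actions of a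
sequence. -/
def seqProb {A : Type u} {I : Type v} (s : I → A → ℝ) : List (I × A) → ℝ
  | [] => 1
  | p :: q => seqProb s q * s p.1 p.2

/-- The value at the strategy `s` of player `i` of the linear function on the sequence-form
strategy space of `i` with coefficient vector `g`. -/
def linVal {n : ℕ} {A : Type u} {I : Type v} (G : Game n A I) (i : Fin n)
    (g : List (I × A) → ℝ) (s : I → A → ℝ) : ℝ :=
  ∑ q ∈ G.sequences i, seqProb s q * g q

/-- What a black-box simulator reports at the nodes of `G`: correct, not necessarily tight, bounds
`lo i h` and `hi i h` on the utility `u_i(h → z)` of all terminal descendants `z` of `h`.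
Utilities are normalized: the reported ranges have length at most one. -/
structure Bounds {n : ℕ} {A : Type u} {I : Type v} (G : Game n A I) where
  lo : Fin n → List A → ℝ
  hi : Fin n → List A → ℝ
  lo_le : ∀ i, ∀ h ∈ G.tree, ∀ z ∈ G.terminals, h <:+ z → lo i h ≤ G.along (G.util i) h z
  le_hi : ∀ i, ∀ h ∈ G.tree, ∀ z ∈ G.terminals, h <:+ z → G.along (G.util i) h z ≤ hi i h
  range_le : ∀ i, ∀ h ∈ G.tree, hi i h - lo i h ≤ 1

/-- The bounds never get looser when one moves from a node to a child. -/
def Bounds.Nested {n : ℕ} {A : Type u} {I : Type v} {G : Game n A I} (b : Bounds G) : Prop :=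
  ∀ i a h, a :: h ∈ G.tree →
    b.lo i h ≤ G.util i h + b.lo i (a :: h) ∧ G.util i h + b.hi i (a :: h) ≤ b.hi i h

/-- A pseudogame on a part of the tree of a game: the nodes of `expanded` have been expanded (their
children belong to the pseudogame), nature plays by `nature`, and instead of utilities there
are lower and upper bounds at each node. -/
structure Pseudogame (n : ℕ) (A : Type u) where
  expanded : Finset (List A)
  nature : List A → A → ℝ
  lower : Fin n → List A → ℝ
  upper : Fin n → List A → ℝ

namespace Pseudogame

variable {n : ℕ} {A : Type u} {I : Type v} (P : Pseudogame n A) (G : Game n A I)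

/-- the nodes of the pseudogame: the root and the children of the expanded nodes -/
def nodes : Finset (List A) := {h ∈ G.tree | h = [] ∨ h.tail ∈ P.expanded}

/-- the terminal nodes of the pseudogame: the unexpanded nodes and the terminal nodes of `G` -/
def leaves : Finset (List A) := {h ∈ P.nodes G | h ∉ P.expanded ∨ G.actions h = ∅}

/-- the expected value of the sum of `f` along the path of play -/
def value (f : List A → ℝ) (σ : Fin n → I → A → ℝ) : ℝ :=
  ∑ z ∈ P.leaves G, G.reach P.nature σ z * G.along f [] z

/-- the lower bound `α_i(σ)` on the value of `σ` for player `i` -/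
def lowerVal (i : Fin n) (σ : Fin n → I → A → ℝ) : ℝ := P.value G (P.lower i) σ

/-- the upper bound `β_i(σ)` on the value of `σ` for player `i` -/
def upperVal (i : Fin n) (σ : Fin n → I → A → ℝ) : ℝ := P.value G (P.upper i) σ

/-- The equilibrium gap `β_i^*(σ̄_{-i}) - α_i(σ̄)` of player `i` for the correlated profile `σ̄`
that is uniform over `σ 0, …, σ (T - 1)`. The deviation of player `i` does not depend on the shared
randomness. -/
def gap (i : Fin n) (σ : ℕ → Fin n → I → A → ℝ) (T : ℕ) : ℝ :=
  sSup ((fun s => (1 / (T : ℝ)) * ∑ t ∈ Finset.range T,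
      P.upperVal G i (Function.update (σ t) i s)) '' G.Strategy i)
    - (1 / (T : ℝ)) * ∑ t ∈ Finset.range T, P.lowerVal G i (σ t)

end Pseudogame

section ConfidenceSequence

variable {n : ℕ} {A : Type u} {I : Type v} (G : Game n A I)

/-- the game itself, as a pseudogame without uncertainty -/
def fullGame : Pseudogame n A where
  expanded := G.tree
  nature := G.chance
  lower := G.util
  upper := G.util

variable (b : Bounds G) (play : ℕ → List A) (t : ℕ)

/-- how often the node `h` was on the path of play in the first `t` playthroughs, which ended in
the terminal nodes `play 0, …, play (t - 1)` -/
def visits (h : List A) : ℕ := ((Finset.range t).filter (fun s => h <:+ play s)).card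

/-- the nodes that were on the path of play in the first `t` playthroughs -/
def expandedNodes : Finset (List A) := {h ∈ G.tree | ∃ s < t, h <:+ play s}

/-- the empirical frequency of action `a` at `h` -/
def empirical (h : List A) (a : A) : ℝ :=
  (visits play t (a :: h) : ℝ) / (visits play t h : ℝ)

/-- the number `C_t` of chance nodes of the pseudogame -/
def numChance : ℕ := ((expandedNodes G play t).filter (fun h => G.IsChance h)).card

/-- the confidence radius at the chance node `h` -/
def radius (h : List A) : ℝ :=
  Real.sqrt (1 / (2 * (visits play t h : ℝ)) *
    ((G.actions h).card * Real.log 2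
      + Real.log ((t : ℝ) ^ 2 * (numChance G play t : ℝ) * (n : ℝ))))

/-- the radius times the reported range at a chance node, and zero at other nodes -/
def slack (i : Fin n) (h : List A) : ℝ :=
  if G.IsChance h then radius G play t h * (b.hi i h - b.lo i h) else 0

/-- The pseudogame `(Ĝ^t, α̂^t, β̂^t)` of the confidence sequence after `t` playthroughs. -/
def confGame : Pseudogame n A where
  expanded := expandedNodes G play t
  nature := empirical play t
  lower := fun i h =>
    if h ∈ expandedNodes G play t then G.util i h - slack G b play t i h else b.lo i h
  upper := fun i h =>
    if h ∈ expandedNodes G play t then G.util i h + slack G b play t i h else b.hi i h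

/-- The pseudogame `(G^t, α^t, β^t)` with the same tree but the exact nature probabilities and no
sampling error. -/
def exactGame : Pseudogame n A where
  expanded := expandedNodes G play t
  nature := G.chance
  lower := fun i h => if h ∈ expandedNodes G play t then G.util i h else b.lo i h
  upper := fun i h => if h ∈ expandedNodes G play t then G.util i h else b.hi i h

/-- the number `N_t` of nodes of the pseudogame after `t` playthroughs -/
def numNodes : ℕ := ((confGame G b play t).nodes G).card

end ConfidenceSequence

/-- The regret after `T` rounds of the decisions `x 0, x 1, …` against the losses `ℓ 0, ℓ 1, …`. -/
def regret {S : Type*} (X : Set S) (ℓ : ℕ → S → ℝ) (x : ℕ → S) (T : ℕ) : ℝ :=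
  sSup ((fun y => ∑ t ∈ Finset.range T, (ℓ t (x t) - ℓ t y)) '' X)

/-- A run of certificate finding with regret minimization on a black-box game, on a probability
space. Index `t` of `σ`, `play`, `est` and `estLow` is the round with number `t + 1`.

In a round, every player submits a strategy that is determined by what happened before (by any
rule, such as an extendable regret minimizer fed with the past losses); the game is
played once under the resulting profile and the confidence sequence is updated; finally each player
`i` gets the loss `s ↦ -β̃_i(s)`, where `β̃_i`, a linear function on the sequence-form strategies,
is an estimate of `s ↦ β̂_i(s, σ_{-i})` with the correct conditional expectation, and an estimate of
`α̂_i(σ)`. Exact values are allowed as estimates. -/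
structure Run {n : ℕ} {A : Type u} {I : Type v} (G : Game n A I) (b : Bounds G)
    {Ω : Type w} [mΩ : MeasurableSpace Ω] (μ : Measure Ω) where
  /-- what is known after `t` rounds -/
  ℱ : Filtration ℕ mΩ
  /-- what is known in the round with index `t` after its playthrough, before its estimates -/
  𝒢 : ℕ → MeasurableSpace Ω
  le_mid : ∀ t, ℱ t ≤ 𝒢 t
  mid_le : ∀ t, 𝒢 t ≤ ℱ (t + 1)
  /-- the profiles played -/
  σ : ℕ → Ω → Fin n → I → A → ℝ
  σ_mem : ∀ t ω i, σ t ω i ∈ G.Strategy i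
  σ_meas : ∀ t i l a, Measurable[ℱ t] (fun ω => σ t ω i l a)
  /-- the terminal nodes reached by the playthroughs -/
  play : ℕ → Ω → List A
  play_mem : ∀ t ω, play t ω ∈ G.terminals
  play_meas : ∀ t z, MeasurableSet[𝒢 t] {ω | play t ω = z}
  play_law : ∀ t, ∀ z ∈ G.terminals,
    μ[Set.indicator {ω | play t ω = z} (fun _ => (1 : ℝ)) | ℱ t]
      =ᵐ[μ] fun ω => G.reach G.chance (σ t ω) z
  /-- the coefficient vectors of the estimates `β̃` -/
  est : ℕ → Ω → Fin n → List (I × A) → ℝ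
  /-- the estimates `α̃` -/
  estLow : ℕ → Ω → Fin n → ℝ
  est_meas : ∀ t i q, Measurable[ℱ (t + 1)] (fun ω => est t ω i q)
  estLow_meas : ∀ t i, Measurable[ℱ (t + 1)] (fun ω => estLow t ω i)
  est_int : ∀ t i, ∀ s ∈ G.Strategy i, Integrable (fun ω => linVal G i (est t ω i) s) μ
  estLow_int : ∀ t i, Integrable (fun ω => estLow t ω i) μ
  est_unbiased : ∀ t i, ∀ s ∈ G.Strategy i,
    μ[fun ω => linVal G i (est t ω i) s | 𝒢 t]
      =ᵐ[μ] fun ω => (confGame G b (fun r => play r ω) (t + 1)).upperVal G i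
        (Function.update (σ t ω) i s)
  estLow_unbiased : ∀ t i,
    μ[fun ω => estLow t ω i | 𝒢 t]
      =ᵐ[μ] fun ω => (confGame G b (fun r => play r ω) (t + 1)).lowerVal G i (σ t ω)
  /-- The bound on the norm of the estimates of the first `t` rounds. It may depend on the
  pseudogame, but is known before the estimates are drawn. -/
  M : ℕ → Ω → Fin n → ℝ
  M_meas : ∀ t i, Measurable[𝒢 t] (fun ω => M (t + 1) ω i)
  M_mono : ∀ t ω i, M t ω i ≤ M (t + 1) ω i
  one_le_M : ∀ t ω i, 1 ≤ M t ω i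
  est_bound : ∀ t ω i, ∀ s ∈ G.Strategy i, ∀ s' ∈ G.Strategy i,
    |linVal G i (est t ω i) s - linVal G i (est t ω i) s'| ≤ M (t + 1) ω i
  estLow_bound : ∀ t ω i, ∀ s ∈ G.Strategy i,
    |linVal G i (est t ω i) s - estLow t ω i| ≤ M (t + 1) ω i

namespace Run

variable {n : ℕ} {A : Type u} {I : Type v} {G : Game n A I} {b : Bounds G}
  {Ω : Type w} [MeasurableSpace Ω] {μ : Measure Ω} (R : Run G b μ)

/-- the pseudogame `Ĝ^T` -/
def conf (T : ℕ) (ω : Ω) : Pseudogame n A := confGame G b (fun r => R.play r ω) T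

/-- the pseudogame `G^T` -/
def exact (T : ℕ) (ω : Ω) : Pseudogame n A := exactGame G b (fun r => R.play r ω) T

/-- the number `N_T` of nodes of `Ĝ^T` -/
def N (T : ℕ) (ω : Ω) : ℝ := (numNodes G b (fun r => R.play r ω) T : ℝ)

/-- the regret of player `i` against the losses `-β̃_i` submitted to it -/
def playerRegret (i : Fin n) (T : ℕ) (ω : Ω) : ℝ :=
  regret (G.Strategy i) (fun t s => -linVal G i (R.est t ω i) s) (fun t => R.σ t ω i) T

/-- `ε_{i,T}`: the equilibrium gap of the average profile in the pseudogame `Ĝ^T` -/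
def eps (i : Fin n) (T : ℕ) (ω : Ω) : ℝ := (R.conf T ω).gap G i (fun t => R.σ t ω) T

/-- `ε̃_{i,T}`: the gap computed from the estimates, plus `c M √(log T / T)` -/
def epsTilde (c : ℝ) (i : Fin n) (T : ℕ) (ω : Ω) : ℝ :=
  sSup ((fun s => (1 / (T : ℝ)) * ∑ t ∈ Finset.range T,
      (linVal G i (R.est t ω i) s - R.estLow t ω i)) '' G.Strategy i)
    + c * R.M T ω i * Real.sqrt (Real.log T / T)

/-- `ε*_{i,T}` -/
def epsStar (c : ℝ) (i : Fin n) (T : ℕ) (ω : Ω) : ℝ :=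
  min (R.eps i T ω) (R.epsTilde c i T ω)

end Run

end

end EFG

/-! The argument has a deterministic part, two concentration bounds, and an amortized count of
visits.

Deterministic part. Let `V` be a continuation value computed with the true chance probabilities.
Telescoping `V` along play in the pseudogame with empirical chance (`Proper.telescope`) turns the
difference of the two values into a sum of one-step errors. At an expanded chance node the error is
at most the total variation distance between empirical and true chance times the reported range, so
the slack `radius * range` pays for it (`le_value_optimistic`). Hence, whenever the frequencies are
`Accurate`, the confidence sequence encloses the values of the game, and for nested bounds those of
the exact pseudogame at any later time. Accurate or not, it misses them by at most one, because the
reported range at the root is at most one (`Encloses`). Lower bounds are upper bounds for the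
negated utilities.

Correctness. Products of exponential factors with conditional mean at most one
(`integral_prod_le_one`) give Hoeffding bounds that hold at the `m`-th visit of a node, whenever it
occurs. A union bound over nodes, sets of actions and `m` shows that all frequencies are accurate
from time `t₀` on, except with probability at most `2 * |tree| / t₀`. With `t₀` about `√(T log T)`
the earlier rounds cost only `O(√(T log T))` in the summed gap. By Kuhn's theorem a function that is
linear in the sequence form is an average of its values at pure strategies, so suprema over
strategies are finite maxima. Azuma's inequality for each pure strategy then compares the estimates
with their conditional means. The norm bound `M` is random but predictable: the increments are
divided by it before Azuma and multiplied back by Abel summation.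

Rate. The estimated gap is at most the average regret, plus the average estimated width of the
confidence sequence at the played profile, plus the term with `M`. In expectation the estimated
width is the true width, a sum over nodes of empirical reach times local width. A Chernoff bound
(`Tempered`) replaces empirical by true reach, up to a factor 3 and an additive error of order `1 /
visits`. True reach times a quantity known before the round has the same expectation as that
quantity counted only when the node is visited. The total is therefore a sum over actual visits: `∑
1/√m` over the visits of a node is `O(√T)`, and the numbers of actions of the expanded nodes add up
to at most `N_T`. This is why no lower bound on reach probabilities is needed. The `1 / visits`
errors add up to a polylogarithm with a game-dependent factor, which a large `T₀` absorbs. -/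

namespace EFG
noncomputable section

/-! ### Trees of histories and sums along paths -/

namespace Game

variable {n : ℕ} {A : Type u} {I : Type v} (G : Game n A I)

theorem mem_actions {h : List A} {a : A} : a ∈ G.actions h ↔ a :: h ∈ G.tree := by
  unfold actions childActions
  exact Finset.mem_preimage

/-- The probability of taking action `a` at `h`. -/
def step (nat : List A → A → ℝ) (σ : Fin n → I → A → ℝ) (h : List A) (a : A) : ℝ :=
  match G.player h with
  | none => nat h a
  | some i => σ i (G.infoset h) a

theorem reach_cons (nat : List A → A → ℝ) (σ : Fin n → I → A → ℝ) (a : A) (h : List A) :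
    G.reach nat σ (a :: h) = G.reach nat σ h * G.step nat σ h a := rfl

theorem step_of_chance (nat : List A → A → ℝ) (σ : Fin n → I → A → ℝ) {h : List A} (a : A)
    (hp : G.player h = none) : G.step nat σ h a = nat h a := by
  simp [step, hp]

theorem step_of_player (nat : List A → A → ℝ) (σ : Fin n → I → A → ℝ) {h : List A} (a : A)
    {i : Fin n} (hp : G.player h = some i) : G.step nat σ h a = σ i (G.infoset h) a := by
  simp [step, hp]

theorem mem_tree_of_suffix {h z : List A} (hz : z ∈ G.tree) (hs : h <:+ z) : h ∈ G.tree := by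
  induction z with
  | nil => rw [List.suffix_nil] at hs; rwa [hs]
  | cons a z ih =>
    rcases List.suffix_cons_iff.1 hs with h' | h'
    · rwa [h']
    · exact ih (G.parent_mem a z hz) h'

/-- the length of the longest history -/
def depth : ℕ := G.tree.sup List.length

theorem length_le_depth {h : List A} (hh : h ∈ G.tree) : h.length ≤ G.depth :=
  Finset.le_sup (f := List.length) hh

/-- Induction from the leaves of the tree towards the root. -/
theorem tree_induction {p : List A → Prop}
    (ih : ∀ h ∈ G.tree, (∀ a ∈ G.actions h, p (a :: h)) → p h) : ∀ h ∈ G.tree, p h := by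
  have key : ∀ k : ℕ, ∀ h ∈ G.tree, G.depth - h.length ≤ k → p h := by
    intro k
    induction k with
    | zero =>
      intro h hh hk
      refine ih h hh fun a ha => ?_
      have := G.length_le_depth (G.mem_actions.1 ha)
      simp only [List.length_cons] at this
      omega
    | succ k hk' =>
      intro h hh hk
      refine ih h hh fun a ha => ?_
      refine hk' _ (G.mem_actions.1 ha) ?_
      simp only [List.length_cons]
      omega
  exact fun h hh => key _ h hh le_rfl

theorem mem_terminals {z : List A} : z ∈ G.terminals ↔ z ∈ G.tree ∧ G.actions z = ∅ := by
  simp [terminals]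

theorem exists_terminal : ∀ h ∈ G.tree, ∃ z ∈ G.terminals, h <:+ z := by
  refine G.tree_induction fun h hh ih => ?_
  by_cases he : G.actions h = ∅
  · exact ⟨h, G.mem_terminals.2 ⟨hh, he⟩, List.suffix_rfl⟩
  · obtain ⟨a, ha⟩ := Finset.nonempty_iff_ne_empty.2 he
    obtain ⟨z, hz, hs⟩ := ih a ha
    exact ⟨z, hz, (List.suffix_cons a h).trans hs⟩

theorem along_self (f : List A → ℝ) {h : List A} (hh : h ∈ G.tree) : G.along f h h = f h := by
  have : (G.tree.filter fun g => h <:+ g ∧ g <:+ h) = {h} := by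
    ext g
    simp only [Finset.mem_filter, Finset.mem_singleton]
    constructor
    · rintro ⟨_, h1, h2⟩
      exact h2.eq_of_length_le h1.length_le
    · rintro rfl
      exact ⟨hh, List.suffix_rfl, List.suffix_rfl⟩
  rw [along, this, Finset.sum_singleton]

theorem along_cons_right (f : List A → ℝ) {a : A} {h z : List A} (hz : a :: z ∈ G.tree)
    (hs : h <:+ z) : G.along f h (a :: z) = f (a :: z) + G.along f h z := by
  have : (G.tree.filter fun g => h <:+ g ∧ g <:+ a :: z)
      = insert (a :: z) (G.tree.filter fun g => h <:+ g ∧ g <:+ z) := by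
    ext g
    simp only [Finset.mem_filter, Finset.mem_insert, List.suffix_cons_iff]
    constructor
    · rintro ⟨h1, h2, h3 | h3⟩
      · exact Or.inl h3
      · exact Or.inr ⟨h1, h2, h3⟩
    · rintro (rfl | ⟨h1, h2, h3⟩)
      · exact ⟨hz, hs.trans (List.suffix_cons _ _), Or.inl rfl⟩
      · exact ⟨h1, h2, Or.inr h3⟩
  rw [along, this, Finset.sum_insert]
  · rfl
  · simp only [Finset.mem_filter, not_and]
    intro _ _ h3
    have := h3.length_le
    simp at this

theorem along_cons_left (f : List A → ℝ) {a : A} {h z : List A} (hz : z ∈ G.tree)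
    (hs : a :: h <:+ z) : G.along f h z = f h + G.along f (a :: h) z := by
  have hs' : h <:+ z := (List.suffix_cons a h).trans hs
  have : (G.tree.filter fun g => h <:+ g ∧ g <:+ z)
      = insert h (G.tree.filter fun g => a :: h <:+ g ∧ g <:+ z) := by
    ext g
    simp only [Finset.mem_filter, Finset.mem_insert]
    constructor
    · rintro ⟨h1, h2, h3⟩
      by_cases hl : g.length ≤ h.length
      · exact Or.inl (h2.eq_of_length_le hl).symm
      · refine Or.inr ⟨h1, List.suffix_of_suffix_length_le hs h3 ?_, h3⟩
        simp only [List.length_cons]; omega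
    · rintro (rfl | ⟨h1, h2, h3⟩)
      · exact ⟨G.mem_tree_of_suffix hz hs', List.suffix_rfl, hs'⟩
      · exact ⟨h1, (List.suffix_cons a h).trans h2, h3⟩
  rw [along, this, Finset.sum_insert]
  · rfl
  · simp only [Finset.mem_filter, not_and]
    intro _ h2
    have := h2.length_le
    simp at this

end Game

/-! ### Telescoping and the value of a pseudogame -/

namespace Pseudogame

variable {n : ℕ} {A : Type u} {I : Type v} {P : Pseudogame n A} {G : Game n A I}

/-- The expanded nodes form a subtree of `G` and play under `σ` is a probability distribution at
every expanded node. -/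
structure Proper (P : Pseudogame n A) (G : Game n A I) (σ : Fin n → I → A → ℝ) : Prop where
  sub : P.expanded ⊆ G.tree
  tail_mem : ∀ a h, a :: h ∈ P.expanded → h ∈ P.expanded
  nonneg : ∀ h ∈ P.expanded, ∀ a ∈ G.actions h, 0 ≤ G.step P.nature σ h a
  sum_one : ∀ h ∈ P.expanded, (G.actions h).Nonempty → ∑ a ∈ G.actions h, G.step P.nature σ h a = 1

theorem mem_nodes {h : List A} : h ∈ P.nodes G ↔ h ∈ G.tree ∧ (h = [] ∨ h.tail ∈ P.expanded) := by
  simp [nodes]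

theorem nil_mem_nodes : [] ∈ P.nodes G := mem_nodes.2 ⟨G.root_mem, Or.inl rfl⟩

theorem cons_mem_nodes {a : A} {h : List A} :
    a :: h ∈ P.nodes G ↔ a ∈ G.actions h ∧ h ∈ P.expanded := by
  simp [mem_nodes, G.mem_actions]

theorem mem_leaves {h : List A} :
    h ∈ P.leaves G ↔ h ∈ P.nodes G ∧ (h ∉ P.expanded ∨ G.actions h = ∅) := by
  simp [leaves]

variable {σ : Fin n → I → A → ℝ}

theorem Proper.expanded_subset (hP : P.Proper G σ) : P.expanded ⊆ P.nodes G := by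
  intro h hh
  refine mem_nodes.2 ⟨hP.sub hh, ?_⟩
  cases h with
  | nil => exact Or.inl rfl
  | cons a h => exact Or.inr (hP.tail_mem a h hh)

/-- Summing the one-step changes of a function along the expected path of play. -/
theorem Proper.telescope (hP : P.Proper G σ) (W : List A → ℝ) :
    ∑ g ∈ P.nodes G, G.reach P.nature σ g *
      (W g - if g ∈ P.expanded then ∑ a ∈ G.actions g, G.step P.nature σ g a * W (a :: g) else 0)
      = W [] := by
  have h1 : ∑ g ∈ P.nodes G, G.reach P.nature σ g *
      (if g ∈ P.expanded then ∑ a ∈ G.actions g, G.step P.nature σ g a * W (a :: g) else 0)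
      = ∑ g ∈ P.expanded, ∑ a ∈ G.actions g, G.reach P.nature σ (a :: g) * W (a :: g) := by
    simp only [mul_ite, mul_zero]
    rw [← Finset.sum_filter, Finset.filter_mem_eq_inter,
      Finset.inter_eq_right.2 hP.expanded_subset]
    refine Finset.sum_congr rfl fun g _ => ?_
    rw [Finset.mul_sum]
    refine Finset.sum_congr rfl fun a _ => ?_
    rw [G.reach_cons]; ring
  -- Every node except the root is the child of exactly one expanded node, so the subtracted sum is
  -- the first sum without its root term.
  have h2 : ∑ g ∈ P.expanded, ∑ a ∈ G.actions g, G.reach P.nature σ (a :: g) * W (a :: g)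
      = ∑ g ∈ (P.nodes G).erase [], G.reach P.nature σ g * W g := by
    rw [Finset.sum_sigma']
    refine Finset.sum_bij (fun x _ => x.2 :: x.1) ?_ ?_ ?_ ?_
    · rintro ⟨g, a⟩ hx
      rw [Finset.mem_sigma] at hx
      simp [cons_mem_nodes, hx.1, hx.2]
    · rintro ⟨g, a⟩ _ ⟨g', a'⟩ _ hx
      simp only [List.cons.injEq] at hx
      obtain ⟨rfl, rfl⟩ := hx
      rfl
    · intro g hg
      rw [Finset.mem_erase] at hg
      cases g with
      | nil => exact absurd rfl hg.1
      | cons a g =>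
        have := cons_mem_nodes.1 hg.2
        exact ⟨⟨g, a⟩, Finset.mem_sigma.2 ⟨this.2, this.1⟩, rfl⟩
    · intro _ _; rfl
  simp only [mul_sub, Finset.sum_sub_distrib]
  rw [h1, h2, ← Finset.add_sum_erase _ _ (nil_mem_nodes (P := P) (G := G))]
  simp [Game.reach]

/-- The value is the expected sum of `f` over the visited nodes. -/
theorem Proper.value_eq (hP : P.Proper G σ) (f : List A → ℝ) :
    P.value G f σ = ∑ g ∈ P.nodes G, G.reach P.nature σ g * f g := by
  -- The potential is the sum of `f` over the proper ancestors. Its one-step change is `-f g` at an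
  -- inner node and the full path sum minus `f g` at a leaf, and it vanishes at the root.
  have h := hP.telescope (fun g => G.along f [] g - f g)
  simp only [G.along_self f G.root_mem, sub_self] at h
  rw [← sub_eq_zero, ← h, value, leaves, Finset.sum_filter, ← Finset.sum_sub_distrib]
  refine Finset.sum_congr rfl fun g hg => ?_
  have hW : ∑ a ∈ G.actions g, G.step P.nature σ g a * (G.along f [] (a :: g) - f (a :: g))
      = ∑ a ∈ G.actions g, G.step P.nature σ g a * G.along f [] g := by
    refine Finset.sum_congr rfl fun a ha => ?_
    rw [G.along_cons_right f (G.mem_actions.1 ha) (List.nil_suffix)]; ring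
  rw [hW, ← Finset.sum_mul]
  by_cases he : g ∈ P.expanded
  · rcases (G.actions g).eq_empty_or_nonempty with h0 | h0
    · simp [h0]; ring
    · simp [he, h0.ne_empty, hP.sum_one g he h0]
  · simp [he]; ring

theorem nodes_subset : P.nodes G ⊆ G.tree := fun _ h => (mem_nodes.1 h).1

/-- The flow through a node reaches the leaves below it. -/
theorem Proper.sum_reach_leaves (hP : P.Proper G σ) {h : List A} (hh : h ∈ P.nodes G) :
    ∑ z ∈ P.leaves G, (if h <:+ z then G.reach P.nature σ z else 0) = G.reach P.nature σ h := by
  have := hP.value_eq (fun g => if g = h then 1 else 0)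
  simp only [mul_ite, mul_one, mul_zero, Finset.sum_ite_eq', hh, if_true] at this
  rw [← this, value]
  refine Finset.sum_congr rfl fun z _ => ?_
  rw [Game.along, Finset.sum_ite_eq']
  simp [nodes_subset hh]

theorem Proper.sum_leaves (hP : P.Proper G σ) : ∑ z ∈ P.leaves G, G.reach P.nature σ z = 1 := by
  simpa [Game.reach] using hP.sum_reach_leaves nil_mem_nodes

theorem Proper.reach_nonneg (hP : P.Proper G σ) {h : List A} (hh : h ∈ P.nodes G) :
    0 ≤ G.reach P.nature σ h := by
  induction h with
  | nil => simp [Game.reach]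
  | cons a h ih =>
    have := cons_mem_nodes.1 hh
    rw [G.reach_cons]
    exact mul_nonneg (ih (hP.expanded_subset this.2)) (hP.nonneg h this.2 a this.1)

theorem Proper.step_le_one (hP : P.Proper G σ) {h : List A} (hh : h ∈ P.expanded) {a : A}
    (ha : a ∈ G.actions h) : G.step P.nature σ h a ≤ 1 := by
  rw [← hP.sum_one h hh ⟨a, ha⟩]
  exact Finset.single_le_sum (fun b hb => hP.nonneg h hh b hb) ha

theorem Proper.reach_le_one (hP : P.Proper G σ) {h : List A} (hh : h ∈ P.nodes G) :
    G.reach P.nature σ h ≤ 1 := by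
  induction h with
  | nil => simp [Game.reach]
  | cons a h ih =>
    have := cons_mem_nodes.1 hh
    rw [G.reach_cons]
    exact mul_le_one₀ (ih (hP.expanded_subset this.2)) (hP.nonneg h this.2 a this.1)
      (hP.step_le_one this.2 this.1)

/-- `k` steps of the recursion for the expected sum of `f` from a node on -/
def contAux (P : Pseudogame n A) (G : Game n A I) (f : List A → ℝ) (σ : Fin n → I → A → ℝ) :
    ℕ → List A → ℝ
  | 0, h => f h
  | k + 1, h => f h + if h ∈ P.expanded then
      ∑ a ∈ G.actions h, G.step P.nature σ h a * contAux P G f σ k (a :: h) else 0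

/-- the expected sum of `f` over the nodes from `h` on, given that `h` is reached -/
def cont (P : Pseudogame n A) (G : Game n A I) (f : List A → ℝ) (σ : Fin n → I → A → ℝ)
    (h : List A) : ℝ := contAux P G f σ (G.depth - h.length) h

/-- The fuel `G.depth - h.length` drops by one per step and never runs out early: when it is zero,
`h` has no children in the tree, so the missing sum is empty. -/
theorem cont_eq (f : List A → ℝ) (h : List A) :
    P.cont G f σ h = f h + if h ∈ P.expanded then
      ∑ a ∈ G.actions h, G.step P.nature σ h a * P.cont G f σ (a :: h) else 0 := by
  unfold cont
  rcases hk : G.depth - h.length with _ | k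
  · have : G.actions h = ∅ := by
      refine Finset.eq_empty_of_forall_notMem fun a ha => ?_
      have := G.length_le_depth (G.mem_actions.1 ha)
      simp only [List.length_cons] at this
      omega
    simp [contAux, this]
  · have hk' : ∀ a : A, G.depth - (a :: h).length = k := by
      intro a; simp only [List.length_cons]; omega
    simp only [contAux, hk']

/-- Telescoping the continuation value itself leaves exactly `f g` at each node. -/
theorem Proper.value_eq_cont (hP : P.Proper G σ) (f : List A → ℝ) :
    P.value G f σ = P.cont G f σ [] := by
  rw [hP.value_eq, ← hP.telescope (P.cont G f σ)]
  refine Finset.sum_congr rfl fun g _ => ?_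
  congr 1
  have := cont_eq (P := P) (G := G) (σ := σ) f g
  linarith

end Pseudogame

/-! ### Sequence form, pure strategies and Kuhn's theorem -/

namespace Game

variable {n : ℕ} {A : Type u} {I : Type v} (G : Game n A I)

theorem sequenceAt_suffix (i : Fin n) {h z : List A} (hs : h <:+ z) :
    sequenceAt G.player G.infoset i h <:+ sequenceAt G.player G.infoset i z := by
  induction z with
  | nil => rw [List.suffix_nil] at hs; rw [hs]
  | cons a z ih =>
    rcases List.suffix_cons_iff.1 hs with h' | h'
    · rw [h']
    · refine (ih h').trans ?_
      rw [sequenceAt]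
      split_ifs
      · exact List.suffix_cons _ _
      · exact List.suffix_rfl

theorem exists_of_mem_sequenceAt (i : Fin n) {z : List A} {l : I} {a : A}
    (hl : (l, a) ∈ sequenceAt G.player G.infoset i z) :
    ∃ h, a :: h <:+ z ∧ G.player h = some i ∧ G.infoset h = l := by
  induction z with
  | nil => simp [sequenceAt] at hl
  | cons b z ih =>
    rw [sequenceAt] at hl
    split_ifs at hl with hp
    · rcases List.mem_cons.1 hl with h' | h'
      · rw [Prod.mk.injEq] at h'
        obtain ⟨rfl, rfl⟩ := h'
        exact ⟨z, List.suffix_rfl, hp, rfl⟩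
      · obtain ⟨h, h1, h2⟩ := ih h'
        exact ⟨h, h1.trans (List.suffix_cons _ _), h2⟩
    · obtain ⟨h, h1, h2⟩ := ih hl
      exact ⟨h, h1.trans (List.suffix_cons _ _), h2⟩

/-- By perfect recall, no information set occurs twice on a path. -/
theorem infoset_notMem_sequenceAt (i : Fin n) {h : List A} (hd : G.IsDecision i h) (a : A) :
    (G.infoset h, a) ∉ sequenceAt G.player G.infoset i h := by
  intro hl
  obtain ⟨g, hg, hp, he⟩ := G.exists_of_mem_sequenceAt i hl
  have hgt : a :: g ∈ G.tree := G.mem_tree_of_suffix hd.1 hg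
  have h1 := G.perfect_recall i h hd.1 g (G.parent_mem a g hgt) hd.2.2 hp hd.2.1
    ⟨a, G.mem_actions.2 hgt⟩ he.symm
  have h2 := (G.sequenceAt_suffix i hg).length_le
  rw [sequenceAt, if_pos hp, List.length_cons, h1] at h2
  omega

/-- the information sets of player `i` -/
def infosets (i : Fin n) : Finset I := (G.tree.filter (G.IsDecision i)).image G.infoset

/-- the actions available to player `i` at an information set -/
def acts (i : Fin n) (l : I) : Finset A :=
  (G.tree.filter fun h => G.IsDecision i h ∧ G.infoset h = l).biUnion G.actions

variable {G} in
theorem IsDecision.acts_eq {i : Fin n} {h : List A} (hd : G.IsDecision i h) :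
    G.acts i (G.infoset h) = G.actions h := by
  ext a
  simp only [acts, Finset.mem_biUnion, Finset.mem_filter]
  constructor
  · rintro ⟨g, ⟨hg, hg1, hg2⟩, ha⟩
    rwa [actions, ← G.infoset_actions i g hg h hd.1 hg1.2.2 hd.2.2 hg1.2.1 hd.2.1 hg2]
  · exact fun ha => ⟨h, ⟨hd.1, hd, rfl⟩, ha⟩

variable {G} in
theorem IsDecision.mem_infosets {i : Fin n} {h : List A} (hd : G.IsDecision i h) :
    G.infoset h ∈ G.infosets i :=
  Finset.mem_image_of_mem _ (Finset.mem_filter.2 ⟨hd.1, hd⟩)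

theorem exists_of_mem_infosets {i : Fin n} {l : I} (hl : l ∈ G.infosets i) :
    ∃ h, G.IsDecision i h ∧ G.infoset h = l := by
  obtain ⟨h, hh, rfl⟩ := Finset.mem_image.1 hl
  exact ⟨h, (Finset.mem_filter.1 hh).2, rfl⟩

theorem strategy_nonneg {i : Fin n} {s : I → A → ℝ} (hs : s ∈ G.Strategy i) {l : I}
    (hl : l ∈ G.infosets i) {a : A} (ha : a ∈ G.acts i l) : 0 ≤ s l a := by
  obtain ⟨h, hd, rfl⟩ := G.exists_of_mem_infosets hl
  rw [hd.acts_eq] at ha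
  exact (hs h hd).1 a ha

theorem strategy_sum {i : Fin n} {s : I → A → ℝ} (hs : s ∈ G.Strategy i) {l : I}
    (hl : l ∈ G.infosets i) : ∑ a ∈ G.acts i l, s l a = 1 := by
  obtain ⟨h, hd, rfl⟩ := G.exists_of_mem_infosets hl
  rw [hd.acts_eq]
  exact (hs h hd).2

theorem strategy_le_one {i : Fin n} {s : I → A → ℝ} (hs : s ∈ G.Strategy i) {l : I}
    (hl : l ∈ G.infosets i) {a : A} (ha : a ∈ G.acts i l) : s l a ≤ 1 := by
  rw [← G.strategy_sum hs hl]
  exact Finset.single_le_sum (fun b hb => G.strategy_nonneg hs hl hb) ha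

/-- The choices of an action at every information set of player `i`. -/
def choices (i : Fin n) : Finset (∀ l ∈ G.infosets i, A) := (G.infosets i).pi (G.acts i)

/-- the pure strategy that takes the chosen actions -/
def pure {i : Fin n} (π : ∀ l ∈ G.infosets i, A) : I → A → ℝ :=
  fun l a => if hl : l ∈ G.infosets i then (if a = π l hl then 1 else 0) else 0

/-- the probability that independent draws from a behavior strategy make the given choices -/
def weight {i : Fin n} (s : I → A → ℝ) (π : ∀ l ∈ G.infosets i, A) : ℝ :=
  ∏ l ∈ (G.infosets i).attach, s l.1 (π l.1 l.2)

theorem pure_mem {i : Fin n} {π : ∀ l ∈ G.infosets i, A} (hπ : π ∈ G.choices i) :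
    G.pure π ∈ G.Strategy i := by
  intro h hd
  have hl := hd.mem_infosets
  have hm := Finset.mem_pi.1 hπ _ hl
  rw [hd.acts_eq] at hm
  constructor
  · intro a _
    simp only [pure, dif_pos hl]
    split_ifs <;> norm_num
  · simp only [pure, dif_pos hl, Finset.sum_ite_eq', hm, if_true]

theorem choices_nonempty (i : Fin n) : (G.choices i).Nonempty := by
  rw [choices, Finset.pi_nonempty]
  intro l hl
  obtain ⟨h, hd, rfl⟩ := G.exists_of_mem_infosets hl
  rw [hd.acts_eq]
  exact hd.2.1

theorem strategy_nonempty (i : Fin n) : (G.Strategy i).Nonempty :=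
  let ⟨_, hπ⟩ := G.choices_nonempty i
  ⟨_, G.pure_mem hπ⟩

theorem weight_nonneg {i : Fin n} {s : I → A → ℝ} (hs : s ∈ G.Strategy i)
    {π : ∀ l ∈ G.infosets i, A} (hπ : π ∈ G.choices i) : 0 ≤ G.weight s π :=
  Finset.prod_nonneg fun l _ => G.strategy_nonneg hs l.2 (Finset.mem_pi.1 hπ l.1 l.2)

theorem weight_le_one {i : Fin n} {s : I → A → ℝ} (hs : s ∈ G.Strategy i)
    {π : ∀ l ∈ G.infosets i, A} (hπ : π ∈ G.choices i) : G.weight s π ≤ 1 :=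
  Finset.prod_le_one (fun l _ => G.strategy_nonneg hs l.2 (Finset.mem_pi.1 hπ l.1 l.2))
    fun l _ => G.strategy_le_one hs l.2 (Finset.mem_pi.1 hπ l.1 l.2)

theorem sum_weight {i : Fin n} {s : I → A → ℝ} (hs : s ∈ G.Strategy i) :
    ∑ π ∈ G.choices i, G.weight s π = 1 := by
  have := Finset.prod_sum (G.infosets i) (G.acts i) (fun l a => s l a)
  rw [choices]
  simp only [weight]
  rw [← this]
  exact Finset.prod_eq_one fun l hl => G.strategy_sum hs hl

/-- whether the action `a` at `l` is consistent with the sequence `q` -/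
def consistent (q : List (I × A)) (l : I) (a : A) : ℝ :=
  if ∃ b, (l, b) ∈ q then (if (l, a) ∈ q then 1 else 0) else 1

/-- An information set that the sequence does not mention contributes the total mass one; one that
it mentions contributes the probability of the prescribed action. Perfect recall prevents
repetitions, so prolonging the sequence changes a single factor, from one to the new probability. -/
theorem seqProb_eq_prod {i : Fin n} {s : I → A → ℝ} (hs : s ∈ G.Strategy i) {z : List A}
    (hz : z ∈ G.tree) :
    seqProb s (sequenceAt G.player G.infoset i z) = ∏ l ∈ G.infosets i, ∑ a ∈ G.acts i l,
      s l a * consistent (sequenceAt G.player G.infoset i z) l a := by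
  induction z with
  | nil =>
    simp only [sequenceAt, seqProb, consistent, List.not_mem_nil, exists_false, if_false, mul_one]
    exact (Finset.prod_eq_one fun l hl => G.strategy_sum hs hl).symm
  | cons b h ih =>
    have hh := G.parent_mem b h hz
    rw [sequenceAt]
    split_ifs with hp
    · have hb : b ∈ G.actions h := G.mem_actions.2 hz
      have hd : G.IsDecision i h := ⟨hh, ⟨b, hb⟩, hp⟩
      have hl := hd.mem_infosets
      rw [seqProb, ih hh, ← Finset.mul_prod_erase _ _ hl, ← Finset.mul_prod_erase _ _ hl]
      have h1 : ∑ a ∈ G.acts i (G.infoset h), s (G.infoset h) a *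
          consistent (sequenceAt G.player G.infoset i h) (G.infoset h) a = 1 := by
        rw [← G.strategy_sum hs hl]
        refine Finset.sum_congr rfl fun a _ => ?_
        rw [consistent, if_neg, mul_one]
        rintro ⟨c, hc⟩
        exact G.infoset_notMem_sequenceAt i hd c hc
      have h2 : ∑ a ∈ G.acts i (G.infoset h), s (G.infoset h) a *
          consistent ((G.infoset h, b) :: sequenceAt G.player G.infoset i h) (G.infoset h) a
          = s (G.infoset h) b := by
        have : ∀ a, consistent ((G.infoset h, b) :: sequenceAt G.player G.infoset i h)
            (G.infoset h) a = if a = b then 1 else 0 := by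
          intro a
          rw [consistent, if_pos ⟨b, by simp⟩]
          simp [G.infoset_notMem_sequenceAt i hd a]
        simp only [this, mul_ite, mul_one, mul_zero, Finset.sum_ite_eq', hd.acts_eq, hb, if_true]
      rw [h1, h2, one_mul, mul_comm]
      congr 1
      refine Finset.prod_congr rfl fun l hl' => Finset.sum_congr rfl fun a _ => ?_
      have hne := (Finset.mem_erase.1 hl').1
      simp [consistent, hne]
    · exact ih hh

theorem prod_consistent {i : Fin n} {π : ∀ l ∈ G.infosets i, A} (hπ : π ∈ G.choices i)
    {z : List A} (hz : z ∈ G.tree) :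
    seqProb (G.pure π) (sequenceAt G.player G.infoset i z) = ∏ l ∈ (G.infosets i).attach,
      consistent (sequenceAt G.player G.infoset i z) l.1 (π l.1 l.2) := by
  rw [G.seqProb_eq_prod (G.pure_mem hπ) hz, ← Finset.prod_attach]
  refine Finset.prod_congr rfl fun l _ => ?_
  have := Finset.mem_pi.1 hπ l.1 l.2
  simp only [pure, dif_pos l.2, ite_mul, one_mul, zero_mul, Finset.sum_ite_eq', this, if_true]

/-- Kuhn's theorem: a behavior strategy is a mixture of pure strategies. -/
theorem seqProb_eq_sum_pure {i : Fin n} {s : I → A → ℝ} (hs : s ∈ G.Strategy i) {z : List A}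
    (hz : z ∈ G.tree) :
    seqProb s (sequenceAt G.player G.infoset i z) = ∑ π ∈ G.choices i,
      G.weight s π * seqProb (G.pure π) (sequenceAt G.player G.infoset i z) := by
  rw [G.seqProb_eq_prod hs hz, Finset.prod_sum]
  refine Finset.sum_congr rfl fun π hπ => ?_
  rw [G.prod_consistent hπ hz, weight, Finset.prod_mul_distrib]

/-- A function of the strategies of player `i` that is linear in the sequence form. -/
def IsLinear (i : Fin n) (F : (I → A → ℝ) → ℝ) : Prop :=
  ∀ s ∈ G.Strategy i, F s = ∑ π ∈ G.choices i, G.weight s π * F (G.pure π)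

variable {G}

theorem isLinear_seqProb {i : Fin n} {z : List A} (hz : z ∈ G.tree) :
    G.IsLinear i fun s => seqProb s (sequenceAt G.player G.infoset i z) :=
  fun _ hs => G.seqProb_eq_sum_pure hs hz

theorem isLinear_const {i : Fin n} (c : ℝ) : G.IsLinear i fun _ => c := by
  intro s hs
  rw [← Finset.sum_mul, G.sum_weight hs, one_mul]

theorem IsLinear.sum {i : Fin n} {ι : Type*} {J : Finset ι} {F : ι → (I → A → ℝ) → ℝ}
    (hF : ∀ j ∈ J, G.IsLinear i (F j)) : G.IsLinear i fun s => ∑ j ∈ J, F j s := by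
  intro s hs
  simp only [Finset.mul_sum]
  rw [Finset.sum_comm]
  exact Finset.sum_congr rfl fun j hj => hF j hj s hs

theorem IsLinear.mul_const {i : Fin n} {F : (I → A → ℝ) → ℝ} (hF : G.IsLinear i F) (c : ℝ) :
    G.IsLinear i fun s => F s * c := by
  intro s hs
  simp only [hF s hs, Finset.sum_mul, mul_assoc]

theorem IsLinear.const_mul {i : Fin n} {F : (I → A → ℝ) → ℝ} (hF : G.IsLinear i F) (c : ℝ) :
    G.IsLinear i fun s => c * F s := by
  simpa only [mul_comm c] using hF.mul_const c

theorem IsLinear.sub {i : Fin n} {F F' : (I → A → ℝ) → ℝ} (hF : G.IsLinear i F)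
    (hF' : G.IsLinear i F') : G.IsLinear i fun s => F s - F' s := by
  intro s hs
  simp only [hF s hs, hF' s hs, mul_sub, Finset.sum_sub_distrib]

theorem isLinear_linVal {i : Fin n} (g : List (I × A) → ℝ) : G.IsLinear i (linVal G i g) := by
  refine IsLinear.sum fun q hq => ?_
  obtain ⟨z, hz, rfl⟩ := Finset.mem_image.1 hq
  exact (isLinear_seqProb hz).mul_const _

/-- The contribution of player `i` to a reach probability factors out as a sequence probability. The
contribution of everybody else is the reach with all probabilities of `i` set to one. This makes
values linear in the sequence form of one player. -/
theorem reach_update (nat : List A → A → ℝ) (σ : Fin n → I → A → ℝ) (i : Fin n)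
    (s : I → A → ℝ) (z : List A) :
    G.reach nat (Function.update σ i s) z = G.reach nat (Function.update σ i fun _ _ => 1) z *
      seqProb s (sequenceAt G.player G.infoset i z) := by
  induction z with
  | nil => simp [reach, sequenceAt, seqProb]
  | cons a h ih =>
    rw [reach_cons, reach_cons, ih, sequenceAt]
    rcases hp : G.player h with _ | j
    · simp only [G.step_of_chance nat _ a hp, reduceCtorEq, if_false]; ring
    · simp only [G.step_of_player nat _ a hp, Option.some.injEq]
      by_cases hj : j = i
      · subst hj
        simp only [if_true, seqProb, Function.update_self]; ring
      · simp only [hj, if_false, Function.update_of_ne hj]; ring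

theorem isLinear_value (P : Pseudogame n A) (f : List A → ℝ) (σ : Fin n → I → A → ℝ) (i : Fin n) :
    G.IsLinear i fun s => P.value G f (Function.update σ i s) := by
  unfold Pseudogame.value
  refine IsLinear.sum fun z hz => IsLinear.mul_const ?_ _
  rw [funext fun s => reach_update P.nature σ i s z]
  exact (isLinear_seqProb
    (Pseudogame.nodes_subset (Pseudogame.mem_leaves.1 hz).1)).const_mul _

/-- A linear function on the strategies is bounded by a bound on the pure strategies. -/
theorem IsLinear.le {i : Fin n} {F : (I → A → ℝ) → ℝ} (hF : G.IsLinear i F) {C : ℝ}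
    (hC : ∀ π ∈ G.choices i, F (G.pure π) ≤ C) {s : I → A → ℝ} (hs : s ∈ G.Strategy i) :
    F s ≤ C := by
  rw [hF s hs, ← one_mul C, ← G.sum_weight hs, Finset.sum_mul]
  exact Finset.sum_le_sum fun π hπ =>
    mul_le_mul_of_nonneg_left (hC π hπ) (G.weight_nonneg hs hπ)

theorem IsLinear.bddAbove {i : Fin n} {F : (I → A → ℝ) → ℝ} (hF : G.IsLinear i F) :
    BddAbove (F '' G.Strategy i) := by
  refine ⟨(G.choices i).sup' (G.choices_nonempty i) fun π => F (G.pure π), ?_⟩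
  rintro _ ⟨s, hs, rfl⟩
  exact hF.le (fun π hπ => Finset.le_sup' (fun π => F (G.pure π)) hπ) hs

/-- An average is at most the largest averaged value, and pure strategies are strategies. The finite
maximum makes gaps and regrets integrable, and it allows union bounds over deviations. -/
theorem IsLinear.sSup_eq {i : Fin n} {F : (I → A → ℝ) → ℝ} (hF : G.IsLinear i F) :
    sSup (F '' G.Strategy i)
      = (G.choices i).sup' (G.choices_nonempty i) fun π => F (G.pure π) := by
  apply le_antisymm
  · refine csSup_le ((G.strategy_nonempty i).image F) ?_
    rintro _ ⟨s, hs, rfl⟩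
    exact hF.le (fun π hπ => Finset.le_sup' (fun π => F (G.pure π)) hπ) hs
  · exact Finset.sup'_le _ _ fun π hπ =>
      le_csSup hF.bddAbove (Set.mem_image_of_mem F (G.pure_mem hπ))

theorem IsLinear.le_sSup {i : Fin n} {F : (I → A → ℝ) → ℝ} (hF : G.IsLinear i F)
    {s : I → A → ℝ} (hs : s ∈ G.Strategy i) : F s ≤ sSup (F '' G.Strategy i) :=
  _root_.le_csSup hF.bddAbove (Set.mem_image_of_mem F hs)

theorem IsLinear.sSup_le {i : Fin n} {F : (I → A → ℝ) → ℝ} (hF : G.IsLinear i F) {C : ℝ}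
    (hC : ∀ π ∈ G.choices i, F (G.pure π) ≤ C) : sSup (F '' G.Strategy i) ≤ C := by
  rw [hF.sSup_eq]
  exact Finset.sup'_le _ _ hC

end Game

/-! ### Paths, visit counts and empirical frequencies -/

section Paths

variable {n : ℕ} {A : Type u} {I : Type v} (G : Game n A I)

theorem Game.exists_next {h z : List A} (hz : z ∈ G.terminals) (hs : h <:+ z)
    (hne : (G.actions h).Nonempty) : ∃ a ∈ G.actions h, a :: h <:+ z := by
  have hz' := G.mem_terminals.1 hz
  obtain ⟨l, rfl⟩ := hs
  rcases List.eq_nil_or_concat l with rfl | ⟨l, a, rfl⟩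
  · simp only [List.nil_append] at hz'
    exact absurd hz'.2 hne.ne_empty
  · have : a :: h <:+ (l ++ [a]) ++ h := ⟨l, by simp⟩
    simp only [List.concat_eq_append] at hz' ⊢
    exact ⟨a, G.mem_actions.2 (G.mem_tree_of_suffix hz'.1 this), this⟩

theorem next_unique {h z : List A} {a c : A} (h1 : a :: h <:+ z) (h2 : c :: h <:+ z) : a = c := by
  have := (List.suffix_of_suffix_length_le h1 h2 (by simp)).eq_of_length (by simp)
  exact (List.cons.inj this).1

/-- The function of the action that a path takes at `h`; `d` if the path avoids `h`. -/
theorem Game.sum_next {h z : List A} (hz : z ∈ G.terminals) (hne : (G.actions h).Nonempty)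
    (κ : A → ℝ) : ∑ a ∈ G.actions h, (if a :: h <:+ z then κ a else 0)
      = if hs : h <:+ z then κ (G.exists_next hz hs hne).choose else 0 := by
  split_ifs with hs
  · obtain ⟨h1, h2⟩ := (G.exists_next hz hs hne).choose_spec
    rw [Finset.sum_eq_single_of_mem _ h1, if_pos h2]
    intro c _ hc
    rw [if_neg]
    exact fun h3 => hc (next_unique h3 h2)
  · refine Finset.sum_eq_zero fun a _ => if_neg fun h1 => hs ((List.suffix_cons a h).trans h1)

theorem Game.along_append (f : List A → ℝ) {a : A} {h z : List A} (hz : z ∈ G.tree)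
    (hs : a :: h <:+ z) : G.along f [] z = G.along f [] h + G.along f (a :: h) z := by
  induction z with
  | nil => simp at hs
  | cons c z ih =>
    rw [G.along_cons_right f hz List.nil_suffix]
    rcases List.suffix_cons_iff.1 hs with h' | h'
    · obtain ⟨rfl, rfl⟩ := List.cons.inj h'
      rw [G.along_self f hz]; ring
    · rw [ih (G.parent_mem _ _ hz) h', G.along_cons_right f hz h']; ring

theorem Game.along_neg (f : List A → ℝ) (h z : List A) :
    G.along (fun g => -f g) h z = -G.along f h z := by
  simp [Game.along]

theorem Pseudogame.value_neg (P : Pseudogame n A) (f : List A → ℝ) (σ : Fin n → I → A → ℝ) :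
    P.value G (fun g => -f g) σ = -P.value G f σ := by
  simp [Pseudogame.value, G.along_neg]

end Paths

section Counts

variable {n : ℕ} {A : Type u} {I : Type v} {G : Game n A I} {play : ℕ → List A}

theorem mem_expandedNodes {t : ℕ} {h : List A} :
    h ∈ expandedNodes G play t ↔ h ∈ G.tree ∧ ∃ s < t, h <:+ play s := by
  simp [expandedNodes]

theorem expandedNodes_mono {t t' : ℕ} (ht : t ≤ t') :
    expandedNodes G play t ⊆ expandedNodes G play t' := by
  intro h hh
  obtain ⟨h1, s, hs, h2⟩ := mem_expandedNodes.1 hh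
  exact mem_expandedNodes.2 ⟨h1, s, hs.trans_le ht, h2⟩

theorem visits_pos {t : ℕ} {h : List A} : 0 < visits play t h ↔ ∃ s < t, h <:+ play s := by
  rw [visits, Finset.card_pos]
  constructor
  · rintro ⟨s, hs⟩
    rw [Finset.mem_filter, Finset.mem_range] at hs
    exact ⟨s, hs⟩
  · rintro ⟨s, hs⟩
    exact ⟨s, by rwa [Finset.mem_filter, Finset.mem_range]⟩

theorem visits_pos_of_expanded {t : ℕ} {h : List A} (hh : h ∈ expandedNodes G play t) :
    0 < visits play t h := visits_pos.2 (mem_expandedNodes.1 hh).2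

theorem visits_le (t : ℕ) (h : List A) : visits play t h ≤ t :=
  (Finset.card_filter_le _ _).trans (Finset.card_range t).le

theorem visits_succ (t : ℕ) (h : List A) :
    visits play (t + 1) h = visits play t h + if h <:+ play t then 1 else 0 := by
  rw [visits, Finset.range_add_one, Finset.filter_insert]
  split_ifs
  · rw [Finset.card_insert_of_notMem (by simp)]; rfl
  · rfl

theorem visits_mono {t t' : ℕ} (ht : t ≤ t') (h : List A) :
    visits play t h ≤ visits play t' h :=
  Finset.card_le_card (Finset.filter_subset_filter _ (Finset.range_mono ht))

/-- Playthroughs end at terminal nodes, so a path that visits a node with actions passes through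
exactly one of its children. -/
theorem sum_visits (hplay : ∀ r, play r ∈ G.terminals) (t : ℕ) {h : List A}
    (hne : (G.actions h).Nonempty) :
    ∑ a ∈ G.actions h, visits play t (a :: h) = visits play t h := by
  induction t with
  | zero => simp [visits]
  | succ t ih =>
    simp only [visits_succ, Finset.sum_add_distrib, ih]
    congr 1
    have := G.sum_next (hplay t) hne (fun _ => 1)
    have h2 : ∑ a ∈ G.actions h, (if a :: h <:+ play t then (1 : ℝ) else 0)
        = if h <:+ play t then (1 : ℝ) else 0 := by
      rw [this]; split_ifs <;> rfl
    exact_mod_cast h2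

theorem sum_empirical (hplay : ∀ r, play r ∈ G.terminals) {t : ℕ} {h : List A}
    (hh : h ∈ expandedNodes G play t) (hne : (G.actions h).Nonempty) :
    ∑ a ∈ G.actions h, empirical play t h a = 1 := by
  have := visits_pos_of_expanded hh
  simp only [empirical]
  rw [← Finset.sum_div, ← Nat.cast_sum, sum_visits hplay t hne, div_self]
  positivity

theorem empirical_nonneg (t : ℕ) (h : List A) (a : A) : 0 ≤ empirical play t h a := by
  unfold empirical; positivity

/-- The empirical frequencies at the expanded chance nodes are close to the true probabilities. -/
def Accurate (G : Game n A I) (play : ℕ → List A) (t : ℕ) : Prop :=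
  ∀ h ∈ expandedNodes G play t, G.IsChance h → ∀ S ⊆ G.actions h,
    ∑ a ∈ S, (empirical play t h a - G.chance h a) ≤ radius G play t h

theorem radius_nonneg (t : ℕ) (h : List A) : 0 ≤ radius G play t h := Real.sqrt_nonneg _

end Counts

/-- The means of a function under two distributions differ by at most its range times the total
variation distance. -/
theorem sum_mul_le_of_range {ι : Type*} {J : Finset ι} {p q v : ι → ℝ} {lo hi r : ℝ}
    (hpq : ∑ j ∈ J, p j = ∑ j ∈ J, q j) (hr : ∀ S ⊆ J, ∑ j ∈ S, (q j - p j) ≤ r)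
    (hlo : ∀ j ∈ J, lo ≤ v j) (hhi : ∀ j ∈ J, v j ≤ hi) (hne : J.Nonempty) :
    ∑ j ∈ J, p j * v j ≤ ∑ j ∈ J, q j * v j + r * (hi - lo) := by
  have hle : lo ≤ hi := by
    obtain ⟨j, hj⟩ := hne
    exact (hlo j hj).trans (hhi j hj)
  set S := J.filter fun j => p j < q j with hS
  -- Since both masses agree, `v` may be shifted by `lo`. Then only the indices where `p` exceeds
  -- `q` help, each by at most its excess times the range, and the total excess equals the total
  -- deficit on `S`.
  have h1 : ∑ j ∈ J, (p j - q j) * (v j - lo) ≤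
      ∑ j ∈ J, (if p j < q j then 0 else (p j - q j) * (hi - lo)) := by
    refine Finset.sum_le_sum fun j hj => ?_
    split_ifs with hc
    · exact mul_nonpos_of_nonpos_of_nonneg (by linarith) (by linarith [hlo j hj])
    · exact mul_le_mul_of_nonneg_left (by linarith [hhi j hj]) (by linarith)
  have h2 : ∑ j ∈ J, (if p j < q j then 0 else (p j - q j) * (hi - lo))
      = (∑ j ∈ S, (q j - p j)) * (hi - lo) := by
    have : ∑ j ∈ J, (p j - q j) * (hi - lo) = 0 := by
      rw [← Finset.sum_mul, Finset.sum_sub_distrib, hpq, sub_self, zero_mul]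
    have h5 : ∑ j ∈ J, (if p j < q j then 0 else (p j - q j) * (hi - lo))
        - ∑ j ∈ J, (if p j < q j then (q j - p j) * (hi - lo) else 0)
        = ∑ j ∈ J, (p j - q j) * (hi - lo) := by
      rw [← Finset.sum_sub_distrib]
      refine Finset.sum_congr rfl fun j _ => ?_
      split_ifs <;> ring
    rw [hS, Finset.sum_mul, Finset.sum_filter]
    linarith
  have h3 : (∑ j ∈ S, (q j - p j)) * (hi - lo) ≤ r * (hi - lo) :=
    mul_le_mul_of_nonneg_right (hr S (Finset.filter_subset _ _)) (by linarith)
  have h4 : ∑ j ∈ J, (p j - q j) * (v j - lo)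
      = ∑ j ∈ J, p j * v j - ∑ j ∈ J, q j * v j - (∑ j ∈ J, p j - ∑ j ∈ J, q j) * lo := by
    rw [← Finset.sum_sub_distrib, ← Finset.sum_sub_distrib, Finset.sum_mul,
      ← Finset.sum_sub_distrib]
    exact Finset.sum_congr rfl fun j _ => by ring
  rw [hpq, sub_self, zero_mul] at h4
  linarith

/-! ### The confidence sequence encloses the true values -/

section Games

variable {n : ℕ} {A : Type u} {I : Type v} {G : Game n A I} {b : Bounds G} {play : ℕ → List A}
  {σ : Fin n → I → A → ℝ}

/-- If nature plays by distributions at the expanded nodes, then the pseudogame is proper. -/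
theorem Pseudogame.proper_of_nature {P : Pseudogame n A} (hσ : ∀ j, σ j ∈ G.Strategy j)
    (hsub : P.expanded ⊆ G.tree) (htail : ∀ a h, a :: h ∈ P.expanded → h ∈ P.expanded)
    (hnn : ∀ h ∈ P.expanded, G.IsChance h → ∀ a ∈ G.actions h, 0 ≤ P.nature h a)
    (hsum : ∀ h ∈ P.expanded, G.IsChance h → ∑ a ∈ G.actions h, P.nature h a = 1) :
    P.Proper G σ := by
  refine ⟨hsub, htail, fun h hh a ha => ?_, fun h hh hne => ?_⟩
  · rcases hp : G.player h with _ | j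
    · rw [G.step_of_chance _ _ a hp]
      exact hnn h hh ⟨hsub hh, ⟨a, ha⟩, hp⟩ a ha
    · rw [G.step_of_player _ _ a hp]
      exact (hσ j h ⟨hsub hh, ⟨a, ha⟩, hp⟩).1 a ha
  · rcases hp : G.player h with _ | j
    · rw [← hsum h hh ⟨hsub hh, hne, hp⟩]
      exact Finset.sum_congr rfl fun a _ => G.step_of_chance _ _ a hp
    · rw [← (hσ j h ⟨hsub hh, hne, hp⟩).2]
      exact Finset.sum_congr rfl fun a _ => G.step_of_player _ _ a hp

theorem expandedNodes_subset (t : ℕ) : expandedNodes G play t ⊆ G.tree :=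
  fun _ hh => (mem_expandedNodes.1 hh).1

theorem expandedNodes_tail {t : ℕ} (a : A) (h : List A) (hh : a :: h ∈ expandedNodes G play t) :
    h ∈ expandedNodes G play t := by
  obtain ⟨h1, s, hs, h2⟩ := mem_expandedNodes.1 hh
  exact mem_expandedNodes.2 ⟨G.parent_mem a h h1, s, hs, (List.suffix_cons a h).trans h2⟩

theorem fullGame_proper (hσ : ∀ j, σ j ∈ G.Strategy j) : (fullGame G).Proper G σ :=
  Pseudogame.proper_of_nature hσ (fun _ h => h) G.parent_mem
    (fun h hh hc a ha => G.chance_nonneg h hh hc.2.2 a ha)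
    (fun h hh hc => G.chance_sum h hh hc.2.2 hc.2.1)

theorem exactGame_proper (hσ : ∀ j, σ j ∈ G.Strategy j) (t : ℕ) :
    (exactGame G b play t).Proper G σ :=
  Pseudogame.proper_of_nature hσ (expandedNodes_subset t) expandedNodes_tail
    (fun h _ hc a ha => G.chance_nonneg h hc.1 hc.2.2 a ha)
    (fun h _ hc => G.chance_sum h hc.1 hc.2.2 hc.2.1)

theorem confGame_proper (hplay : ∀ r, play r ∈ G.terminals) (hσ : ∀ j, σ j ∈ G.Strategy j)
    (t : ℕ) : (confGame G b play t).Proper G σ :=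
  Pseudogame.proper_of_nature hσ (expandedNodes_subset t) expandedNodes_tail
    (fun h _ _ a _ => empirical_nonneg t h a)
    (fun _ hh hc => sum_empirical hplay hh hc.2.1)

/-- The upper bounds of the confidence sequence for the utility `u`, given the reported
bounds `α` and `β`. -/
def optimistic (G : Game n A I) (play : ℕ → List A) (t : ℕ) (u α β : List A → ℝ) (h : List A) : ℝ :=
  if h ∈ expandedNodes G play t then
    u h + if G.IsChance h then radius G play t h * (β h - α h) else 0
  else β h

theorem confGame_upperVal (t : ℕ) (i : Fin n) :
    (confGame G b play t).upperVal G i σ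
      = (confGame G b play t).value G (optimistic G play t (G.util i) (b.lo i) (b.hi i)) σ := rfl

/-- Negating utilities and swapping the negated reported bounds exchanges lower and upper bounds.
Everything below is therefore proved for upper bounds only. -/
theorem confGame_lowerVal (t : ℕ) (i : Fin n) :
    (confGame G b play t).lowerVal G i σ
      = -(confGame G b play t).value G (optimistic G play t (fun h => -G.util i h)
          (fun h => -b.hi i h) (fun h => -b.lo i h)) σ := by
  rw [← Pseudogame.value_neg, Pseudogame.lowerVal]
  congr 1
  ext h
  simp only [confGame, optimistic, slack]
  split_ifs <;> ring

/-- A value function of the game is dominated by the confidence sequence. -/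
theorem le_value_optimistic (hplay : ∀ r, play r ∈ G.terminals) (hσ : ∀ j, σ j ∈ G.Strategy j)
    {t : ℕ} (hacc : Accurate G play t) {V u α β : List A → ℝ}
    (hV : ∀ h ∈ expandedNodes G play t,
      V h = u h + ∑ a ∈ G.actions h, G.step G.chance σ h a * V (a :: h))
    (hlo : ∀ h ∈ expandedNodes G play t, ∀ a ∈ G.actions h, α h ≤ u h + V (a :: h))
    (hhi : ∀ h ∈ expandedNodes G play t, ∀ a ∈ G.actions h, u h + V (a :: h) ≤ β h)
    (hleaf : ∀ h ∈ G.tree, h ∉ expandedNodes G play t → V h ≤ β h) :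
    V [] ≤ (confGame G b play t).value G (optimistic G play t u α β) σ := by
  have hP := confGame_proper (b := b) hplay hσ t
  -- `V` solves the recursion of the true chance probabilities but is telescoped with the empirical
  -- ones, so the two sides can be compared node by node with equal, nonnegative weights.
  rw [hP.value_eq, ← hP.telescope V]
  refine Finset.sum_le_sum fun h hh => mul_le_mul_of_nonneg_left ?_ (hP.reach_nonneg hh)
  change V h - (if h ∈ expandedNodes G play t then
    ∑ a ∈ G.actions h, G.step (empirical play t) σ h a * V (a :: h) else 0) ≤ _
  by_cases he : h ∈ expandedNodes G play t
  · rw [if_pos he, optimistic, if_pos he, hV h he]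
    by_cases hc : G.IsChance h
    · rw [if_pos hc]
      simp only [G.step_of_chance _ _ _ hc.2.2]
      -- Values at the children lie in the reported range at `h` shifted by `u h`, so the shift
      -- leaves the length of the range unchanged.
      have := sum_mul_le_of_range (J := G.actions h) (p := G.chance h) (q := empirical play t h)
        (v := fun a => V (a :: h)) (lo := α h - u h) (hi := β h - u h)
        (r := radius G play t h)
        (by rw [sum_empirical hplay he hc.2.1]; exact G.chance_sum h hc.1 hc.2.2 hc.2.1)
        (hacc h he hc) (fun a ha => by linarith [hlo h he a ha])
        (fun a ha => by linarith [hhi h he a ha]) hc.2.1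
      have h2 : β h - u h - (α h - u h) = β h - α h := by ring
      rw [h2] at this
      linarith
    · rw [if_neg hc]
      have : ∑ a ∈ G.actions h, G.step G.chance σ h a * V (a :: h)
          = ∑ a ∈ G.actions h, G.step (empirical play t) σ h a * V (a :: h) := by
        refine Finset.sum_congr rfl fun a ha => ?_
        rcases hp : G.player h with _ | j
        · exact absurd ⟨expandedNodes_subset t he, ⟨a, ha⟩, hp⟩ hc
        · rw [G.step_of_player _ _ a hp, G.step_of_player _ _ a hp]
      rw [this]; linarith
  · rw [if_neg he, optimistic, if_neg he, sub_zero]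
    exact hleaf h (Pseudogame.nodes_subset hh) he

/-- `α` and `β` bound the sums of `u` along the paths to terminal nodes. -/
structure PathBounds (G : Game n A I) (u α β : List A → ℝ) : Prop where
  lo_le : ∀ h ∈ G.tree, ∀ z ∈ G.terminals, h <:+ z → α h ≤ G.along u h z
  le_hi : ∀ h ∈ G.tree, ∀ z ∈ G.terminals, h <:+ z → G.along u h z ≤ β h

theorem Bounds.pathBounds (b : Bounds G) (i : Fin n) :
    PathBounds G (G.util i) (b.lo i) (b.hi i) := ⟨b.lo_le i, b.le_hi i⟩

variable {u α β : List A → ℝ}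

theorem PathBounds.neg (hb : PathBounds G u α β) :
    PathBounds G (fun h => -u h) (fun h => -β h) (fun h => -α h) :=
  ⟨fun h hh z hz hs => by rw [G.along_neg]; exact neg_le_neg (hb.le_hi h hh z hz hs),
    fun h hh z hz hs => by rw [G.along_neg]; exact neg_le_neg (hb.lo_le h hh z hz hs)⟩

theorem PathBounds.le (hb : PathBounds G u α β) {h : List A} (hh : h ∈ G.tree) : α h ≤ β h := by
  obtain ⟨z, hz, hs⟩ := G.exists_terminal h hh
  exact (hb.lo_le h hh z hz hs).trans (hb.le_hi h hh z hz hs)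

/-- The confidence sequence never excludes the reported bound at the root. -/
theorem PathBounds.lo_le_value (hb : PathBounds G u α β) (hplay : ∀ r, play r ∈ G.terminals)
    (hσ : ∀ j, σ j ∈ G.Strategy j) (t : ℕ) :
    α [] ≤ (confGame G b play t).value G (optimistic G play t u α β) σ := by
  have hP := confGame_proper (b := b) hplay hσ t
  -- Slack only adds to the utilities on an expanded path. At an unexpanded leaf the bound `β`
  -- dominates the rest of some path to a terminal node, so every leaf value is at least the utility
  -- of a complete path.
  have hexp : ∀ z ∈ expandedNodes G play t,
      G.along u [] z ≤ G.along (optimistic G play t u α β) [] z := by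
    intro z hz
    refine Finset.sum_le_sum fun g hg => ?_
    obtain ⟨hg1, -, hg2⟩ := Finset.mem_filter.1 hg
    obtain ⟨-, s, hs, hs'⟩ := mem_expandedNodes.1 hz
    rw [optimistic, if_pos (mem_expandedNodes.2 ⟨hg1, s, hs, hg2.trans hs'⟩)]
    split_ifs
    · have := mul_nonneg (radius_nonneg (G := G) (play := play) t g)
        (sub_nonneg.2 (hb.le hg1))
      linarith
    · linarith
  rw [← mul_one (α []), ← hP.sum_leaves, Finset.mul_sum, Pseudogame.value]
  refine Finset.sum_le_sum fun z hz => ?_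
  obtain ⟨hz1, hz2⟩ := Pseudogame.mem_leaves.1 hz
  rw [mul_comm]
  refine mul_le_mul_of_nonneg_left ?_ (hP.reach_nonneg hz1)
  have hzt := Pseudogame.nodes_subset hz1
  by_cases he : z ∈ expandedNodes G play t
  · have hzt' := G.mem_terminals.2 ⟨hzt, hz2.resolve_left (not_not.2 he)⟩
    exact (hb.lo_le [] G.root_mem z hzt' List.nil_suffix).trans (hexp z he)
  · obtain ⟨y, hy, hs⟩ := G.exists_terminal z hzt
    refine (hb.lo_le [] G.root_mem y hy List.nil_suffix).trans ?_
    cases z with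
    | nil =>
      rw [G.along_self _ hzt, optimistic, if_neg he]
      exact hb.le_hi [] hzt y hy hs
    | cons a h =>
      have h1 : h ∈ expandedNodes G play t := (Pseudogame.cons_mem_nodes.1 hz1).2
      rw [G.along_append u (G.mem_terminals.1 hy).1 hs,
        G.along_cons_right _ hzt List.nil_suffix, optimistic, if_neg he]
      linarith [hexp h h1, hb.le_hi _ hzt y hy hs]

theorem Pseudogame.cont_neg (P : Pseudogame n A) (f : List A → ℝ) (h : List A) :
    P.cont G (fun g => -f g) σ h = -P.cont G f σ h := by
  have : ∀ k h, P.contAux G (fun g => -f g) σ k h = -P.contAux G f σ k h := by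
    intro k
    induction k with
    | zero => intro h; rfl
    | succ k ih =>
      intro h
      simp only [Pseudogame.contAux, ih]
      split_ifs
      · simp; ring
      · simp
  exact this _ _

/-- A convex combination is at most a common upper bound. -/
theorem Pseudogame.Proper.sum_step_le {P : Pseudogame n A} (hP : P.Proper G σ) {h : List A}
    (hh : h ∈ P.expanded) (hne : (G.actions h).Nonempty) {v : A → ℝ} {C : ℝ}
    (hv : ∀ a ∈ G.actions h, v a ≤ C) : ∑ a ∈ G.actions h, G.step P.nature σ h a * v a ≤ C := by
  rw [← one_mul C, ← hP.sum_one h hh hne, Finset.sum_mul]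
  exact Finset.sum_le_sum fun a ha => mul_le_mul_of_nonneg_left (hv a ha) (hP.nonneg h hh a ha)

theorem fullGame_cont_eq (f : List A → ℝ) {h : List A} (hh : h ∈ G.tree) :
    (fullGame G).cont G f σ h
      = f h + ∑ a ∈ G.actions h, G.step G.chance σ h a * (fullGame G).cont G f σ (a :: h) := by
  rw [Pseudogame.cont_eq, if_pos (show h ∈ (fullGame G).expanded from hh)]
  rfl

theorem fullGame_cont_le (hσ : ∀ j, σ j ∈ G.Strategy j) (f : List A → ℝ) :
    ∀ h ∈ G.tree, ∀ C, (∀ z ∈ G.terminals, h <:+ z → G.along f h z ≤ C) →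
      (fullGame G).cont G f σ h ≤ C := by
  refine G.tree_induction fun h hh ih C hC => ?_
  rw [fullGame_cont_eq f hh]
  rcases (G.actions h).eq_empty_or_nonempty with h0 | h0
  · rw [h0, Finset.sum_empty, add_zero, ← G.along_self f hh]
    exact hC h (G.mem_terminals.2 ⟨hh, h0⟩) List.suffix_rfl
  · have := (fullGame_proper hσ).sum_step_le (h := h) hh h0
      (v := fun a => (fullGame G).cont G f σ (a :: h)) (C := C - f h) (fun a ha => by
        refine ih a ha _ fun z hz hs => ?_
        have := hC z hz ((List.suffix_cons a h).trans hs)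
        rw [G.along_cons_left f (G.mem_terminals.1 hz).1 hs] at this
        linarith)
    change ∑ a ∈ G.actions h, G.step G.chance σ h a * _ ≤ _ at this
    linarith

/-- The bound at `h` covers all complete paths through `h`, hence their averages after any action.
For true utilities the bounds at `h` and at its children need no relation, so nestedness is not
required. -/
theorem PathBounds.add_cont_le (hb : PathBounds G u α β) (hσ : ∀ j, σ j ∈ G.Strategy j)
    {h : List A} (hh : h ∈ G.tree) {a : A} (ha : a ∈ G.actions h) :
    u h + (fullGame G).cont G u σ (a :: h) ≤ β h := by
  have := fullGame_cont_le hσ u (a :: h) (G.mem_actions.1 ha) (β h - u h) fun z hz hs => by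
    have := hb.le_hi h hh z hz ((List.suffix_cons a h).trans hs)
    rw [G.along_cons_left u (G.mem_terminals.1 hz).1 hs] at this
    linarith
  linarith

theorem PathBounds.cont_le (hb : PathBounds G u α β) (hσ : ∀ j, σ j ∈ G.Strategy j)
    {h : List A} (hh : h ∈ G.tree) : (fullGame G).cont G u σ h ≤ β h :=
  fullGame_cont_le hσ u h hh _ (hb.le_hi h hh)

theorem PathBounds.full_le (hb : PathBounds G u α β) (hplay : ∀ r, play r ∈ G.terminals)
    (hσ : ∀ j, σ j ∈ G.Strategy j) {t : ℕ} (hacc : Accurate G play t) :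
    (fullGame G).value G u σ ≤ (confGame G b play t).value G (optimistic G play t u α β) σ := by
  rw [(fullGame_proper hσ).value_eq_cont]
  refine le_value_optimistic hplay hσ hacc (fun h hh => fullGame_cont_eq u
    (expandedNodes_subset t hh)) (fun h hh a ha => ?_)
    (fun h hh a ha => hb.add_cont_le hσ (expandedNodes_subset t hh) ha)
    (fun h hh _ => hb.cont_le hσ hh)
  have := hb.neg.add_cont_le hσ (expandedNodes_subset t hh) ha
  rw [Pseudogame.cont_neg] at this
  linarith

theorem PathBounds.full_le_hi (hb : PathBounds G u α β) (hσ : ∀ j, σ j ∈ G.Strategy j) :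
    (fullGame G).value G u σ ≤ β [] := by
  rw [(fullGame_proper hσ).value_eq_cont]
  exact hb.cont_le hσ G.root_mem

/-- The reported bounds get tighter along every path. -/
def NestedBounds (G : Game n A I) (u α β : List A → ℝ) : Prop :=
  ∀ a h, a :: h ∈ G.tree → α h ≤ u h + α (a :: h) ∧ u h + β (a :: h) ≤ β h

theorem NestedBounds.neg (hn : NestedBounds G u α β) :
    NestedBounds G (fun h => -u h) (fun h => -β h) (fun h => -α h) := by
  intro a h hh
  obtain ⟨h1, h2⟩ := hn a h hh
  constructor <;> linarith

/-- the utilities at the expanded nodes, and the reported bounds elsewhere -/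
def truncated (G : Game n A I) (play : ℕ → List A) (t : ℕ) (u β : List A → ℝ) (h : List A) : ℝ :=
  if h ∈ expandedNodes G play t then u h else β h

theorem exactGame_cont_eq {T : ℕ} (f : List A → ℝ) (h : List A) :
    (exactGame G b play T).cont G f σ h = f h + if h ∈ expandedNodes G play T then
      ∑ a ∈ G.actions h, G.step G.chance σ h a * (exactGame G b play T).cont G f σ (a :: h)
      else 0 := Pseudogame.cont_eq f h

/-- Continuation values of the truncated game use reported bounds at its leaves instead of
utilities. Nestedness passes these bounds up the tree, from the children to their parent. -/
theorem PathBounds.exact_cont_mem (hb : PathBounds G u α β) (hn : NestedBounds G u α β)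
    (hσ : ∀ j, σ j ∈ G.Strategy j) (T : ℕ) : ∀ h ∈ G.tree,
      α h ≤ (exactGame G b play T).cont G (truncated G play T u β) σ h ∧
      (exactGame G b play T).cont G (truncated G play T u β) σ h ≤ β h := by
  have hP := exactGame_proper (b := b) (play := play) hσ T
  refine G.tree_induction fun h hh ih => ?_
  rw [exactGame_cont_eq, truncated]
  by_cases he : h ∈ expandedNodes G play T
  · rw [if_pos he, if_pos he]
    rcases (G.actions h).eq_empty_or_nonempty with h0 | h0
    · rw [h0, Finset.sum_empty, add_zero, ← G.along_self u hh]
      exact ⟨hb.lo_le h hh h (G.mem_terminals.2 ⟨hh, h0⟩) List.suffix_rfl,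
        hb.le_hi h hh h (G.mem_terminals.2 ⟨hh, h0⟩) List.suffix_rfl⟩
    · set v := fun a => (exactGame G b play T).cont G (truncated G play T u β) σ (a :: h)
      have h1 := hP.sum_step_le (h := h) he h0 (v := v) (C := β h - u h) fun a ha => by
        linarith [(ih a ha).2, (hn a h (G.mem_actions.1 ha)).2]
      have h2 := hP.sum_step_le (h := h) he h0 (v := fun a => -v a) (C := u h - α h)
        fun a ha => by linarith [(ih a ha).1, (hn a h (G.mem_actions.1 ha)).1]
      simp only [mul_neg, Finset.sum_neg_distrib] at h2
      change ∑ a ∈ G.actions h, G.step G.chance σ h a * _ ≤ _ at h1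
      change -∑ a ∈ G.actions h, G.step G.chance σ h a * _ ≤ _ at h2
      constructor <;> linarith
  · rw [if_neg he, if_neg he, add_zero]
    exact ⟨hb.le hh, le_rfl⟩

/-- Nodes expanded at time `t` are still expanded at time `T`, so the continuation value of the
later pseudogame satisfies the required recursion on the earlier, smaller tree. This allows the
bounds of every past round to be compared with one final pseudogame. -/
theorem PathBounds.exact_le (hb : PathBounds G u α β) (hn : NestedBounds G u α β)
    (hplay : ∀ r, play r ∈ G.terminals) (hσ : ∀ j, σ j ∈ G.Strategy j) {t T : ℕ} (ht : t ≤ T)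
    (hacc : Accurate G play t) :
    (exactGame G b play T).value G (truncated G play T u β) σ
      ≤ (confGame G b play t).value G (optimistic G play t u α β) σ := by
  rw [(exactGame_proper hσ T).value_eq_cont]
  have hmem := hb.exact_cont_mem (b := b) (play := play) hn hσ T
  refine le_value_optimistic hplay hσ hacc (fun h hh => ?_) (fun h hh a ha => ?_)
    (fun h hh a ha => ?_) (fun h hh _ => (hmem h hh).2)
  · have := expandedNodes_mono ht hh
    rw [exactGame_cont_eq, truncated, if_pos this, if_pos this]
  · have h1 := G.mem_actions.1 ha
    linarith [(hmem _ h1).1, (hn a h h1).1]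
  · have h1 := G.mem_actions.1 ha
    linarith [(hmem _ h1).2, (hn a h h1).2]

theorem PathBounds.exact_le_hi (hb : PathBounds G u α β) (hn : NestedBounds G u α β)
    (hσ : ∀ j, σ j ∈ G.Strategy j) (T : ℕ) :
    (exactGame G b play T).value G (truncated G play T u β) σ ≤ β [] := by
  rw [(exactGame_proper hσ T).value_eq_cont]
  exact (hb.exact_cont_mem hn hσ T [] G.root_mem).2

variable (b play) in
/-- The values of `Q` are within the bounds of the confidence sequence at time `t` if the empirical
frequencies are accurate, and in any case within one of them. -/
structure Encloses (t : ℕ) (Q : Pseudogame n A) : Prop where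
  upper : ∀ i, ∀ σ : Fin n → I → A → ℝ, (∀ j, σ j ∈ G.Strategy j) → Accurate G play t →
    Q.upperVal G i σ ≤ (confGame G b play t).upperVal G i σ
  lower : ∀ i, ∀ σ : Fin n → I → A → ℝ, (∀ j, σ j ∈ G.Strategy j) → Accurate G play t →
    (confGame G b play t).lowerVal G i σ ≤ Q.lowerVal G i σ
  upper_add_one : ∀ i, ∀ σ : Fin n → I → A → ℝ, (∀ j, σ j ∈ G.Strategy j) →
    Q.upperVal G i σ ≤ (confGame G b play t).upperVal G i σ + 1
  lower_add_one : ∀ i, ∀ σ : Fin n → I → A → ℝ, (∀ j, σ j ∈ G.Strategy j) →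
    (confGame G b play t).lowerVal G i σ ≤ Q.lowerVal G i σ + 1

theorem encloses_fullGame (hplay : ∀ r, play r ∈ G.terminals) (t : ℕ) :
    Encloses b play t (fullGame G) := by
  have hneg : ∀ (i : Fin n) (σ : Fin n → I → A → ℝ),
      (fullGame G).lowerVal G i σ = -(fullGame G).value G (fun h => -G.util i h) σ := by
    intro i σ
    rw [Pseudogame.value_neg, neg_neg]; rfl
  refine ⟨fun i σ hσ hacc => (b.pathBounds i).full_le hplay hσ hacc, fun i σ hσ hacc => ?_,
    fun i σ hσ => ?_, fun i σ hσ => ?_⟩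
  · rw [confGame_lowerVal, hneg]
    exact neg_le_neg ((b.pathBounds i).neg.full_le hplay hσ hacc)
  -- Without accuracy only the root bounds are available: the true value is at most `β []`, the
  -- confidence bound is at least `α []`, and these differ by at most one.
  · have h1 := (b.pathBounds i).full_le_hi hσ
    have h2 := (b.pathBounds i).lo_le_value (b := b) hplay hσ t
    have h3 := b.range_le i [] G.root_mem
    rw [confGame_upperVal]
    change (fullGame G).value G (G.util i) σ ≤ _
    linarith
  · have h1 := (b.pathBounds i).neg.full_le_hi hσ
    have h2 := (b.pathBounds i).neg.lo_le_value (b := b) hplay hσ t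
    have h3 := b.range_le i [] G.root_mem
    rw [confGame_lowerVal, hneg]
    linarith

theorem encloses_exactGame (hn : b.Nested) (hplay : ∀ r, play r ∈ G.terminals) {t T : ℕ}
    (ht : t ≤ T) : Encloses b play t (exactGame G b play T) := by
  have hn' : ∀ i, NestedBounds G (G.util i) (b.lo i) (b.hi i) := hn
  have hneg : ∀ (i : Fin n) (σ : Fin n → I → A → ℝ), (exactGame G b play T).lowerVal G i σ
      = -(exactGame G b play T).value G
        (truncated G play T (fun h => -G.util i h) (fun h => -b.lo i h)) σ := by
    intro i σ
    rw [← Pseudogame.value_neg, Pseudogame.lowerVal]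
    congr 1
    ext h
    simp only [exactGame, truncated]
    split_ifs <;> ring
  refine ⟨fun i σ hσ hacc => (b.pathBounds i).exact_le (hn' i) hplay hσ ht hacc,
    fun i σ hσ hacc => ?_, fun i σ hσ => ?_, fun i σ hσ => ?_⟩
  · rw [confGame_lowerVal, hneg]
    exact neg_le_neg ((b.pathBounds i).neg.exact_le (hn' i).neg hplay hσ ht hacc)
  · have h1 := (b.pathBounds i).exact_le_hi (b := b) (play := play) (hn' i) hσ T
    have h2 := (b.pathBounds i).lo_le_value (b := b) hplay hσ t
    have h3 := b.range_le i [] G.root_mem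
    rw [confGame_upperVal]
    change (exactGame G b play T).value G (truncated G play T (G.util i) (b.hi i)) σ ≤ _
    linarith
  · have h1 := (b.pathBounds i).neg.exact_le_hi (b := b) (play := play) (hn' i).neg hσ T
    have h2 := (b.pathBounds i).neg.lo_le_value (b := b) hplay hσ t
    have h3 := b.range_le i [] G.root_mem
    rw [confGame_lowerVal, hneg]
    linarith

end Games

/-! ### Functions of finitely many playthroughs -/

section History

variable {Ω : Type w} {A : Type u} {pl : ℕ → Ω → List A} {S : Finset (List A)}

/-- the sequence that starts with the given `t` terms -/
def extendHistory {t : ℕ} (c : Fin t → List A) (r : ℕ) : List A :=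
  if h : r < t then c ⟨r, h⟩ else []

/-- Only finitely many histories of length `t` exist, so a function of the history is a finite sum
of pieces on events that fix the history. Measurability and boundedness of everything built from the
plays reduce to this. -/
theorem eq_sum_histories (hmem : ∀ r ω, pl r ω ∈ S) {t : ℕ} {F : (ℕ → List A) → Ω → ℝ}
    (hdep : ∀ p p' : ℕ → List A, (∀ r < t, p r = p' r) → F p = F p') (ω : Ω) :
    F (fun r => pl r ω) ω = ∑ c ∈ Fintype.piFinset fun _ : Fin t => S,
      Set.indicator {ω | ∀ r : Fin t, pl r ω = c r} (F (extendHistory c)) ω := by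
  rw [Finset.sum_eq_single_of_mem (fun r : Fin t => pl r ω)
    (Fintype.mem_piFinset.2 fun r => hmem r ω)]
  · rw [Set.indicator_of_mem (by simp)]
    refine congrFun (hdep _ _ fun r hr => ?_) ω
    simp [extendHistory, hr]
  · intro c _ hc
    rw [Set.indicator_of_notMem]
    exact fun h => hc (funext fun r => (h r).symm)

theorem measurable_of_history [MeasurableSpace Ω] (hmem : ∀ r ω, pl r ω ∈ S) {t : ℕ}
    (hpl : ∀ r < t, ∀ z, MeasurableSet {ω | pl r ω = z}) {F : (ℕ → List A) → Ω → ℝ}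
    (hF : ∀ p, Measurable (F p))
    (hdep : ∀ p p' : ℕ → List A, (∀ r < t, p r = p' r) → F p = F p') :
    Measurable fun ω => F (fun r => pl r ω) ω := by
  simp only [eq_sum_histories hmem hdep]
  refine Finset.measurable_sum _ fun c _ => (hF _).indicator ?_
  rw [Set.ofPred_forall]
  exact MeasurableSet.iInter fun r => hpl r r.2 _

theorem exists_bound_of_history (hmem : ∀ r ω, pl r ω ∈ S) {t : ℕ} {F : (ℕ → List A) → ℝ}
    (hdep : ∀ p p' : ℕ → List A, (∀ r < t, p r = p' r) → F p = F p') :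
    ∃ C, ∀ ω, |F (fun r => pl r ω)| ≤ C := by
  refine ⟨∑ c ∈ Fintype.piFinset fun _ : Fin t => S, |F (extendHistory c)|, fun ω => ?_⟩
  have h1 := eq_sum_histories (F := fun p _ => F p) hmem
    (fun p p' h => funext fun _ => hdep p p' h) ω
  rw [h1]
  refine (Finset.abs_sum_le_sum_abs _ _).trans (Finset.sum_le_sum fun c _ => ?_)
  rw [Set.indicator_apply]
  split_ifs
  · exact le_rfl
  · simp

end History

theorem integrable_of_bounded {Ω : Type w} [MeasurableSpace Ω] {μ : Measure Ω} [IsFiniteMeasure μ]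
    {f : Ω → ℝ} (hf : Measurable f) {C : ℝ} (hC : ∀ ω, |f ω| ≤ C) : Integrable f μ :=
  Integrable.of_bound hf.aestronglyMeasurable C (Filter.Eventually.of_forall hC)

/-- Testing a conditional expectation against a bounded function. -/
theorem integral_mul_of_condExp {Ω : Type w} {m mΩ : MeasurableSpace Ω} (hm : m ≤ mΩ)
    {μ : Measure Ω} [IsFiniteMeasure μ] {X Y Z : Ω → ℝ} (hZ : Measurable[m] Z) {C : ℝ}
    (hC : ∀ ω, |Z ω| ≤ C) (hX : Integrable X μ) (hXY : μ[X | m] =ᵐ[μ] Y) :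
    ∫ ω, Z ω * X ω ∂μ = ∫ ω, Z ω * Y ω ∂μ := by
  have hZX : Integrable (Z * X) μ :=
    hX.bdd_mul (hZ.mono hm le_rfl).aestronglyMeasurable (Filter.Eventually.of_forall hC)
  have h1 := condExp_mul_of_stronglyMeasurable_left hZ.stronglyMeasurable hZX hX
  change ∫ ω, (Z * X) ω ∂μ = _
  rw [← integral_condExp hm]
  refine integral_congr_ae ?_
  filter_upwards [h1, hXY] with ω h2 h3
  rw [h2, Pi.mul_apply, h3]

/-! ### Exponential factors for the moves of nature -/

section Reach

variable {n : ℕ} {A : Type u} {I : Type v} (G : Game n A I)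

theorem leaves_fullGame : (fullGame G).leaves G = G.terminals := by
  ext z
  rw [Pseudogame.mem_leaves, G.mem_terminals, Pseudogame.mem_nodes]
  change (z ∈ G.tree ∧ (z = [] ∨ z.tail ∈ G.tree)) ∧ (z ∉ G.tree ∨ _) ↔ _
  constructor
  · rintro ⟨⟨h1, -⟩, h2⟩
    exact ⟨h1, h2.resolve_left (not_not.2 h1)⟩
  · rintro ⟨h1, h2⟩
    refine ⟨⟨h1, ?_⟩, Or.inr h2⟩
    cases z with
    | nil => exact Or.inl rfl
    | cons a z => exact Or.inr (G.parent_mem a z h1)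

theorem nodes_fullGame : (fullGame G).nodes G = G.tree := by
  ext z
  rw [Pseudogame.mem_nodes]
  change z ∈ G.tree ∧ (z = [] ∨ z.tail ∈ G.tree) ↔ _
  refine ⟨fun h => h.1, fun h => ⟨h, ?_⟩⟩
  cases z with
  | nil => exact Or.inl rfl
  | cons a z => exact Or.inr (G.parent_mem a z h)

variable {G} {σ : Fin n → I → A → ℝ}

theorem sum_reach_terminals (hσ : ∀ j, σ j ∈ G.Strategy j) {h : List A} (hh : h ∈ G.tree) :
    ∑ z ∈ G.terminals, (if h <:+ z then G.reach G.chance σ z else 0) = G.reach G.chance σ h := by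
  rw [← leaves_fullGame]
  exact (fullGame_proper hσ).sum_reach_leaves (by rwa [nodes_fullGame])

theorem sum_terminals (hσ : ∀ j, σ j ∈ G.Strategy j) :
    ∑ z ∈ G.terminals, G.reach G.chance σ z = 1 := by
  rw [← leaves_fullGame]
  exact (fullGame_proper hσ).sum_leaves

theorem reach_nonneg (hσ : ∀ j, σ j ∈ G.Strategy j) {h : List A} (hh : h ∈ G.tree) :
    0 ≤ G.reach G.chance σ h :=
  (fullGame_proper hσ).reach_nonneg (by rwa [nodes_fullGame])

theorem reach_le_one (hσ : ∀ j, σ j ∈ G.Strategy j) {h : List A} (hh : h ∈ G.tree) :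
    G.reach G.chance σ h ≤ 1 :=
  (fullGame_proper hσ).reach_le_one (by rwa [nodes_fullGame])

/-- `κ` of the action that the path to `z` takes at `h`; one if the path avoids `h`. -/
def nextFactor (G : Game n A I) (κ : A → ℝ) (h z : List A) : ℝ :=
  ∑ a ∈ G.actions h, (if a :: h <:+ z then κ a else 0) + if h <:+ z then 0 else 1

/-- With the probability of missing `h` the factor is one, and given a visit its mean is the mean of
`κ` under nature. So the mean is at most one whatever the players do. -/
theorem sum_reach_nextFactor (hσ : ∀ j, σ j ∈ G.Strategy j) {h : List A} (hc : G.IsChance h)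
    {κ : A → ℝ} (hκ : ∑ a ∈ G.actions h, G.chance h a * κ a ≤ 1) :
    ∑ z ∈ G.terminals, G.reach G.chance σ z * nextFactor G κ h z ≤ 1 := by
  have h1 : ∑ z ∈ G.terminals, G.reach G.chance σ z *
      ∑ a ∈ G.actions h, (if a :: h <:+ z then κ a else 0)
      = G.reach G.chance σ h * ∑ a ∈ G.actions h, G.chance h a * κ a := by
    simp only [Finset.mul_sum]
    rw [Finset.sum_comm]
    refine Finset.sum_congr rfl fun a ha => ?_
    have := sum_reach_terminals hσ (G.mem_actions.1 ha)
    rw [G.reach_cons, G.step_of_chance _ _ a hc.2.2] at this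
    rw [← mul_assoc, ← this, Finset.sum_mul]
    refine Finset.sum_congr rfl fun z _ => ?_
    split_ifs <;> simp
  have h2 : ∑ z ∈ G.terminals, G.reach G.chance σ z * (if h <:+ z then 0 else 1)
      = 1 - G.reach G.chance σ h := by
    rw [← sum_terminals hσ, ← sum_reach_terminals hσ hc.1, ← Finset.sum_sub_distrib]
    refine Finset.sum_congr rfl fun z _ => ?_
    by_cases hz : h <:+ z <;> simp [hz, sum_terminals hσ]
  simp only [nextFactor, mul_add, Finset.sum_add_distrib]
  rw [h1, h2]
  have := mul_le_mul_of_nonneg_left hκ (reach_nonneg hσ hc.1)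
  linarith

theorem nextFactor_nonneg {κ : A → ℝ} (hκ : ∀ a, 0 ≤ κ a) (h z : List A) :
    0 ≤ nextFactor G κ h z := by
  refine add_nonneg (Finset.sum_nonneg fun a _ => ?_) ?_
  · split_ifs
    · exact hκ a
    · exact le_rfl
  · split_ifs <;> norm_num

theorem nextFactor_of_not_suffix {κ : A → ℝ} {h z : List A} (hz : ¬ h <:+ z) :
    nextFactor G κ h z = 1 := by
  rw [nextFactor, if_neg hz, Finset.sum_eq_zero, zero_add]
  exact fun a _ => if_neg fun h1 => hz ((List.suffix_cons a h).trans h1)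

theorem nextFactor_exp {h z : List A} (hz : z ∈ G.terminals) (hne : (G.actions h).Nonempty)
    (c : A → ℝ) : nextFactor G (fun a => Real.exp (c a)) h z
      = Real.exp (∑ a ∈ G.actions h, if a :: h <:+ z then c a else 0) := by
  rw [nextFactor, G.sum_next hz hne, G.sum_next hz hne]
  split_ifs <;> simp

/-- The factor of a playthrough, stopped after `m` visits to `h`. -/
def visitFactor (G : Game n A I) (κ : A → ℝ) (h : List A) (m t : ℕ) (p : ℕ → List A)
    (z : List A) : ℝ :=
  if visits p t h < m then nextFactor G κ h z else 1

/-- The factors equal one once `h` has been visited `m` times. The product up to the fixed horizon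
`T` therefore records the action counts at every time `s` with exactly `m` visits, and at the
horizon if there are fewer. One Markov inequality at time `T` then controls all these random times
together. -/
theorem prod_visitFactor {play : ℕ → List A} (hplay : ∀ r, play r ∈ G.terminals) {h : List A}
    (hne : (G.actions h).Nonempty) (c : A → ℝ) {m s T : ℕ} (hsT : s ≤ T)
    (hm : visits play s h ≤ m) (hm' : m ≤ visits play s h ∨ s = T) :
    ∏ r ∈ Finset.range T, visitFactor G (fun a => Real.exp (c a)) h m r play (play r)
      = Real.exp (∑ a ∈ G.actions h, visits play s (a :: h) * c a) := by
  rw [← Finset.prod_range_mul_prod_Ico _ hsT]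
  have h1 : ∏ r ∈ Finset.Ico s T, visitFactor G (fun a => Real.exp (c a)) h m r play (play r)
      = 1 := by
    refine Finset.prod_eq_one fun r hr => ?_
    rw [Finset.mem_Ico] at hr
    rcases hm' with h' | rfl
    · rw [visitFactor, if_neg]
      have := visits_mono (play := play) hr.1 h
      omega
    · omega
  have h2 : ∀ k ≤ s,
      ∏ r ∈ Finset.range k, visitFactor G (fun a => Real.exp (c a)) h m r play (play r)
      = Real.exp (∑ a ∈ G.actions h, visits play k (a :: h) * c a) := by
    intro k
    induction k with
    | zero => intro _; simp [visits]
    | succ k ih =>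
      intro hk
      rw [Finset.prod_range_succ, ih (by omega)]
      have h3 : visitFactor G (fun a => Real.exp (c a)) h m k play (play k)
          = nextFactor G (fun a => Real.exp (c a)) h (play k) := by
        rw [visitFactor]
        split_ifs with hv
        · rfl
        · rw [nextFactor_of_not_suffix]
          intro hs
          have h4 := visits_mono (play := play) hk h
          rw [visits_succ, if_pos hs] at h4
          omega
      rw [h3, nextFactor_exp (hplay k) hne, ← Real.exp_add, ← Finset.sum_add_distrib]
      congr 1
      refine Finset.sum_congr rfl fun a _ => ?_
      rw [visits_succ]
      split_ifs <;> push_cast <;> ring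
  rw [h1, mul_one, h2 s le_rfl]

end Reach

/-! ### Measurability in a run and the supermartingale bound -/

namespace Run

variable {n : ℕ} {A : Type u} {I : Type v} {G : Game n A I} {b : Bounds G}
  {Ω : Type w} [mΩ : MeasurableSpace Ω] {μ : Measure Ω} (R : Run G b μ)

theorem mid_le_top (t : ℕ) : R.𝒢 t ≤ mΩ := (R.mid_le t).trans (R.ℱ.le _)

theorem measurableSet_play_of_lt {r t : ℕ} (hr : r < t) (z : List A) :
    MeasurableSet[R.ℱ t] {ω | R.play r ω = z} :=
  (R.mid_le r).trans (R.ℱ.mono hr) _ (R.play_meas r z)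

theorem measurableSet_play (r : ℕ) (z : List A) : MeasurableSet {ω | R.play r ω = z} :=
  R.mid_le_top r _ (R.play_meas r z)

theorem measurableSet_play_mid {r t : ℕ} (hr : r < t + 1) (z : List A) :
    MeasurableSet[R.𝒢 t] {ω | R.play r ω = z} := by
  rcases Nat.lt_succ_iff_lt_or_eq.1 hr with h | rfl
  · exact R.le_mid t _ (R.measurableSet_play_of_lt h z)
  · exact R.play_meas _ z

/-- Functions of the first `t` playthroughs are known after `t` rounds. -/
theorem measurable_history {t : ℕ} {F : (ℕ → List A) → Ω → ℝ}
    (hF : ∀ p, Measurable[R.ℱ t] (F p))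
    (hdep : ∀ p p' : ℕ → List A, (∀ r < t, p r = p' r) → F p = F p') :
    Measurable[R.ℱ t] fun ω => F (fun r => R.play r ω) ω :=
  @measurable_of_history Ω A R.play G.terminals (R.ℱ t) R.play_mem t
    (fun _ hr z => R.measurableSet_play_of_lt hr z) F hF hdep

theorem measurable_history_mid {t : ℕ} {F : (ℕ → List A) → Ω → ℝ}
    (hF : ∀ p, Measurable[R.𝒢 t] (F p))
    (hdep : ∀ p p' : ℕ → List A, (∀ r < t + 1, p r = p' r) → F p = F p') :
    Measurable[R.𝒢 t] fun ω => F (fun r => R.play r ω) ω :=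
  @measurable_of_history Ω A R.play G.terminals (R.𝒢 t) R.play_mem (t + 1)
    (fun _ hr z => R.measurableSet_play_mid hr z) F hF hdep

theorem exists_bound {t : ℕ} {F : (ℕ → List A) → ℝ}
    (hdep : ∀ p p' : ℕ → List A, (∀ r < t, p r = p' r) → F p = F p') :
    ∃ C, ∀ ω, |F (fun r => R.play r ω)| ≤ C :=
  exists_bound_of_history R.play_mem hdep

theorem measurable_reach (t : ℕ) (nat : List A → A → ℝ) (z : List A) :
    Measurable[R.ℱ t] fun ω => G.reach nat (R.σ t ω) z := by
  induction z with
  | nil => exact measurable_const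
  | cons a h ih =>
    simp only [G.reach_cons]
    refine Measurable.mul ih ?_
    rcases hp : G.player h with _ | j
    · simp only [G.step_of_chance _ _ a hp]
      exact measurable_const
    · simp only [G.step_of_player _ _ a hp]
      exact R.σ_meas t j _ a

variable [IsProbabilityMeasure μ]

/-- The law of a playthrough, tested against what was known before. -/
theorem integral_play (t : ℕ) {f : Ω → List A → ℝ} (hf : ∀ z, Measurable[R.ℱ t] fun ω => f ω z)
    {C : ℝ} (hC : ∀ ω z, |f ω z| ≤ C) :
    ∫ ω, f ω (R.play t ω) ∂μ
      = ∫ ω, ∑ z ∈ G.terminals, G.reach G.chance (R.σ t ω) z * f ω z ∂μ := by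
  have h1 : ∀ ω, f ω (R.play t ω) = ∑ z ∈ G.terminals,
      f ω z * Set.indicator {ω | R.play t ω = z} (fun _ => (1 : ℝ)) ω := by
    intro ω
    rw [Finset.sum_eq_single_of_mem _ (R.play_mem t ω)]
    · simp
    · intro z _ hz
      rw [Set.indicator_of_notMem, mul_zero]
      exact fun h => hz h.symm
  simp only [h1]
  have hind : ∀ z, Integrable (Set.indicator {ω | R.play t ω = z} fun _ => (1 : ℝ)) μ :=
    fun z => (integrable_const 1).indicator (R.measurableSet_play t z)
  have hf' : ∀ z, Measurable fun ω => f ω z := fun z => (hf z).mono (R.ℱ.le t) le_rfl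
  rw [integral_finsetSum, integral_finsetSum]
  · refine Finset.sum_congr rfl fun z hz => ?_
    rw [integral_mul_of_condExp (R.ℱ.le t) (hf z) (fun ω => hC ω z) (hind z) (R.play_law t z hz)]
    simp only [mul_comm]
  · intro z hz
    refine ((integrable_of_bounded (hf' z) fun ω => hC ω z).bdd_mul
      ((R.measurable_reach t G.chance z).mono (R.ℱ.le t) le_rfl).aestronglyMeasurable
      (c := 1) (Filter.Eventually.of_forall fun ω => ?_))
    have hzt := (G.mem_terminals.1 hz).1
    rw [Real.norm_eq_abs, abs_of_nonneg (reach_nonneg (R.σ_mem t ω) hzt)]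
    exact reach_le_one (R.σ_mem t ω) hzt
  · intro z _
    exact (hind z).bdd_mul (hf' z).aestronglyMeasurable
      (Filter.Eventually.of_forall fun ω => hC ω z)

/-- The probability of visiting a node, tested against what was known before. -/
theorem integral_reach (t : ℕ) {h : List A} (hh : h ∈ G.tree) {Z : Ω → ℝ}
    (hZ : Measurable[R.ℱ t] Z) {C : ℝ} (hC : ∀ ω, |Z ω| ≤ C) :
    ∫ ω, G.reach G.chance (R.σ t ω) h * Z ω ∂μ
      = ∫ ω, (if h <:+ R.play t ω then Z ω else 0) ∂μ := by
  have hC0 : 0 ≤ C := by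
    obtain ⟨ω⟩ := μ.nonempty_of_neZero
    exact (abs_nonneg _).trans (hC ω)
  rw [R.integral_play t (f := fun ω z => if h <:+ z then Z ω else 0) (C := C)]
  · congr 1
    ext ω
    rw [← sum_reach_terminals (R.σ_mem t ω) hh, Finset.sum_mul]
    refine Finset.sum_congr rfl fun z _ => ?_
    split_ifs <;> simp
  · intro z
    split_ifs
    · exact hZ
    · exact measurable_const
  · intro ω z
    split_ifs
    · exact hC ω
    · simpa using hC0

/-- A product of factors with conditional means at most one has mean at most one. -/
theorem integral_prod_le_one {φ : ℕ → (ℕ → List A) → List A → ℝ}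
    (hdep : ∀ t p p', (∀ r < t, p r = p' r) → φ t p = φ t p')
    (hnn : ∀ t p z, 0 ≤ φ t p z)
    (hsum : ∀ t p (σ : Fin n → I → A → ℝ), (∀ j, σ j ∈ G.Strategy j) →
      ∑ z ∈ G.terminals, G.reach G.chance σ z * φ t p z ≤ 1) (T : ℕ) :
    ∫ ω, ∏ r ∈ Finset.range T, φ r (fun r => R.play r ω) (R.play r ω) ∂μ ≤ 1 := by
  induction T with
  | zero => simp
  | succ T ih =>
    set Φ : (ℕ → List A) → ℝ := fun p => ∏ r ∈ Finset.range T, φ r p (p r) with hΦ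
    have hΦdep : ∀ p p' : ℕ → List A, (∀ r < T, p r = p' r) → Φ p = Φ p' := by
      intro p p' h
      refine Finset.prod_congr rfl fun r hr => ?_
      have hr' := Finset.mem_range.1 hr
      rw [hdep r p p' fun s hs => h s (hs.trans hr'), h r hr']
    have hΦnn : ∀ p, 0 ≤ Φ p := fun p => Finset.prod_nonneg fun r _ => hnn r p _
    have hfdep : ∀ z, ∀ p p' : ℕ → List A, (∀ r < T, p r = p' r) →
        Φ p * φ T p z = Φ p' * φ T p' z := by
      intro z p p' h
      rw [hΦdep p p' h, hdep T p p' h]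
    have hb : ∃ C, ∀ ω, ∀ z ∈ G.terminals, |Φ (fun r => R.play r ω) *
        φ T (fun r => R.play r ω) z| ≤ C := by
      choose C hC using fun z => R.exists_bound (hfdep z)
      refine ⟨∑ z ∈ G.terminals, |C z|, fun ω z hz => ((hC z ω).trans (le_abs_self _)).trans ?_⟩
      exact Finset.single_le_sum (f := fun z => |C z|) (fun _ _ => abs_nonneg _) hz
    obtain ⟨C, hC⟩ := hb
    have hC0 : 0 ≤ C := by
      obtain ⟨ω⟩ := μ.nonempty_of_neZero
      exact (abs_nonneg _).trans (hC ω _ (R.play_mem 0 ω))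
    have hmeas : ∀ z, Measurable[R.ℱ T] fun ω => Φ (fun r => R.play r ω) *
        φ T (fun r => R.play r ω) z := fun z =>
      R.measurable_history (F := fun p _ => Φ p * φ T p z) (fun p => measurable_const)
        fun p p' h => funext fun _ => hfdep z p p' h
    -- The cutoff to terminal nodes changes nothing at the actual play; it supplies a bound that is
    -- uniform in `z`.
    have key := R.integral_play T (f := fun ω z => if z ∈ G.terminals then
      Φ (fun r => R.play r ω) * φ T (fun r => R.play r ω) z else 0) (C := C)
      (fun z => by
        split_ifs
        · exact hmeas z
        · exact measurable_const)
      (fun ω z => by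
        split_ifs with hz
        · exact hC ω z hz
        · simpa using hC0)
    simp only [R.play_mem, if_true] at key
    simp only [Finset.prod_range_succ]
    change ∫ ω, Φ (fun r => R.play r ω) * φ T (fun r => R.play r ω) (R.play T ω) ∂μ ≤ 1
    rw [key]
    refine le_trans (integral_mono_of_nonneg (Filter.Eventually.of_forall fun ω => ?_) ?_
      (Filter.Eventually.of_forall fun ω => ?_)) ih
    · refine Finset.sum_nonneg fun z hz => mul_nonneg
        (reach_nonneg (R.σ_mem T ω) (G.mem_terminals.1 hz).1) ?_
      rw [if_pos hz]
      exact mul_nonneg (hΦnn _) (hnn _ _ _)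
    · obtain ⟨C', hC'⟩ := R.exists_bound hΦdep
      refine integrable_of_bounded (C := C') ?_ hC'
      exact (R.measurable_history (F := fun p _ => Φ p) (fun p => measurable_const)
        fun p p' h => funext fun _ => hΦdep p p' h).mono (R.ℱ.le T) le_rfl
    · calc ∑ z ∈ G.terminals, G.reach G.chance (R.σ T ω) z *
            (if z ∈ G.terminals then
              Φ (fun r => R.play r ω) * φ T (fun r => R.play r ω) z else 0)
          = Φ (fun r => R.play r ω) * ∑ z ∈ G.terminals,
              G.reach G.chance (R.σ T ω) z * φ T (fun r => R.play r ω) z := by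
            rw [Finset.mul_sum]
            refine Finset.sum_congr rfl fun z hz => ?_
            rw [if_pos hz]; ring
        _ ≤ Φ (fun r => R.play r ω) * 1 :=
            mul_le_mul_of_nonneg_left (hsum _ _ _ (R.σ_mem T ω)) (hΦnn _)
        _ = _ := mul_one _

/-- An exponential tail bound for the actions that nature takes at the chance node `h`. -/
theorem measureReal_visits_le {h : List A} (hc : G.IsChance h) {c : A → ℝ}
    (hsum : ∑ a ∈ G.actions h, G.chance h a * Real.exp (c a) ≤ 1) (m T : ℕ) (x : ℝ) :
    μ.real {ω | ∃ s ≤ T, visits (fun r => R.play r ω) s h ≤ m ∧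
        (m ≤ visits (fun r => R.play r ω) s h ∨ s = T) ∧
        x ≤ ∑ a ∈ G.actions h, visits (fun r => R.play r ω) s (a :: h) * c a}
      ≤ Real.exp (-x) := by
  set φ := visitFactor G (fun a => Real.exp (c a)) h m with hφ
  have hdep : ∀ t p p', (∀ r < t, p r = p' r) → φ t p = φ t p' := by
    intro t p p' hp
    have : visits p t h = visits p' t h := by
      unfold visits
      congr 1
      refine Finset.filter_congr fun r hr => ?_
      rw [hp r (Finset.mem_range.1 hr)]
    ext z
    simp only [hφ, visitFactor, this]
  have hnn : ∀ t p z, 0 ≤ φ t p z := by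
    intro t p z
    simp only [hφ, visitFactor]
    split_ifs
    · exact nextFactor_nonneg (fun a => (Real.exp_pos _).le) h z
    · norm_num
  have h1 := R.integral_prod_le_one hdep hnn (fun t p σ hσ => by
    simp only [hφ, visitFactor]
    split_ifs
    · exact sum_reach_nextFactor hσ hc hsum
    · simp [sum_terminals hσ]) T
  set F : Ω → ℝ := fun ω => ∏ r ∈ Finset.range T, φ r (fun r => R.play r ω) (R.play r ω) with hF
  have hFdep : ∀ p p' : ℕ → List A, (∀ r < T, p r = p' r) →
      ∏ r ∈ Finset.range T, φ r p (p r) = ∏ r ∈ Finset.range T, φ r p' (p' r) := by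
    intro p p' hp
    refine Finset.prod_congr rfl fun r hr => ?_
    have hr' := Finset.mem_range.1 hr
    rw [hdep r p p' fun s hs => hp s (hs.trans hr'), hp r hr']
  have hFint : Integrable F μ := by
    obtain ⟨C, hC⟩ := R.exists_bound hFdep
    refine integrable_of_bounded (C := C) ?_ hC
    exact (R.measurable_history (F := fun p _ => ∏ r ∈ Finset.range T, φ r p (p r))
      (fun p => measurable_const)
      fun p p' h => funext fun _ => hFdep p p' h).mono (R.ℱ.le T) le_rfl
  -- Markov's inequality for a nonnegative variable of mean at most one.
  have h2 := mul_meas_ge_le_integral_of_nonneg (μ := μ) (f := F)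
    (Filter.Eventually.of_forall fun ω => Finset.prod_nonneg fun r _ => hnn _ _ _) hFint
    (Real.exp x)
  have h3 : {ω | ∃ s ≤ T, visits (fun r => R.play r ω) s h ≤ m ∧
        (m ≤ visits (fun r => R.play r ω) s h ∨ s = T) ∧
        x ≤ ∑ a ∈ G.actions h, visits (fun r => R.play r ω) s (a :: h) * c a}
      ⊆ {ω | Real.exp x ≤ F ω} := by
    rintro ω ⟨s, hs, hm, hm', hx⟩
    change Real.exp x ≤ ∏ r ∈ Finset.range T, φ r (fun r => R.play r ω) (R.play r ω)
    have := prod_visitFactor (play := fun r => R.play r ω) (fun r => R.play_mem r ω) hc.2.1 c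
      hs hm hm'
    rw [hφ, this]
    exact Real.exp_le_exp.2 hx
  refine (measureReal_mono h3).trans ?_
  rw [Real.exp_neg, ← one_div, le_div_iff₀ (Real.exp_pos x), mul_comm]
  exact h2.trans h1

end Run

/-- Hoeffding's lemma for a Bernoulli variable. -/
theorem bernoulli_mgf_le {P : ℝ} (h0 : 0 ≤ P) (h1 : P ≤ 1) (l : ℝ) :
    P * Real.exp (l * (1 - P)) + (1 - P) * Real.exp (-(l * P)) ≤ Real.exp (l ^ 2 / 8) := by
  set ν : Measure ℝ := ENNReal.ofReal P • Measure.dirac 1 + ENNReal.ofReal (1 - P) •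
    Measure.dirac 0 with hν
  have hprob : IsProbabilityMeasure ν := by
    constructor
    simp only [hν, Measure.coe_add, Measure.coe_smul, Pi.add_apply, Pi.smul_apply,
      measure_univ, smul_eq_mul, mul_one]
    rw [← ENNReal.ofReal_add h0 (by linarith)]
    simp
  have hint : ∀ f : ℝ → ℝ, ∫ x, f x ∂ν = P * f 1 + (1 - P) * f 0 := by
    intro f
    have hi : ∀ (c : ℝ) (y : ℝ), Integrable f (ENNReal.ofReal c • Measure.dirac y) := fun c y =>
      (integrable_dirac (by simp)).smul_measure ENNReal.ofReal_ne_top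
    rw [hν, integral_add_measure (hi _ _) (hi _ _), integral_smul_measure, integral_smul_measure,
      integral_dirac, integral_dirac, ENNReal.toReal_ofReal h0,
      ENNReal.toReal_ofReal (by linarith)]
    rfl
  have hsub := ProbabilityTheory.hasSubgaussianMGF_of_mem_Icc (μ := ν) (X := fun x => x)
    (a := 0) (b := 1) aemeasurable_id (by
      rw [hν, ae_add_measure_iff]
      constructor
      · refine Measure.ae_smul_measure ?_ _
        rw [ae_dirac_eq]
        exact ⟨zero_le_one, le_rfl⟩
      · refine Measure.ae_smul_measure ?_ _
        rw [ae_dirac_eq]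
        exact ⟨le_rfl, zero_le_one⟩)
  have := hsub.mgf_le l
  rw [ProbabilityTheory.mgf, hint, hint] at this
  convert this using 2
  · ring_nf
  · ring_nf
  · norm_num
    ring

/-- The indices up to `t₀` contribute at most `t₀ * (1 / t₀ ^ 2)`, and the tail telescopes to at
most `1 / t₀`. This is the price of the union bound over visit counts when accuracy is demanded only
from time `t₀` on. -/
theorem sum_inv_max_sq_le {t₀ : ℕ} (ht : t₀ ≠ 0) (T : ℕ) :
    ∑ m ∈ Finset.Icc 1 T, (((max m t₀ : ℕ) : ℝ) ^ 2)⁻¹ ≤ 2 / t₀ := by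
  have hpos : (0 : ℝ) < t₀ := by exact_mod_cast Nat.pos_of_ne_zero ht
  have h1 : Finset.Icc 1 T ⊆ Finset.Ioc 0 t₀ ∪ Finset.Ioc t₀ (T + t₀) := by
    intro m hm
    rw [Finset.mem_Icc] at hm
    rw [Finset.mem_union, Finset.mem_Ioc, Finset.mem_Ioc]
    omega
  have h2 : ∑ m ∈ Finset.Ioc 0 t₀, (((max m t₀ : ℕ) : ℝ) ^ 2)⁻¹ = 1 / t₀ := by
    rw [Finset.sum_congr rfl fun m hm => by rw [max_eq_right (Finset.mem_Ioc.1 hm).2]]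
    rw [Finset.sum_const, Nat.card_Ioc, nsmul_eq_mul]
    field_simp
    simp
  have h3 : ∑ m ∈ Finset.Ioc t₀ (T + t₀), (((max m t₀ : ℕ) : ℝ) ^ 2)⁻¹ ≤ 1 / t₀ := by
    rw [Finset.sum_congr rfl fun m hm => by rw [max_eq_left (Finset.mem_Ioc.1 hm).1.le]]
    refine (sum_Ioc_inv_sq_le_sub ht (by omega)).trans ?_
    rw [one_div]
    have : (0 : ℝ) ≤ ((T + t₀ : ℕ) : ℝ)⁻¹ := by positivity
    linarith
  calc _ ≤ ∑ m ∈ Finset.Ioc 0 t₀ ∪ Finset.Ioc t₀ (T + t₀), (((max m t₀ : ℕ) : ℝ) ^ 2)⁻¹ :=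
        Finset.sum_le_sum_of_subset_of_nonneg h1 fun _ _ _ => by positivity
    _ ≤ ∑ m ∈ Finset.Ioc 0 t₀, (((max m t₀ : ℕ) : ℝ) ^ 2)⁻¹
        + ∑ m ∈ Finset.Ioc t₀ (T + t₀), (((max m t₀ : ℕ) : ℝ) ^ 2)⁻¹ := by
        rw [← Finset.sum_union_inter]
        have : 0 ≤ ∑ m ∈ Finset.Ioc 0 t₀ ∩ Finset.Ioc t₀ (T + t₀),
            (((max m t₀ : ℕ) : ℝ) ^ 2)⁻¹ := Finset.sum_nonneg fun _ _ => by positivity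
        linarith
    _ ≤ 2 / t₀ := by
        rw [h2]
        have : (2 : ℝ) / t₀ = 1 / t₀ + 1 / t₀ := by ring
        linarith

/-! ### Concentration of the empirical frequencies -/

namespace Run

variable {n : ℕ} {A : Type u} {I : Type v} {G : Game n A I} {b : Bounds G}
  {Ω : Type w} [mΩ : MeasurableSpace Ω] {μ : Measure Ω} (R : Run G b μ) [IsProbabilityMeasure μ]

/-- The frequency of a set of actions of nature exceeds its probability with small probability. -/
theorem measureReal_deviation_le {h : List A} (hc : G.IsChance h) {S : Finset A}
    (hS : S ⊆ G.actions h) {m : ℕ} (hm : 0 < m) (T : ℕ) {l : ℝ} (hl : 0 ≤ l) :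
    μ.real {ω | ∃ s ≤ T, visits (fun r => R.play r ω) s h = m ∧
        Real.sqrt (1 / (2 * (m : ℝ)) * l)
          ≤ ∑ a ∈ S, (empirical (fun r => R.play r ω) s h a - G.chance h a)}
      ≤ Real.exp (-l) := by
  set ρ := Real.sqrt (1 / (2 * (m : ℝ)) * l) with hρ
  have hm0 : (0 : ℝ) < m := by exact_mod_cast hm
  have hρ0 : 0 ≤ ρ := Real.sqrt_nonneg _
  have hρ2 : 2 * m * ρ ^ 2 = l := by
    rw [hρ, Real.sq_sqrt (by positivity)]
    field_simp
  set P := ∑ a ∈ S, G.chance h a with hP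
  have hnn : ∀ a ∈ G.actions h, 0 ≤ G.chance h a :=
    fun a ha => G.chance_nonneg h hc.1 hc.2.2 a ha
  have hone : ∑ a ∈ G.actions h, G.chance h a = 1 := G.chance_sum h hc.1 hc.2.2 hc.2.1
  have hP0 : 0 ≤ P := Finset.sum_nonneg fun a ha => hnn a (hS ha)
  have hP1 : P ≤ 1 := by
    rw [← hone]
    exact Finset.sum_le_sum_of_subset_of_nonneg hS fun a ha _ => hnn a ha
  -- The slope `4 * ρ` maximizes `x * ρ - x ^ 2 / 8`; the maximum is `2 * ρ ^ 2`, and `m` visits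
  -- turn it into `l`. The subtracted constant is the Hoeffding correction that makes the
  -- exponential mean at most one.
  set c : A → ℝ := fun a =>
    (if a ∈ S then 4 * ρ * (1 - P) else -(4 * ρ * P)) - (4 * ρ) ^ 2 / 8 with hcdef
  have hsum : ∑ a ∈ G.actions h, G.chance h a * Real.exp (c a) ≤ 1 := by
    have h1 : ∀ a, G.chance h a * Real.exp (c a) = (if a ∈ S then
        G.chance h a * Real.exp (4 * ρ * (1 - P)) else
        G.chance h a * Real.exp (-(4 * ρ * P))) * Real.exp (-((4 * ρ) ^ 2 / 8)) := by
      intro a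
      simp only [hcdef, sub_eq_add_neg, Real.exp_add]
      split_ifs <;> ring
    have h2 : ∑ a ∈ G.actions h \ S, G.chance h a = 1 - P := by
      rw [← hone, ← Finset.sum_sdiff hS]; ring
    have h3 : (G.actions h).filter (fun a => a ∈ S) = S := by
      rw [Finset.filter_mem_eq_inter, Finset.inter_eq_right.2 hS]
    have h4 : (G.actions h).filter (fun a => a ∉ S) = G.actions h \ S := by
      ext a; simp
    simp only [h1]
    rw [← Finset.sum_mul, Finset.sum_ite, h3, h4, ← Finset.sum_mul, ← Finset.sum_mul, h2]
    have := mul_le_mul_of_nonneg_right (bernoulli_mgf_le hP0 hP1 (4 * ρ))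
      (Real.exp_pos (-((4 * ρ) ^ 2 / 8))).le
    rwa [← Real.exp_add, add_neg_cancel, Real.exp_zero] at this
  refine (measureReal_mono ?_).trans (R.measureReal_visits_le hc hsum m T l)
  rintro ω ⟨s, hs, hv, hdev⟩
  refine ⟨s, hs, hv.le, Or.inl hv.ge, ?_⟩
  set pl := fun r => R.play r ω
  have h1 : ∑ a ∈ G.actions h, (visits pl s (a :: h) : ℝ) = m := by
    rw [← hv]
    exact_mod_cast sum_visits (fun r => R.play_mem r ω) s hc.2.1
  have h2 : ∑ a ∈ S, (empirical pl s h a - G.chance h a)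
      = (∑ a ∈ S, (visits pl s (a :: h) : ℝ)) / m - P := by
    rw [Finset.sum_sub_distrib, Finset.sum_div]
    simp only [empirical, hv]
    rfl
  have h3 : ∑ a ∈ G.actions h, (visits pl s (a :: h) : ℝ) * c a
      = 4 * ρ * ∑ a ∈ S, (visits pl s (a :: h) : ℝ) - m * (4 * ρ * P + (4 * ρ) ^ 2 / 8) := by
    have : ∀ a, (visits pl s (a :: h) : ℝ) * c a = 4 * ρ * (if a ∈ S then
        (visits pl s (a :: h) : ℝ) else 0)
        - visits pl s (a :: h) * (4 * ρ * P + (4 * ρ) ^ 2 / 8) := by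
      intro a
      simp only [hcdef]
      split_ifs <;> ring
    simp only [this]
    rw [Finset.sum_sub_distrib, ← Finset.mul_sum, ← Finset.sum_mul, h1, ← Finset.sum_filter,
      Finset.filter_mem_eq_inter, Finset.inter_eq_right.2 hS]
  rw [h2, le_sub_iff_add_le, le_div_iff₀ hm0] at hdev
  rw [h3, ← hρ2]
  nlinarith [mul_le_mul_of_nonneg_left hdev hρ0]

/-- With high probability the empirical frequencies are accurate from time `t₀` on. -/
theorem measureReal_not_accurate_le (hn : 0 < n) {t₀ : ℕ} (ht₀ : t₀ ≠ 0) (T : ℕ) :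
    μ.real {ω | ∃ t, t₀ ≤ t ∧ t ≤ T ∧ ¬ Accurate G (fun r => R.play r ω) t}
      ≤ G.tree.card * (2 / t₀) := by
  -- At a time `t ≥ t₀` with `m` visits, `t` is at least `max m t₀`, and `C_t * n` is at least one.
  -- Hence this logarithm is at most the one in the radius, and it depends on neither `t` nor `C_t`:
  -- one event for each node, set and visit count suffices. Its first summand pays for the `2 ^
  -- |A_h|` sets of actions.
  set l : List A → ℕ → ℝ := fun h m => (G.actions h).card * Real.log 2
    + Real.log (((max m t₀ : ℕ) : ℝ) ^ 2) with hl
  have hmax : ∀ m : ℕ, (1 : ℝ) ≤ ((max m t₀ : ℕ) : ℝ) := by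
    intro m
    have : 1 ≤ max m t₀ := by have := Nat.pos_of_ne_zero ht₀; omega
    exact_mod_cast this
  have hl0 : ∀ h m, 0 ≤ l h m := fun h m =>
    add_nonneg (mul_nonneg (Nat.cast_nonneg _) (Real.log_nonneg (by norm_num)))
      (Real.log_nonneg (one_le_pow₀ (hmax m)))
  set E : List A → Finset A → ℕ → Set Ω := fun h S m =>
    {ω | ∃ s ≤ T, visits (fun r => R.play r ω) s h = m ∧
        Real.sqrt (1 / (2 * (m : ℝ)) * l h m)
          ≤ ∑ a ∈ S, (empirical (fun r => R.play r ω) s h a - G.chance h a)} with hE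
  have hcover : {ω | ∃ t, t₀ ≤ t ∧ t ≤ T ∧ ¬ Accurate G (fun r => R.play r ω) t}
      ⊆ ⋃ h ∈ G.tree.filter G.IsChance, ⋃ S ∈ (G.actions h).powerset,
        ⋃ m ∈ Finset.Icc 1 T, E h S m := by
    rintro ω ⟨t, h1, h2, h3⟩
    simp only [Accurate, not_forall, not_le] at h3
    obtain ⟨h, hh, hc, S, hS, hdev⟩ := h3
    have hv := visits_pos_of_expanded hh
    simp only [Set.mem_iUnion]
    refine ⟨h, Finset.mem_filter.2 ⟨hc.1, hc⟩, S, Finset.mem_powerset.2 hS,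
      visits (fun r => R.play r ω) t h, Finset.mem_Icc.2 ⟨hv, (visits_le t h).trans h2⟩,
      t, h2, rfl, le_trans ?_ hdev.le⟩
    refine Real.sqrt_le_sqrt (mul_le_mul_of_nonneg_left (add_le_add_right ?_ _) (by positivity))
    have hC : 1 ≤ numChance G (fun r => R.play r ω) t :=
      Finset.card_pos.2 ⟨h, Finset.mem_filter.2 ⟨hh, hc⟩⟩
    refine Real.log_le_log (by have := hmax (visits (fun r => R.play r ω) t h); positivity) ?_
    have h4 : max (visits (fun r => R.play r ω) t h) t₀ ≤ t := max_le (visits_le t h) h1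
    have h5 : (((max (visits (fun r => R.play r ω) t h) t₀ : ℕ) : ℝ)) ^ 2 ≤ (t : ℝ) ^ 2 := by
      gcongr
    have h6 : (1 : ℝ) ≤ (numChance G (fun r => R.play r ω) t : ℝ) * n :=
      one_le_mul_of_one_le_of_one_le (by exact_mod_cast hC) (by exact_mod_cast hn)
    rw [mul_assoc]
    exact h5.trans (le_mul_of_one_le_right (by positivity) h6)
  have hbound : ∀ h ∈ G.tree.filter G.IsChance, ∀ S ∈ (G.actions h).powerset,
      ∀ m ∈ Finset.Icc 1 T, μ.real (E h S m)
        ≤ (2 ^ (G.actions h).card : ℝ)⁻¹ * (((max m t₀ : ℕ) : ℝ) ^ 2)⁻¹ := by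
    intro h hh S hS m hm
    refine (R.measureReal_deviation_le (Finset.mem_filter.1 hh).2 (Finset.mem_powerset.1 hS)
      (Finset.mem_Icc.1 hm).1 T (hl0 h m)).trans (le_of_eq ?_)
    have := hmax m
    simp only [hl]
    rw [neg_add, Real.exp_add, Real.exp_neg, Real.exp_neg, Real.exp_log (by positivity),
      Real.exp_nat_mul, Real.exp_log (by norm_num)]
  calc _ ≤ μ.real (⋃ h ∈ G.tree.filter G.IsChance, ⋃ S ∈ (G.actions h).powerset,
        ⋃ m ∈ Finset.Icc 1 T, E h S m) := measureReal_mono hcover (measure_ne_top _ _)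
    _ ≤ ∑ h ∈ G.tree.filter G.IsChance, ∑ S ∈ (G.actions h).powerset,
        ∑ m ∈ Finset.Icc 1 T, μ.real (E h S m) := by
        refine (measureReal_biUnion_finset_le _ _).trans (Finset.sum_le_sum fun h _ => ?_)
        refine (measureReal_biUnion_finset_le _ _).trans (Finset.sum_le_sum fun S _ => ?_)
        exact measureReal_biUnion_finset_le _ _
    _ ≤ ∑ h ∈ G.tree.filter G.IsChance, ∑ S ∈ (G.actions h).powerset,
        ∑ m ∈ Finset.Icc 1 T,
          (2 ^ (G.actions h).card : ℝ)⁻¹ * (((max m t₀ : ℕ) : ℝ) ^ 2)⁻¹ :=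
        Finset.sum_le_sum fun h hh => Finset.sum_le_sum fun S hS =>
          Finset.sum_le_sum fun m hm => hbound h hh S hS m hm
    _ = ∑ h ∈ G.tree.filter G.IsChance,
        ∑ m ∈ Finset.Icc 1 T, (((max m t₀ : ℕ) : ℝ) ^ 2)⁻¹ := by
        refine Finset.sum_congr rfl fun h _ => ?_
        rw [Finset.sum_const, Finset.card_powerset, ← Finset.mul_sum, nsmul_eq_mul, ← mul_assoc]
        push_cast
        rw [mul_inv_cancel₀ (by positivity), one_mul]
    _ ≤ ∑ h ∈ G.tree.filter G.IsChance, 2 / (t₀ : ℝ) :=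
        Finset.sum_le_sum fun _ _ => sum_inv_max_sq_le ht₀ T
    _ ≤ _ := by
        rw [Finset.sum_const, nsmul_eq_mul]
        refine mul_le_mul_of_nonneg_right ?_ (by positivity)
        exact_mod_cast Finset.card_filter_le _ _

/-- The number of times that nature took the action `a` is at most a bit more than expected. -/
theorem measureReal_frequent_le {h : List A} (hc : G.IsChance h) {a : A} (ha : a ∈ G.actions h)
    (s : ℕ) (l x : ℝ) :
    μ.real {ω | x ≤ l * visits (fun r => R.play r ω) s (a :: h)
        - visits (fun r => R.play r ω) s h * (G.chance h a * (Real.exp l - 1))}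
      ≤ Real.exp (-x) := by
  have hone : ∑ a ∈ G.actions h, G.chance h a = 1 := G.chance_sum h hc.1 hc.2.2 hc.2.1
  -- The Chernoff exponent for counting `a`: an indicator of mean `q` has exponential moment `1 + q
  -- * (exp l - 1)`, which is at most the exponential of `q * (exp l - 1)`.
  set c : A → ℝ := fun a' => (if a' = a then l else 0) - G.chance h a * (Real.exp l - 1) with hcdef
  have hsum : ∑ a ∈ G.actions h, G.chance h a * Real.exp (c a) ≤ 1 := by
    have h1 : ∀ a', G.chance h a' * Real.exp (c a') = (G.chance h a' + if a' = a then
        G.chance h a * (Real.exp l - 1) else 0) *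
        Real.exp (-(G.chance h a * (Real.exp l - 1))) := by
      intro a'
      simp only [hcdef, sub_eq_add_neg, Real.exp_add]
      split_ifs with hh
      · subst hh; ring
      · simp
    simp only [h1]
    rw [← Finset.sum_mul, Finset.sum_add_distrib, hone, Finset.sum_ite_eq', if_pos ha,
      Real.exp_neg, ← div_eq_mul_inv, div_le_one (Real.exp_pos _), add_comm]
    exact Real.add_one_le_exp _
  -- Both the visit cap and the horizon are `s`. At most `s` visits can occur by then, so the
  -- stopping rule never interferes.
  refine (measureReal_mono ?_).trans (R.measureReal_visits_le hc hsum s s x)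
  intro ω hω
  refine ⟨s, le_rfl, visits_le s h, Or.inr rfl, hω.trans (le_of_eq ?_)⟩
  have h1 : ∑ a ∈ G.actions h, (visits (fun r => R.play r ω) s (a :: h) : ℝ)
      = visits (fun r => R.play r ω) s h := by
    exact_mod_cast sum_visits (fun r => R.play_mem r ω) s hc.2.1
  simp only [hcdef, mul_sub, Finset.sum_sub_distrib]
  rw [← h1, ← Finset.sum_mul, ← Finset.sum_mul]
  simp only [mul_ite, mul_zero, Finset.sum_ite_eq', ha, if_true]
  ring

end Run

/-- Weighting the increments of a small process by a nondecreasing sequence. -/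
theorem sum_mul_ge_of_abs_le {M ξ : ℕ → ℝ} {x : ℝ} {T : ℕ} (hM0 : 0 ≤ M 0)
    (hM : ∀ t, M t ≤ M (t + 1)) (hx : ∀ k ≤ T, |∑ r ∈ Finset.range k, ξ r| ≤ x) :
    -(2 * M T * x) ≤ ∑ t ∈ Finset.range T, M (t + 1) * ξ t := by
  -- Summation by parts, with the increments of `M` multiplying partial sums that are at most `x`.
  -- Each of the two terms of the left side loses at most `M T * x` at the end.
  have key : ∀ k ≤ T, M k * ∑ r ∈ Finset.range k, ξ r - (M k - M 0) * x
      ≤ ∑ t ∈ Finset.range k, M (t + 1) * ξ t := by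
    intro k
    induction k with
    | zero => intro _; simp
    | succ k ih =>
      intro hk
      have h1 := ih (by omega)
      have h2 := (abs_le.1 (hx k (by omega))).2
      rw [Finset.sum_range_succ, Finset.sum_range_succ]
      nlinarith [mul_nonneg (sub_nonneg.2 (hM k)) (sub_nonneg.2 h2)]
  have h1 := key T le_rfl
  have h2 := (abs_le.1 (hx T le_rfl)).1
  have hx0 : 0 ≤ x := by simpa using hx 0 (Nat.zero_le _)
  have hMT : 0 ≤ M T := hM0.trans (monotone_nat_of_le_succ hM (Nat.zero_le T))
  nlinarith [mul_nonneg hM0 hx0, mul_le_mul_of_nonneg_left h2 hMT]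

/-! ### The Azuma-Hoeffding inequality -/

section Azuma

variable {Ω : Type w} [mΩ : MeasurableSpace Ω] {μ : Measure Ω} [IsProbabilityMeasure μ]
  {ℱ : Filtration ℕ mΩ} {𝒢 : ℕ → MeasurableSpace Ω}

/-- The exponential moment of a martingale with bounded differences. -/
theorem integral_exp_sum_le (hℱ : ∀ t, ℱ t ≤ 𝒢 t) {ξ : ℕ → Ω → ℝ}
    (hmeas : ∀ t, Measurable[ℱ (t + 1)] (ξ t)) (hbd : ∀ t ω, |ξ t ω| ≤ 2)
    (hmart : ∀ t (Z : Ω → ℝ) (C : ℝ), Measurable[𝒢 t] Z → (∀ ω, |Z ω| ≤ C) →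
      ∫ ω, Z ω * ξ t ω ∂μ = 0) (l : ℝ) (T : ℕ) :
    ∫ ω, Real.exp (l * ∑ t ∈ Finset.range T, ξ t ω) ∂μ ≤ Real.exp (2 * l ^ 2 * T) := by
  have hm : ∀ T, Measurable[ℱ T] fun ω => Real.exp (l * ∑ t ∈ Finset.range T, ξ t ω) := by
    intro T
    refine Real.measurable_exp.comp (Measurable.const_mul ?_ l)
    exact Finset.measurable_sum _ fun t ht =>
      (hmeas t).mono (ℱ.mono (Finset.mem_range.1 ht)) le_rfl
  have hb : ∀ T ω, |Real.exp (l * ∑ t ∈ Finset.range T, ξ t ω)| ≤ Real.exp (|l| * (T * 2)) := by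
    intro T ω
    rw [abs_of_pos (Real.exp_pos _), Real.exp_le_exp]
    refine (le_abs_self _).trans ?_
    rw [abs_mul]
    refine mul_le_mul_of_nonneg_left ?_ (abs_nonneg _)
    refine (Finset.abs_sum_le_sum_abs _ _).trans ?_
    refine (Finset.sum_le_sum fun t _ => hbd t ω).trans ?_
    simp
  have hi : ∀ T, Integrable (fun ω => Real.exp (l * ∑ t ∈ Finset.range T, ξ t ω)) μ :=
    fun T => integrable_of_bounded ((hm T).mono (ℱ.le T) le_rfl) (hb T)
  induction T with
  | zero => simp
  | succ T ih =>
    have hiξ : Integrable (fun ω => Real.exp (l * ∑ t ∈ Finset.range T, ξ t ω) * ξ T ω) μ :=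
      (hi T).mul_bdd ((hmeas T).mono (ℱ.le _) le_rfl).aestronglyMeasurable
        (Filter.Eventually.of_forall fun ω => hbd T ω)
    calc ∫ ω, Real.exp (l * ∑ t ∈ Finset.range (T + 1), ξ t ω) ∂μ
        ≤ ∫ ω, (Real.cosh (2 * l) * Real.exp (l * ∑ t ∈ Finset.range T, ξ t ω)
          + Real.sinh (2 * l) / 2 *
            (Real.exp (l * ∑ t ∈ Finset.range T, ξ t ω) * ξ T ω)) ∂μ := by
          refine integral_mono (hi _) (((hi T).const_mul _).add (hiξ.const_mul _)) fun ω => ?_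
          -- On `[-2, 2]` the convex function `exp (l * ·)` lies below its chord. The linear part of
          -- the chord integrates to zero against the past, and `cosh (2 * l) ≤ exp (2 * l ^ 2)`
          -- bounds the rest.
          have h1 := Real.exp_mul_le_cosh_add_mul_sinh (t := ξ T ω / 2)
            (by rw [abs_div, abs_two]; linarith [hbd T ω]) (2 * l)
          simp only [Finset.sum_range_succ, mul_add, Real.exp_add]
          have h2 : ξ T ω / 2 * (2 * l) = l * ξ T ω := by ring
          rw [h2] at h1
          have := mul_le_mul_of_nonneg_left h1
            (Real.exp_pos (l * ∑ t ∈ Finset.range T, ξ t ω)).le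
          linarith
      _ = Real.cosh (2 * l) * ∫ ω, Real.exp (l * ∑ t ∈ Finset.range T, ξ t ω) ∂μ := by
          rw [integral_add ((hi T).const_mul _) (hiξ.const_mul _), integral_const_mul,
            integral_const_mul, hmart T _ _ ((hm T).mono (hℱ T) le_rfl) (hb T), mul_zero,
            add_zero]
      _ ≤ Real.exp ((2 * l) ^ 2 / 2) * Real.exp (2 * l ^ 2 * T) :=
          mul_le_mul (Real.cosh_le_exp_half_sq _) ih
            (integral_nonneg fun ω => (Real.exp_pos _).le) (Real.exp_pos _).le
      _ = Real.exp (2 * l ^ 2 * (T + 1 : ℕ)) := by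
          rw [← Real.exp_add]
          congr 1
          push_cast
          ring

/-- The Azuma-Hoeffding inequality. -/
theorem measureReal_sum_ge_le (hℱ : ∀ t, ℱ t ≤ 𝒢 t) {ξ : ℕ → Ω → ℝ}
    (hmeas : ∀ t, Measurable[ℱ (t + 1)] (ξ t)) (hbd : ∀ t ω, |ξ t ω| ≤ 2)
    (hmart : ∀ t (Z : Ω → ℝ) (C : ℝ), Measurable[𝒢 t] Z → (∀ ω, |Z ω| ≤ C) →
      ∫ ω, Z ω * ξ t ω ∂μ = 0) {k T : ℕ} (hT : 0 < T) (hk : k ≤ T) {x : ℝ} (hx : 0 ≤ x) :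
    μ.real {ω | x ≤ ∑ t ∈ Finset.range k, ξ t ω} ≤ Real.exp (-(x ^ 2 / (8 * T))) := by
  have hT0 : (0 : ℝ) < T := by exact_mod_cast hT
  -- The minimizer of `2 * l ^ 2 * T - l * x`.
  set l : ℝ := x / (4 * T) with hl
  have hl0 : 0 ≤ l := by positivity
  have h1 := integral_exp_sum_le (μ := μ) hℱ hmeas hbd hmart l k
  have hm : Measurable fun ω => Real.exp (l * ∑ t ∈ Finset.range k, ξ t ω) :=
    Real.measurable_exp.comp ((Finset.measurable_sum _ fun t _ =>
      (hmeas t).mono (ℱ.le _) le_rfl).const_mul l)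
  have hi : Integrable (fun ω => Real.exp (l * ∑ t ∈ Finset.range k, ξ t ω)) μ := by
    refine integrable_of_bounded hm (C := Real.exp (l * (k * 2))) fun ω => ?_
    rw [abs_of_pos (Real.exp_pos _), Real.exp_le_exp]
    refine mul_le_mul_of_nonneg_left ?_ hl0
    refine (Finset.sum_le_sum fun t _ => (le_abs_self _).trans (hbd t ω)).trans ?_
    simp
  have h2 := mul_meas_ge_le_integral_of_nonneg (μ := μ)
    (Filter.Eventually.of_forall fun ω => (Real.exp_pos _).le) hi (Real.exp (l * x))
  have h3 : μ.real {ω | x ≤ ∑ t ∈ Finset.range k, ξ t ω}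
      ≤ μ.real {ω | Real.exp (l * x) ≤ Real.exp (l * ∑ t ∈ Finset.range k, ξ t ω)} :=
    measureReal_mono fun ω hω => Real.exp_le_exp.2 (mul_le_mul_of_nonneg_left hω hl0)
  have h4 : μ.real {ω | x ≤ ∑ t ∈ Finset.range k, ξ t ω}
      ≤ Real.exp (2 * l ^ 2 * k) / Real.exp (l * x) := by
    rw [le_div_iff₀ (Real.exp_pos _), mul_comm]
    exact (mul_le_mul_of_nonneg_left h3 (Real.exp_pos _).le).trans (h2.trans h1)
  rw [← Real.exp_sub] at h4
  refine h4.trans (Real.exp_le_exp.2 ?_)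
  have h5 : 2 * l ^ 2 * k ≤ 2 * l ^ 2 * T :=
    mul_le_mul_of_nonneg_left (by exact_mod_cast hk) (by positivity)
  have h6 : 2 * l ^ 2 * T - l * x = -(x ^ 2 / (8 * T)) := by
    rw [hl]; field_simp; ring
  linarith

/-- The partial sums of a martingale with bounded differences stay small. -/
theorem measureReal_exists_abs_sum_gt_le (hℱ : ∀ t, ℱ t ≤ 𝒢 t) {ξ : ℕ → Ω → ℝ}
    (hmeas : ∀ t, Measurable[ℱ (t + 1)] (ξ t)) (hbd : ∀ t ω, |ξ t ω| ≤ 2)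
    (hmart : ∀ t (Z : Ω → ℝ) (C : ℝ), Measurable[𝒢 t] Z → (∀ ω, |Z ω| ≤ C) →
      ∫ ω, Z ω * ξ t ω ∂μ = 0) {T : ℕ} (hT : 1 < T) :
    μ.real {ω | ∃ k ≤ T, 4 * Real.sqrt (T * Real.log T) < |∑ t ∈ Finset.range k, ξ t ω|}
      ≤ 2 * (T + 1) / T ^ 2 := by
  have hT0 : (0 : ℝ) < T := by exact_mod_cast (by omega : 0 < T)
  have hlog : 0 ≤ Real.log T := Real.log_natCast_nonneg T
  -- Chosen so that `x ^ 2 / (8 * T) = 2 * log T`; each tail is then `1 / T ^ 2`, and the union runs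
  -- over `T + 1` times and two signs. All times are needed because the later summation by parts
  -- uses every partial sum.
  set x := 4 * Real.sqrt (T * Real.log T) with hx
  have hx0 : 0 ≤ x := by positivity
  have hexp : Real.exp (-(x ^ 2 / (8 * T))) = 1 / T ^ 2 := by
    have : x ^ 2 / (8 * T) = Real.log (T ^ 2) := by
      rw [hx, mul_pow, Real.sq_sqrt (by positivity), Real.log_pow]
      push_cast
      field_simp
      ring
    rw [this, Real.exp_neg, Real.exp_log (by positivity), one_div]
  have hcover : {ω | ∃ k ≤ T, x < |∑ t ∈ Finset.range k, ξ t ω|} ⊆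
      ⋃ k ∈ Finset.range (T + 1), ({ω | x ≤ ∑ t ∈ Finset.range k, ξ t ω} ∪
        {ω | x ≤ ∑ t ∈ Finset.range k, -ξ t ω}) := by
    rintro ω ⟨k, hk, hkx⟩
    simp only [Set.mem_iUnion]
    refine ⟨k, Finset.mem_range.2 (by omega), ?_⟩
    rcases lt_abs.1 hkx with h | h
    · exact Or.inl h.le
    · refine Or.inr ?_
      change x ≤ ∑ t ∈ Finset.range k, -ξ t ω
      rw [Finset.sum_neg_distrib]
      exact h.le
  refine (measureReal_mono hcover (measure_ne_top _ _)).trans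
    ((measureReal_biUnion_finset_le _ _).trans ?_)
  have hle : ∀ k ∈ Finset.range (T + 1), μ.real ({ω | x ≤ ∑ t ∈ Finset.range k, ξ t ω} ∪
        {ω | x ≤ ∑ t ∈ Finset.range k, -ξ t ω}) ≤ 2 / T ^ 2 := by
    intro k hk
    have hk' : k ≤ T := by have := Finset.mem_range.1 hk; omega
    have h1 := measureReal_sum_ge_le (μ := μ) hℱ hmeas hbd hmart (by omega) hk' hx0
    have h2 := measureReal_sum_ge_le (μ := μ) (ξ := fun t ω => -ξ t ω) hℱ
      (fun t => (hmeas t).neg) (fun t ω => by rw [abs_neg]; exact hbd t ω)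
      (fun t Z C hZ hC => by
        have := hmart t Z C hZ hC
        simp only [mul_neg, integral_neg, this, neg_zero]) (by omega) hk' hx0
    rw [hexp] at h1 h2
    refine (measureReal_union_le _ _).trans ?_
    have : (2 : ℝ) / T ^ 2 = 1 / T ^ 2 + 1 / T ^ 2 := by ring
    linarith
  refine (Finset.sum_le_sum hle).trans ?_
  rw [Finset.sum_const, Finset.card_range, nsmul_eq_mul]
  push_cast
  exact le_of_eq (by ring)

end Azuma

/-- Functions of `visits` depend only on the playthroughs counted. -/
theorem visits_congr {A : Type u} {p p' : ℕ → List A} {t : ℕ} (hp : ∀ r < t, p r = p' r)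
    (h : List A) : visits p t h = visits p' t h := by
  unfold visits
  congr 1
  refine Finset.filter_congr fun r hr => ?_
  rw [hp r (Finset.mem_range.1 hr)]

/-! ### Estimated widths against true widths -/

section Congr

variable {n : ℕ} {A : Type u} {I : Type v} {G : Game n A I} (b : Bounds G)

theorem expandedNodes_congr {p p' : ℕ → List A} {t : ℕ} (hp : ∀ r < t, p r = p' r) :
    expandedNodes G p t = expandedNodes G p' t := by
  ext h
  simp only [mem_expandedNodes]
  refine and_congr_right fun _ => exists_congr fun s => and_congr_right fun hs => ?_
  rw [hp s hs]

theorem radius_congr {p p' : ℕ → List A} {t : ℕ} (hp : ∀ r < t, p r = p' r) (h : List A) :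
    radius G p t h = radius G p' t h := by
  simp only [radius, numChance, visits_congr hp, expandedNodes_congr hp]

theorem confGame_congr {p p' : ℕ → List A} {t : ℕ} (hp : ∀ r < t, p r = p' r) :
    confGame G b p t = confGame G b p' t := by
  have h1 : empirical p t = empirical p' t := by
    ext h a
    simp only [empirical, visits_congr hp]
  have h2 : slack G b p t = slack G b p' t := by
    ext i h
    simp only [slack, radius_congr hp]
  simp only [confGame, h1, h2, expandedNodes_congr hp]

theorem numNodes_congr {p p' : ℕ → List A} {t : ℕ} (hp : ∀ r < t, p r = p' r) :
    numNodes G b p t = numNodes G b p' t := by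
  simp only [numNodes, confGame_congr b hp]

end Congr

namespace Run

variable {n : ℕ} {A : Type u} {I : Type v} {G : Game n A I} {b : Bounds G}
  {Ω : Type w} [mΩ : MeasurableSpace Ω] {μ : Measure Ω} (R : Run G b μ)

theorem measurable_conf_value (t : ℕ) (f : Pseudogame n A → List A → ℝ)
    (τ : Ω → Fin n → I → A → ℝ)
    (hτ : ∀ nat z, Measurable[R.ℱ t] fun ω => G.reach nat (τ ω) z) :
    Measurable[R.𝒢 t] fun ω => (R.conf (t + 1) ω).value G (f (R.conf (t + 1) ω)) (τ ω) := by
  refine R.measurable_history_mid (F := fun p ω =>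
    (confGame G b p (t + 1)).value G (f (confGame G b p (t + 1))) (τ ω)) (fun p => ?_)
    fun p p' hp => ?_
  · unfold Pseudogame.value
    exact Finset.measurable_sum _ fun z _ =>
      (((hτ _ z).mono (R.le_mid t) le_rfl)).mul_const _
  · rw [confGame_congr b hp]

theorem measurable_reach_update (t : ℕ) (i : Fin n) (s : I → A → ℝ) (nat : List A → A → ℝ)
    (z : List A) :
    Measurable[R.ℱ t] fun ω => G.reach nat (Function.update (R.σ t ω) i s) z := by
  induction z with
  | nil => exact measurable_const
  | cons a h ih =>
    simp only [G.reach_cons]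
    refine Measurable.mul ih ?_
    rcases hp : G.player h with _ | j
    · simp only [G.step_of_chance _ _ a hp]
      exact measurable_const
    · simp only [G.step_of_player _ _ a hp]
      by_cases hj : j = i
      · subst hj
        simp only [Function.update_self]
        exact measurable_const
      · simp only [Function.update_of_ne hj]
        exact R.σ_meas t j _ a

/-- the width of the confidence sequence after round `t`, for a deviation to `s` -/
def width (i : Fin n) (s : I → A → ℝ) (t : ℕ) (ω : Ω) : ℝ :=
  (R.conf (t + 1) ω).upperVal G i (Function.update (R.σ t ω) i s)
    - (R.conf (t + 1) ω).lowerVal G i (R.σ t ω)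

theorem measurable_width (i : Fin n) (s : I → A → ℝ) (t : ℕ) :
    Measurable[R.𝒢 t] (R.width i s t) :=
  (R.measurable_conf_value t (fun P => P.upper i) _ (R.measurable_reach_update t i s)).sub
    (R.measurable_conf_value t (fun P => P.lower i) _ (R.measurable_reach t))

/-- the estimate of the width -/
def estWidth (i : Fin n) (s : I → A → ℝ) (t : ℕ) (ω : Ω) : ℝ :=
  linVal G i (R.est t ω i) s - R.estLow t ω i

theorem measurable_linVal (i : Fin n) (s : I → A → ℝ) (t : ℕ) :
    Measurable[R.ℱ (t + 1)] fun ω => linVal G i (R.est t ω i) s :=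
  Finset.measurable_sum _ fun q _ => (R.est_meas t i q).const_mul _

theorem measurable_estWidth (i : Fin n) (s : I → A → ℝ) (t : ℕ) :
    Measurable[R.ℱ (t + 1)] (R.estWidth i s t) :=
  (R.measurable_linVal i s t).sub (R.estLow_meas t i)

theorem M_pos (t : ℕ) (ω : Ω) (i : Fin n) : 0 < R.M t ω i :=
  zero_lt_one.trans_le (R.one_le_M t ω i)

theorem integrable_estWidth (i : Fin n) {s : I → A → ℝ} (hs : s ∈ G.Strategy i) (t : ℕ) :
    Integrable (R.estWidth i s t) μ :=
  (R.est_int t i s hs).sub (R.estLow_int t i)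

theorem condExp_estWidth (i : Fin n) {s : I → A → ℝ} (hs : s ∈ G.Strategy i) (t : ℕ) :
    μ[R.estWidth i s t | R.𝒢 t] =ᵐ[μ] R.width i s t := by
  have h1 := condExp_sub (R.est_int t i s hs) (R.estLow_int t i) (R.𝒢 t)
  filter_upwards [h1, R.est_unbiased t i s hs, R.estLow_unbiased t i] with ω h2 h3 h4
  have h5 : R.estWidth i s t
      = (fun ω => linVal G i (R.est t ω i) s) - fun ω => R.estLow t ω i := rfl
  rw [h5, h2, Pi.sub_apply, h3, h4]
  rfl

theorem measurable_inv_M (i : Fin n) (t : ℕ) : Measurable[R.𝒢 t] fun ω => (R.M (t + 1) ω i)⁻¹ :=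
  (R.M_meas t i).inv

theorem abs_inv_M_le (i : Fin n) (t : ℕ) (ω : Ω) : |(R.M t ω i)⁻¹| ≤ 1 := by
  rw [abs_of_pos (inv_pos.2 (R.M_pos t ω i))]
  exact inv_le_one_of_one_le₀ (R.one_le_M t ω i)

theorem abs_estWidth_le (i : Fin n) {s : I → A → ℝ} (hs : s ∈ G.Strategy i) (t : ℕ) (ω : Ω) :
    |(R.M (t + 1) ω i)⁻¹ * R.estWidth i s t ω| ≤ 1 := by
  rw [abs_mul, abs_of_pos (inv_pos.2 (R.M_pos _ ω i)), inv_mul_le_one₀ (R.M_pos _ ω i)]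
  exact R.estLow_bound t ω i s hs

/-- The width is the conditional expectation of its estimate, and `M (t + 1)` is known before the
estimate is drawn. The normalized width thus inherits the bound of the normalized estimate, but only
almost surely. -/
theorem abs_width_le (i : Fin n) {s : I → A → ℝ} (hs : s ∈ G.Strategy i) (t : ℕ) :
    ∀ᵐ ω ∂μ, |(R.M (t + 1) ω i)⁻¹ * R.width i s t ω| ≤ 1 := by
  have h1 := condExp_mul_of_stronglyMeasurable_left (μ := μ) (f := fun ω => (R.M (t + 1) ω i)⁻¹)
    (g := R.estWidth i s t) (R.measurable_inv_M i t).stronglyMeasurable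
    ((R.integrable_estWidth i hs t).bdd_mul
      ((R.measurable_inv_M i t).mono (R.mid_le_top t) le_rfl).aestronglyMeasurable
      (c := 1) (Filter.Eventually.of_forall fun ω => R.abs_inv_M_le i _ ω))
    (R.integrable_estWidth i hs t)
  have h2 := ae_bdd_abs_condExp_of_ae_bdd_abs (m := R.𝒢 t) (μ := μ) (R := (1 : ℝ))
    (f := (fun ω => (R.M (t + 1) ω i)⁻¹) * R.estWidth i s t)
    (Filter.Eventually.of_forall fun ω => R.abs_estWidth_le i hs t ω)
  filter_upwards [h1, h2, R.condExp_estWidth i hs t] with ω h3 h4 h5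
  rw [h3, Pi.mul_apply, h5] at h4
  exact h4

variable [IsProbabilityMeasure μ]

/-- The estimated widths add up to about the true widths, with high probability. -/
theorem measureReal_estWidth_le (i : Fin n) {s : I → A → ℝ} (hs : s ∈ G.Strategy i) {T : ℕ}
    (hT : 1 < T) :
    μ.real {ω | ∑ t ∈ Finset.range T, R.estWidth i s t ω
        < ∑ t ∈ Finset.range T, R.width i s t ω - 8 * R.M T ω i * Real.sqrt (T * Real.log T)}
      ≤ 2 * (T + 1) / T ^ 2 := by
  -- The normalized width is clipped so that its bound holds everywhere; almost surely the clipping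
  -- has no effect. The differences `ξ` are then bounded by two.
  set y : ℕ → Ω → ℝ := fun t ω => max (-1) (min 1 ((R.M (t + 1) ω i)⁻¹ * R.width i s t ω))
    with hy
  have hymeas : ∀ t, Measurable[R.𝒢 t] (y t) := fun t =>
    measurable_const.max (measurable_const.min
      ((R.measurable_inv_M i t).mul (R.measurable_width i s t)))
  have hybd : ∀ t ω, |y t ω| ≤ 1 := fun t ω =>
    abs_le.2 ⟨le_max_left _ _, max_le (by norm_num) (min_le_left _ _)⟩
  have hyeq : ∀ t, ∀ᵐ ω ∂μ, y t ω = (R.M (t + 1) ω i)⁻¹ * R.width i s t ω := by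
    intro t
    filter_upwards [R.abs_width_le i hs t] with ω hω
    rw [abs_le] at hω
    simp only [hy]
    rw [min_eq_right hω.2, max_eq_right hω.1]
  set ξ : ℕ → Ω → ℝ := fun t ω => (R.M (t + 1) ω i)⁻¹ * R.estWidth i s t ω - y t ω with hξ
  have hxint : ∀ t, Integrable (fun ω => (R.M (t + 1) ω i)⁻¹ * R.estWidth i s t ω) μ := fun t =>
    integrable_of_bounded (((R.measurable_inv_M i t).mono (R.mid_le_top t) le_rfl).mul
      ((R.measurable_estWidth i s t).mono (R.ℱ.le _) le_rfl))
      fun ω => R.abs_estWidth_le i hs t ω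
  have htail := measureReal_exists_abs_sum_gt_le (μ := μ) (ξ := ξ) R.le_mid
    (fun t => ((((R.measurable_inv_M i t).mono (R.mid_le t) le_rfl)).mul
      (R.measurable_estWidth i s t)).sub ((hymeas t).mono (R.mid_le t) le_rfl))
    (fun t ω => (abs_sub _ _).trans (by linarith [R.abs_estWidth_le i hs t ω, hybd t ω]))
    (fun t Z C hZ hC => by
      have hZ' := hZ.mono (R.mid_le_top t) le_rfl
      have h1 : ∫ ω, Z ω * ((R.M (t + 1) ω i)⁻¹ * R.estWidth i s t ω) ∂μ
          = ∫ ω, Z ω * y t ω ∂μ := by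
        have h2 := integral_mul_of_condExp (μ := μ) (R.mid_le_top t)
          (Z := fun ω => Z ω * (R.M (t + 1) ω i)⁻¹) (hZ.mul (R.measurable_inv_M i t)) (C := C)
          (fun ω => by
            rw [abs_mul]
            exact (mul_le_of_le_one_right (abs_nonneg _) (R.abs_inv_M_le i _ ω)).trans (hC ω))
          (R.integrable_estWidth i hs t) (R.condExp_estWidth i hs t)
        simp only [mul_assoc] at h2
        rw [h2]
        refine integral_congr_ae ?_
        filter_upwards [hyeq t] with ω hω
        rw [hω]
      simp only [hξ, mul_sub]
      rw [integral_sub, h1, sub_self]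
      · exact (hxint t).bdd_mul hZ'.aestronglyMeasurable (Filter.Eventually.of_forall hC)
      · exact (integrable_of_bounded ((hymeas t).mono (R.mid_le_top t) le_rfl)
          (hybd t)).bdd_mul hZ'.aestronglyMeasurable (Filter.Eventually.of_forall hC))
    hT
  refine le_trans ?_ htail
  refine ENNReal.toReal_mono (measure_ne_top _ _) (measure_mono_ae ?_)
  filter_upwards [ae_all_iff.2 hyeq] with ω hω hlt
  by_contra hcon
  have hcon' : ∀ k ≤ T, |∑ t ∈ Finset.range k, ξ t ω| ≤ 4 * Real.sqrt (T * Real.log T) := by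
    intro k hk
    by_contra h
    exact hcon ⟨k, hk, not_le.1 h⟩
  -- Undoing the normalization by the nondecreasing weights `M (t + 1)` doubles the Azuma radius `4
  -- * √(T log T)`, whence the constant 8.
  have h1 := sum_mul_ge_of_abs_le (M := fun t => R.M t ω i) (R.M_pos 0 ω i).le
    (fun t => R.M_mono t ω i) hcon'
  have h2 : ∀ t, R.M (t + 1) ω i * ξ t ω = R.estWidth i s t ω - R.width i s t ω := by
    intro t
    have := (R.M_pos (t + 1) ω i).ne'
    simp only [hξ, hω t]
    field_simp
  simp only [h2, Finset.sum_sub_distrib] at h1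
  have hlt' : ∑ t ∈ Finset.range T, R.estWidth i s t ω
    < ∑ t ∈ Finset.range T, R.width i s t ω - 8 * R.M T ω i * Real.sqrt (T * Real.log T) := hlt
  linarith

end Run

theorem inv_mul_sqrt_mul_log {T : ℝ} (hT : 0 < T) :
    1 / T * Real.sqrt (T * Real.log T) = Real.sqrt (Real.log T / T) := by
  have h1 : Real.log T / T = (1 / T) ^ 2 * (T * Real.log T) := by field_simp
  rw [h1, Real.sqrt_mul (sq_nonneg (1 / T)), Real.sqrt_sq (by positivity)]

/-! ### From widths to equilibrium gaps -/

section Gap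

variable {n : ℕ} {A : Type u} {I : Type v} {G : Game n A I} {b : Bounds G}

theorem isLinear_average (P : Pseudogame n A) (i : Fin n) (σ : ℕ → Fin n → I → A → ℝ) (T : ℕ) :
    G.IsLinear i fun s => (1 / (T : ℝ)) * ∑ t ∈ Finset.range T,
      P.upperVal G i (Function.update (σ t) i s) :=
  (Game.IsLinear.sum fun t _ => Game.isLinear_value P (P.upper i) (σ t) i).const_mul _

theorem update_mem {σ : Fin n → I → A → ℝ} (hσ : ∀ j, σ j ∈ G.Strategy j) {i : Fin n}
    {s : I → A → ℝ} (hs : s ∈ G.Strategy i) (j : Fin n) :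
    Function.update σ i s j ∈ G.Strategy j := by
  by_cases hj : j = i
  · subst hj; rwa [Function.update_self]
  · rw [Function.update_of_ne hj]; exact hσ j

variable {play : ℕ → List A} {σ : ℕ → Fin n → I → A → ℝ} {T : ℕ} {Q : Pseudogame n A}

/-- The gap in the confidence sequence bounds the gap in the pseudogames that it encloses. -/
theorem gap_le_gap_confGame (hσ : ∀ t j, σ t j ∈ G.Strategy j) (hQ : Encloses b play T Q)
    (hacc : Accurate G play T) (i : Fin n) :
    Q.gap G i σ T ≤ (confGame G b play T).gap G i σ T := by
  unfold Pseudogame.gap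
  refine sub_le_sub ?_ (mul_le_mul_of_nonneg_left (Finset.sum_le_sum fun t _ =>
    hQ.lower i _ (hσ t) hacc) (by positivity))
  refine (isLinear_average Q i σ T).sSup_le fun π hπ => ?_
  have hs := G.pure_mem hπ
  refine le_trans ?_ ((isLinear_average (confGame G b play T) i σ T).le_sSup hs)
  exact mul_le_mul_of_nonneg_left (Finset.sum_le_sum fun t _ =>
    hQ.upper i _ (update_mem (hσ t) hs) hacc) (by positivity)

end Gap

namespace Run

variable {n : ℕ} {A : Type u} {I : Type v} {G : Game n A I} {b : Bounds G}
  {Ω : Type w} [mΩ : MeasurableSpace Ω] {μ : Measure Ω} (R : Run G b μ)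

theorem isLinear_estimate (i : Fin n) (T : ℕ) (ω : Ω) :
    G.IsLinear i fun s => (1 / (T : ℝ)) * ∑ t ∈ Finset.range T,
      (linVal G i (R.est t ω i) s - R.estLow t ω i) :=
  (Game.IsLinear.sum fun t _ =>
    (Game.isLinear_linVal (R.est t ω i)).sub (Game.isLinear_const _)).const_mul _

/-- If the empirical frequencies are accurate from time `t₀` on and the estimates are close to the
confidence sequence, then the estimated gap bounds the gap. -/
theorem gap_le_epsTilde {Q : Pseudogame n A} {i : Fin n} {T t₀ : ℕ} {ω : Ω} (hT : 0 < T)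
    (hQ : ∀ t ≤ T, Encloses b (fun r => R.play r ω) t Q)
    (hacc : ∀ t, t₀ ≤ t → t ≤ T → Accurate G (fun r => R.play r ω) t)
    (ht₀ : (t₀ : ℝ) ≤ 2 * Real.sqrt (T * Real.log T))
    (hest : ∀ π ∈ G.choices i, ∑ t ∈ Finset.range T, R.width i (G.pure π) t ω
      - 8 * R.M T ω i * Real.sqrt (T * Real.log T)
      ≤ ∑ t ∈ Finset.range T, R.estWidth i (G.pure π) t ω) :
    Q.gap G i (fun t => R.σ t ω) T ≤ R.epsTilde 12 i T ω := by
  have hT0 : (0 : ℝ) < T := by exact_mod_cast hT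
  have hM := R.one_le_M T ω i
  have key : ∀ π ∈ G.choices i, 1 / (T : ℝ) * ∑ t ∈ Finset.range T,
      Q.upperVal G i (Function.update (R.σ t ω) i (G.pure π))
      ≤ R.epsTilde 12 i T ω + 1 / (T : ℝ) * ∑ t ∈ Finset.range T, Q.lowerVal G i (R.σ t ω) := by
    intro π hπ
    have hs := G.pure_mem hπ
    -- The estimates in round index `t` refer to the pseudogame after `t + 1` playthroughs. In the
    -- rounds before `t₀` the upper and the lower bound may each be wrong by one.
    have h1 : ∀ t ∈ Finset.range T, Q.upperVal G i (Function.update (R.σ t ω) i (G.pure π))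
        - Q.lowerVal G i (R.σ t ω) ≤ R.width i (G.pure π) t ω + if t < t₀ then 2 else 0 := by
      intro t ht
      have htT : t + 1 ≤ T := Finset.mem_range.1 ht
      have hE := hQ (t + 1) htT
      have hup := update_mem (R.σ_mem t ω) hs
      change _ ≤ ((confGame G b (fun r => R.play r ω) (t + 1)).upperVal G i _
        - (confGame G b (fun r => R.play r ω) (t + 1)).lowerVal G i _) + _
      split_ifs with hc
      · have h2 := hE.upper_add_one i _ hup
        have h3 := hE.lower_add_one i _ (R.σ_mem t ω)
        linarith
      · have ha := hacc (t + 1) (by omega) htT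
        have h2 := hE.upper i _ hup ha
        have h3 := hE.lower i _ (R.σ_mem t ω) ha
        linarith
    have h2 : ∑ t ∈ Finset.range T, (if t < t₀ then (2 : ℝ) else 0) ≤ 2 * t₀ := by
      rw [← Finset.sum_filter, Finset.sum_const, nsmul_eq_mul, mul_comm]
      refine mul_le_mul_of_nonneg_left ?_ (by norm_num)
      have : ((Finset.range T).filter fun t => t < t₀) ⊆ Finset.range t₀ := by
        intro t ht
        exact Finset.mem_range.2 (Finset.mem_filter.1 ht).2
      exact_mod_cast (Finset.card_le_card this).trans (Finset.card_range t₀).le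
    have h3 := Finset.sum_le_sum h1
    rw [Finset.sum_sub_distrib, Finset.sum_add_distrib] at h3
    have h4 := hest π hπ
    have h5 := (R.isLinear_estimate i T ω).le_sSup hs
    have h6 := inv_mul_sqrt_mul_log hT0
    have h7 : Real.sqrt (T * Real.log T) ≤ R.M T ω i * Real.sqrt (T * Real.log T) :=
      le_mul_of_one_le_left (Real.sqrt_nonneg _) hM
    -- The constant is `12 = 8 + 4`: 8 from the estimates, and `2 * t₀ ≤ 4 * √(T log T)` from the
    -- early rounds, where `M ≥ 1` allows the same factor `M`.
    have h8 : ∑ t ∈ Finset.range T, Q.upperVal G i (Function.update (R.σ t ω) i (G.pure π))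
        ≤ ∑ t ∈ Finset.range T, R.estWidth i (G.pure π) t ω
          + 12 * R.M T ω i * Real.sqrt (T * Real.log T)
          + ∑ t ∈ Finset.range T, Q.lowerVal G i (R.σ t ω) := by linarith
    have h9 := mul_le_mul_of_nonneg_left h8 (by positivity : 0 ≤ 1 / (T : ℝ))
    have h10 : 1 / (T : ℝ) * (∑ t ∈ Finset.range T, R.estWidth i (G.pure π) t ω
          + 12 * R.M T ω i * Real.sqrt (T * Real.log T)
          + ∑ t ∈ Finset.range T, Q.lowerVal G i (R.σ t ω))
        = 1 / (T : ℝ) * ∑ t ∈ Finset.range T, R.estWidth i (G.pure π) t ω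
          + 12 * R.M T ω i * Real.sqrt (Real.log T / T)
          + 1 / (T : ℝ) * ∑ t ∈ Finset.range T, Q.lowerVal G i (R.σ t ω) := by
      rw [← h6]; ring
    rw [h10] at h9
    refine h9.trans (add_le_add_left (add_le_add_left ?_ _) _)
    exact h5
  unfold Pseudogame.gap
  have := (isLinear_average Q i (fun t => R.σ t ω) T).sSup_le key
  linarith

/-- The two sources of failure, inaccurate frequencies after `t₀` and unlucky estimates for some
pure deviation, get probability `1 / √T` each. The size conditions on `T` absorb the number of nodes
and the number of pure strategies. -/
theorem correctness_failure_le [IsProbabilityMeasure μ] {T : ℕ} (hT : 1 < T)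
    (h1 : 1 ≤ (T : ℝ) * Real.log T) (h2 : 2 * (G.tree.card : ℝ) ≤ Real.sqrt (Real.log T))
    (h3 : 4 * ((∑ i, (G.choices i).card : ℕ) : ℝ) ≤ Real.sqrt T) :
    μ.real {ω | ¬ ∀ i : Fin n,
      (fullGame G).gap G i (fun t => R.σ t ω) T ≤ R.epsStar 12 i T ω ∧
      (b.Nested → (R.exact T ω).gap G i (fun t => R.σ t ω) T ≤ R.epsStar 12 i T ω)}
    ≤ 2 / Real.sqrt T := by
  have hT0 : (0 : ℝ) < T := by exact_mod_cast (by omega : 0 < T)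
  have hlog : 0 < Real.log T := Real.log_pos (by exact_mod_cast hT)
  -- Without players the claim is vacuous; this case is separated because the factor `n` inside the
  -- logarithm of the radius has to be at least one.
  rcases Nat.eq_zero_or_pos n with rfl | hn
  · have : {ω | ¬ ∀ i : Fin 0,
      (fullGame G).gap G i (fun t => R.σ t ω) T ≤ R.epsStar 12 i T ω ∧
      (b.Nested → (R.exact T ω).gap G i (fun t => R.σ t ω) T ≤ R.epsStar 12 i T ω)} = ∅ := by
      ext ω
      simp
    rw [this, measureReal_empty]
    positivity
  -- Large enough that `2 * |tree| / t₀ ≤ 1 / √T`, thanks to the extra `√(log T)`, and small enough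
  -- that giving up the first `t₀` rounds stays within the error term of `ε̃`.
  set t₀ := ⌈Real.sqrt (T * Real.log T)⌉₊ with ht₀
  have hs1 : 1 ≤ Real.sqrt (T * Real.log T) := Real.one_le_sqrt.2 h1
  have ht1 : Real.sqrt (T * Real.log T) ≤ t₀ := Nat.le_ceil _
  have ht2 : (t₀ : ℝ) ≤ 2 * Real.sqrt (T * Real.log T) := by
    have := (Nat.ceil_lt_add_one (Real.sqrt_nonneg (T * Real.log T))).le
    linarith
  have ht3 : t₀ ≠ 0 := by
    intro h
    rw [h, Nat.cast_zero] at ht1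
    linarith
  have ht4 : t₀ ≤ T := by
    refine Nat.ceil_le.2 ?_
    rw [Real.sqrt_le_left hT0.le, sq]
    exact mul_le_mul_of_nonneg_left ((Real.log_le_sub_one_of_pos hT0).trans (by linarith)) hT0.le
  -- The bad events of the estimates, one for each player and pure deviation; linearity extends the
  -- bound to all deviations.
  set B : ∀ i : Fin n, (∀ l ∈ G.infosets i, A) → Set Ω := fun i π =>
    {ω | ∑ t ∈ Finset.range T, R.estWidth i (G.pure π) t ω
        < ∑ t ∈ Finset.range T, R.width i (G.pure π) t ω
          - 8 * R.M T ω i * Real.sqrt (T * Real.log T)} with hB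
  have hcover : {ω | ¬ ∀ i : Fin n,
      (fullGame G).gap G i (fun t => R.σ t ω) T ≤ R.epsStar 12 i T ω ∧
      (b.Nested → (R.exact T ω).gap G i (fun t => R.σ t ω) T ≤ R.epsStar 12 i T ω)}
      ⊆ {ω | ∃ t, t₀ ≤ t ∧ t ≤ T ∧ ¬ Accurate G (fun r => R.play r ω) t} ∪
        ⋃ i ∈ Finset.univ, ⋃ π ∈ G.choices i, B i π := by
    intro ω hω
    by_contra hcon
    rw [Set.mem_union, not_or] at hcon
    obtain ⟨hc1, hc2⟩ := hcon
    have hacc : ∀ t, t₀ ≤ t → t ≤ T → Accurate G (fun r => R.play r ω) t := by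
      intro t h4 h5
      by_contra h6
      exact hc1 ⟨t, h4, h5, h6⟩
    have hest : ∀ i, ∀ π ∈ G.choices i, ∑ t ∈ Finset.range T, R.width i (G.pure π) t ω
        - 8 * R.M T ω i * Real.sqrt (T * Real.log T)
        ≤ ∑ t ∈ Finset.range T, R.estWidth i (G.pure π) t ω := by
      intro i π hπ
      by_contra h6
      refine hc2 ?_
      simp only [Set.mem_iUnion]
      exact ⟨i, Finset.mem_univ i, π, hπ, not_le.1 h6⟩
    have hQ : ∀ Q : Pseudogame n A, (∀ t ≤ T, Encloses b (fun r => R.play r ω) t Q) → ∀ i,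
        Q.gap G i (fun t => R.σ t ω) T ≤ R.epsStar 12 i T ω := fun Q hQ i =>
      le_min (gap_le_gap_confGame (fun t => R.σ_mem t ω) (hQ T le_rfl) (hacc T ht4 le_rfl) i)
        (R.gap_le_epsTilde (by omega) hQ hacc ht2 (hest i))
    refine hω fun i => ⟨hQ _ (fun t _ => encloses_fullGame (fun r => R.play_mem r ω) t) i,
      fun hn => hQ _ (fun t ht => encloses_exactGame hn (fun r => R.play_mem r ω) ht) i⟩
  have hsqrt : Real.sqrt (T * Real.log T) = Real.sqrt T * Real.sqrt (Real.log T) :=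
    Real.sqrt_mul hT0.le _
  have hsT : 0 < Real.sqrt T := Real.sqrt_pos.2 hT0
  have hbound1 : (G.tree.card : ℝ) * (2 / t₀) ≤ 1 / Real.sqrt T := by
    have h4 : (0 : ℝ) < t₀ := by linarith
    rw [← mul_div_assoc, div_le_div_iff₀ h4 hsT, one_mul]
    refine le_trans ?_ ht1
    rw [hsqrt]
    nlinarith
  have hbound2 : ∑ i, ∑ π ∈ G.choices i, μ.real (B i π) ≤ 1 / Real.sqrt T := by
    have h4 : ∀ i, ∀ π ∈ G.choices i, μ.real (B i π) ≤ 4 / T := by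
      intro i π hπ
      refine (R.measureReal_estWidth_le i (G.pure_mem hπ) hT).trans ?_
      have : (1 : ℝ) ≤ T := by exact_mod_cast (by omega : 1 ≤ T)
      rw [div_le_div_iff₀ (by positivity) hT0]
      nlinarith
    calc ∑ i, ∑ π ∈ G.choices i, μ.real (B i π)
        ≤ ∑ i, ∑ π ∈ G.choices i, 4 / (T : ℝ) :=
          Finset.sum_le_sum fun i _ => Finset.sum_le_sum fun π hπ => h4 i π hπ
      _ = 4 * ((∑ i, (G.choices i).card : ℕ) : ℝ) / T := by
          simp only [Finset.sum_const, nsmul_eq_mul]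
          rw [← Finset.sum_mul]
          push_cast
          ring
      _ ≤ Real.sqrt T / T := by gcongr
      _ = 1 / Real.sqrt T := Real.sqrt_div_self'
  calc _ ≤ _ := measureReal_mono hcover (measure_ne_top _ _)
    _ ≤ _ := measureReal_union_le _ _
    _ ≤ 1 / Real.sqrt T + 1 / Real.sqrt T := by
        refine add_le_add ((R.measureReal_not_accurate_le hn ht3 T).trans hbound1) ?_
        refine (measureReal_biUnion_finset_le _ _).trans (le_trans ?_ hbound2)
        exact Finset.sum_le_sum fun i _ => measureReal_biUnion_finset_le _ _
    _ = 2 / Real.sqrt T := by ring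

end Run

/-! ### Summing over the visits to a node -/

section VisitSums

variable {A : Type u}

/-- Summing a function of the number of previous visits over the visits to a node. -/
theorem sum_visited (play : ℕ → List A) (g : List A) (f : ℕ → ℝ) (T : ℕ) :
    ∑ t ∈ Finset.range T, (if g <:+ play t then f (visits play t g) else 0)
      = ∑ m ∈ Finset.range (visits play T g), f m := by
  induction T with
  | zero => simp [visits]
  | succ T ih =>
    rw [Finset.sum_range_succ, ih, visits_succ]
    split_ifs
    · rw [Finset.sum_range_succ]
    · simp

/-- The increment `√(k + 1) - √k` is at least `1 / (3 * √k)` for `k ≥ 1`. The entry `max 1 m`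
charges the first visit, with `m = 0` earlier ones, at one. -/
theorem sum_sqrt_inv_le (k : ℕ) :
    ∑ m ∈ Finset.range k, 1 / Real.sqrt (max 1 m : ℕ) ≤ 3 * Real.sqrt k := by
  induction k with
  | zero => simp
  | succ k ih =>
    rw [Finset.sum_range_succ]
    rcases Nat.eq_zero_or_pos k with rfl | hk
    · simp
    · have hk0 : (0 : ℝ) < k := by exact_mod_cast hk
      have hk1 : (1 : ℝ) ≤ k := by exact_mod_cast hk
      rw [max_eq_right hk]
      have hs : 0 < Real.sqrt k := Real.sqrt_pos.2 hk0
      have h1 : Real.sqrt k ^ 2 = k := Real.sq_sqrt hk0.le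
      have h2 : Real.sqrt (k + 1 : ℕ) ^ 2 = k + 1 := by
        rw [Real.sq_sqrt (by positivity)]; push_cast; ring
      have h3 : Real.sqrt k + 1 / (3 * Real.sqrt k) ≤ Real.sqrt (k + 1 : ℕ) := by
        refine Real.le_sqrt_of_sq_le ?_
        have : (Real.sqrt k + 1 / (3 * Real.sqrt k)) ^ 2
            = Real.sqrt k ^ 2 + 2 / 3 + 1 / (9 * Real.sqrt k ^ 2) := by
          field_simp
          ring
        rw [this, h1]
        push_cast
        have h4 : 1 / (9 * (k : ℝ)) ≤ 1 / 3 := by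
          rw [div_le_div_iff₀ (by positivity) (by norm_num)]
          linarith
        linarith
      have h5 : 1 / Real.sqrt k = 3 * (1 / (3 * Real.sqrt k)) := by field_simp
      rw [h5]
      linarith

/-- Since `1 / max 1 m ≤ 2 / (m + 1)`, the sum is at most twice a harmonic number, and `1 + log k ≤
2 * log T`. -/
theorem sum_inv_le {k T : ℕ} (hkT : k ≤ T) (hT : 1 ≤ Real.log T) :
    ∑ m ∈ Finset.range k, 1 / ((max 1 m : ℕ) : ℝ) ≤ 4 * Real.log T := by
  have h1 : ∑ m ∈ Finset.range k, 1 / ((max 1 m : ℕ) : ℝ) ≤ 2 * (harmonic k : ℝ) := by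
    rw [harmonic]
    push_cast
    rw [Finset.mul_sum]
    refine Finset.sum_le_sum fun m _ => ?_
    rw [← div_eq_mul_inv, div_le_div_iff₀ (by positivity) (by positivity)]
    have h2 : (1 : ℝ) ≤ max 1 (m : ℝ) := le_max_left _ _
    have h3 : (m : ℝ) ≤ max 1 (m : ℝ) := le_max_right _ _
    linarith
  have h2 := harmonic_le_one_add_log k
  rcases Nat.eq_zero_or_pos k with rfl | hk
  · simp; linarith
  · have h3 : Real.log k ≤ Real.log T :=
      Real.log_le_log (by exact_mod_cast hk) (by exact_mod_cast hkT)
    linarith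

end VisitSums

/-! ### Local widths, and empirical against true reach -/

section Bound

variable {n : ℕ} {A : Type u} {I : Type v} {G : Game n A I} {b : Bounds G} {play : ℕ → List A}

theorem card_actions_le (h : List A) : (G.actions h).card ≤ G.tree.card :=
  Finset.card_le_card_of_injOn (fun a => a :: h) (fun _ ha => G.mem_actions.1 ha)
    fun _ _ _ _ e => (List.cons.inj e).1

/-- A bound on the width at the node `g` after `v` visits. -/
def nodeWidth (G : Game n A I) (T : ℕ) (g : List A) (v : ℕ) : ℝ :=
  (if G.IsChance g then
    4 * (G.actions g).card * Real.sqrt (Real.log T) * (1 / Real.sqrt (max 1 v : ℕ)) else 0)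
  + if v = 0 then 1 else 0

theorem nodeWidth_nonneg (T : ℕ) (g : List A) (v : ℕ) : 0 ≤ nodeWidth G T g v := by
  unfold nodeWidth
  refine add_nonneg ?_ ?_
  · split_ifs
    · positivity
    · exact le_rfl
  · split_ifs <;> norm_num

theorem sqrt_log_le {T : ℕ} (hT : 1 ≤ Real.log T) : Real.sqrt (Real.log T) ≤ Real.log T := by
  rw [Real.sqrt_le_left (by linarith)]
  nlinarith

theorem one_le_card_tree : (1 : ℝ) ≤ G.tree.card := by
  exact_mod_cast Finset.card_pos.2 ⟨[], G.root_mem⟩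

theorem nodeWidth_le {T : ℕ} (hT : 1 ≤ Real.log T) (g : List A) (v : ℕ) :
    nodeWidth G T g v ≤ 5 * G.tree.card * Real.log T := by
  have h1 := one_le_card_tree (G := G)
  have h2 : ((G.actions g).card : ℝ) ≤ G.tree.card := by exact_mod_cast card_actions_le g
  have h3 : 1 / Real.sqrt (max 1 v : ℕ) ≤ 1 := by
    rw [div_le_one (Real.sqrt_pos.2 (by positivity))]
    exact Real.one_le_sqrt.2 (by exact_mod_cast le_max_left 1 v)
  have h4 : 4 * (G.actions g).card * Real.sqrt (Real.log T) * (1 / Real.sqrt (max 1 v : ℕ))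
      ≤ 4 * G.tree.card * Real.log T * 1 := by
    gcongr
    exact sqrt_log_le hT
  unfold nodeWidth
  split_ifs <;> nlinarith

theorem sum_nodeWidth_le {T k : ℕ} (hT : 1 ≤ Real.log T) (hk : k ≤ T) (g : List A) :
    ∑ m ∈ Finset.range k, nodeWidth G T g m
      ≤ if 0 < k then 12 * Real.sqrt T * Real.log T * (G.actions g).card + 1 else 0 := by
  split_ifs with hk0
  · unfold nodeWidth
    rw [Finset.sum_add_distrib]
    refine add_le_add ?_ ?_
    · split_ifs
      · rw [← Finset.mul_sum]
        calc 4 * ((G.actions g).card : ℝ) * Real.sqrt (Real.log T) *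
              ∑ m ∈ Finset.range k, 1 / Real.sqrt (max 1 m : ℕ)
            ≤ 4 * (G.actions g).card * Real.log T * (3 * Real.sqrt T) := by
              gcongr
              · exact sqrt_log_le hT
              · refine (sum_sqrt_inv_le k).trans ?_
                gcongr
          _ = _ := by ring
      · rw [Finset.sum_const_zero]
        have : 0 ≤ Real.log T := by linarith
        positivity
    · rw [Finset.sum_ite_eq', if_pos (Finset.mem_range.2 hk0)]
  · have : k = 0 := by omega
    simp [this]

/-- The nodes of the confidence sequence weighted by their numbers of actions. -/
theorem sum_card_actions_le (t : ℕ) :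
    ∑ g ∈ expandedNodes G play t, (G.actions g).card ≤ numNodes G b play t := by
  rw [numNodes, ← Finset.card_sigma]
  refine Finset.card_le_card_of_injOn (fun x => x.2 :: x.1) (fun x hx => ?_) ?_
  · have := Finset.mem_sigma.1 hx
    exact Pseudogame.cons_mem_nodes.2 ⟨this.2, this.1⟩
  · rintro ⟨g, a⟩ _ ⟨g', a'⟩ _ hx
    simp only [List.cons.injEq] at hx
    obtain ⟨rfl, rfl⟩ := hx
    rfl

theorem card_expandedNodes_le (t : ℕ) : (expandedNodes G play t).card ≤ numNodes G b play t := by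
  refine Finset.card_le_card fun h hh => Pseudogame.mem_nodes.2 ⟨expandedNodes_subset t hh, ?_⟩
  cases h with
  | nil => exact Or.inl rfl
  | cons a h => exact Or.inr (expandedNodes_tail a h hh)

theorem one_le_numNodes (t : ℕ) : 1 ≤ numNodes G b play t :=
  Finset.card_pos.2 ⟨[], Pseudogame.nil_mem_nodes⟩

/-- Unvisited nodes contribute nothing. An expanded node costs `O(√T log T)` per action plus one,
and children of distinct expanded nodes are distinct nodes of the pseudogame. This is where `N_T`
enters, without any other dependence on the size of the game. -/
theorem sum_tree_nodeWidth_le {T : ℕ} (hT : 1 ≤ Real.log T) :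
    ∑ g ∈ G.tree, ∑ m ∈ Finset.range (visits play T g), nodeWidth G T g m
      ≤ 13 * Real.sqrt T * Real.log T * numNodes G b play T := by
  have hT1 : 1 ≤ Real.sqrt T := by
    refine Real.one_le_sqrt.2 ?_
    by_contra h
    have := Real.log_nonpos (Nat.cast_nonneg T) (not_le.1 h).le
    linarith
  have h1 : ∀ g ∈ G.tree, ∑ m ∈ Finset.range (visits play T g), nodeWidth G T g m
      ≤ if g ∈ expandedNodes G play T then
        12 * Real.sqrt T * Real.log T * (G.actions g).card + 1 else 0 := by
    intro g hg
    refine (sum_nodeWidth_le hT (visits_le T g) g).trans (le_of_eq ?_)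
    have : 0 < visits play T g ↔ g ∈ expandedNodes G play T := by
      rw [visits_pos, mem_expandedNodes]
      exact ⟨fun h => ⟨hg, h⟩, fun h => h.2⟩
    simp only [this]
  refine (Finset.sum_le_sum h1).trans ?_
  rw [← Finset.sum_filter, Finset.filter_mem_eq_inter,
    Finset.inter_eq_right.2 (expandedNodes_subset T), Finset.sum_add_distrib, ← Finset.mul_sum,
    Finset.sum_const, nsmul_eq_mul, mul_one]
  have h2 : (∑ g ∈ expandedNodes G play T, ((G.actions g).card : ℝ)) ≤ numNodes G b play T := by
    exact_mod_cast sum_card_actions_le T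
  have h3 : ((expandedNodes G play T).card : ℝ) ≤ numNodes G b play T := by
    exact_mod_cast card_expandedNodes_le T
  have h4 : 1 ≤ Real.sqrt T * Real.log T := one_le_mul_of_one_le_of_one_le hT1 hT
  have h5 : 12 * Real.sqrt T * Real.log T * ∑ g ∈ expandedNodes G play T,
      ((G.actions g).card : ℝ) ≤ 12 * Real.sqrt T * Real.log T * numNodes G b play T := by
    gcongr
  have h6 : (numNodes G b play T : ℝ) ≤ Real.sqrt T * Real.log T * numNodes G b play T :=
    le_mul_of_one_le_left (Nat.cast_nonneg _) h4
  linarith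

/-- An expanded node has at least `max 1 (visits play t g)` visits after the round, so the radius is
controlled by a count known before the round. Once `T` exceeds `|tree| * n`, the logarithm in the
radius is at most `3 * log T`. -/
theorem radius_le {T t : ℕ} (hT : 1 ≤ Real.log T) (hn : 0 < n) (hG : G.tree.card * n ≤ T)
    (ht : t < T) {g : List A} (hg : g ∈ expandedNodes G play (t + 1)) (hc : G.IsChance g) :
    2 * radius G play (t + 1) g ≤ 4 * (G.actions g).card * Real.sqrt (Real.log T) *
      (1 / Real.sqrt (max 1 (visits play t g) : ℕ)) := by
  have hT1 : 1 ≤ T := by omega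
  have hT0 : (0 : ℝ) < T := by exact_mod_cast hT1
  have ha : (1 : ℝ) ≤ (G.actions g).card := by exact_mod_cast Finset.card_pos.2 hc.2.1
  have hv : ((max 1 (visits play t g) : ℕ) : ℝ) ≤ visits play (t + 1) g := by
    have h1 := visits_pos_of_expanded hg
    have h2 := visits_mono (play := play) (Nat.le_succ t) g
    exact_mod_cast max_le h1 h2
  have hv0 : (0 : ℝ) < (max 1 (visits play t g) : ℕ) := by positivity
  have hC1 : 1 ≤ numChance G play (t + 1) :=
    Finset.card_pos.2 ⟨g, Finset.mem_filter.2 ⟨hg, hc⟩⟩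
  have hC2 : numChance G play (t + 1) ≤ G.tree.card :=
    Finset.card_le_card ((Finset.filter_subset _ _).trans (expandedNodes_subset _))
  have hlog : Real.log (((t + 1 : ℕ) : ℝ) ^ 2 * (numChance G play (t + 1) : ℝ) * (n : ℝ))
      ≤ 3 * Real.log T := by
    have h1 : (t + 1) ^ 2 * numChance G play (t + 1) * n ≤ T ^ 3 := by
      calc (t + 1) ^ 2 * numChance G play (t + 1) * n
          ≤ T ^ 2 * G.tree.card * n := by gcongr; omega
        _ = T ^ 2 * (G.tree.card * n) := by ring
        _ ≤ T ^ 2 * T := by gcongr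
        _ = T ^ 3 := by ring
    have h2 : 0 < (t + 1) ^ 2 * numChance G play (t + 1) * n := by positivity
    have h3 : Real.log (T ^ 3) = 3 * Real.log T := by rw [Real.log_pow]; norm_num
    rw [← h3]
    refine Real.log_le_log ?_ ?_
    · exact_mod_cast h2
    · exact_mod_cast h1
  have hlog2 : Real.log 2 ≤ Real.log T := by
    have := Real.log_two_lt_d9
    linarith
  have hkey : radius G play (t + 1) g ≤ Real.sqrt ((2 * (G.actions g).card) ^ 2 * (Real.log T *
      (1 / ((max 1 (visits play t g) : ℕ) : ℝ)))) := by
    refine Real.sqrt_le_sqrt ?_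
    calc 1 / (2 * (visits play (t + 1) g : ℝ)) * ((G.actions g).card * Real.log 2
          + Real.log (((t + 1 : ℕ) : ℝ) ^ 2 * (numChance G play (t + 1) : ℝ) * (n : ℝ)))
        ≤ 1 / (2 * ((max 1 (visits play t g) : ℕ) : ℝ)) * ((G.actions g).card * Real.log T
          + (G.actions g).card * (3 * Real.log T)) := by
          refine mul_le_mul (one_div_le_one_div_of_le (by positivity) (by linarith))
            (add_le_add (by gcongr) (hlog.trans ?_)) ?_ (by positivity)
          · exact le_mul_of_one_le_left (by linarith) ha
          · refine add_nonneg (mul_nonneg (by positivity) (Real.log_nonneg (by norm_num)))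
              (Real.log_nonneg ?_)
            have h2 : 1 ≤ (t + 1) ^ 2 * numChance G play (t + 1) * n :=
              Nat.one_le_iff_ne_zero.2 (by positivity)
            exact_mod_cast h2
      _ = 2 * (G.actions g).card * (Real.log T * (1 / ((max 1 (visits play t g) : ℕ) : ℝ))) := by
          field_simp
          ring
      _ ≤ _ := by
          refine mul_le_mul_of_nonneg_right ?_ (mul_nonneg (by linarith) (by positivity))
          nlinarith
  rw [Real.sqrt_mul (sq_nonneg _), Real.sqrt_sq (by positivity),
    Real.sqrt_mul (by linarith : 0 ≤ Real.log T), one_div, Real.sqrt_inv] at hkey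
  rw [one_div]
  linarith

/-- The width of the confidence sequence at a node. -/
theorem upper_sub_lower_le {T t : ℕ} (hT : 1 ≤ Real.log T) (hG : G.tree.card * n ≤ T)
    (ht : t < T) (i : Fin n) {g : List A} (hg : g ∈ G.tree) :
    (confGame G b play (t + 1)).upper i g - (confGame G b play (t + 1)).lower i g
      ≤ nodeWidth G T g (visits play t g) := by
  have hr := b.range_le i g hg
  simp only [confGame, slack, nodeWidth]
  by_cases he : g ∈ expandedNodes G play (t + 1)
  · simp only [he, if_true]
    have h0 : (0 : ℝ) ≤ if visits play t g = 0 then 1 else 0 := by split_ifs <;> norm_num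
    split_ifs with hc hv hv
    · have h1 := radius_le hT i.pos hG ht he hc
      have h2 := mul_le_mul_of_nonneg_left hr (radius_nonneg (G := G) (play := play) (t + 1) g)
      linarith
    · have h1 := radius_le hT i.pos hG ht he hc
      have h2 := mul_le_mul_of_nonneg_left hr (radius_nonneg (G := G) (play := play) (t + 1) g)
      linarith
    · linarith
    · linarith
  · have hv : visits play t g = 0 := by
      by_contra h
      have := visits_pos.1 (Nat.pos_of_ne_zero h)
      exact he (expandedNodes_mono (Nat.le_succ t) (mem_expandedNodes.2 ⟨hg, this⟩))
    simp only [he, if_false, hv, if_true]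
    refine hr.trans (le_add_of_nonneg_left ?_)
    split_ifs <;> positivity

theorem upper_sub_lower_nonneg (t : ℕ) (i : Fin n) {g : List A} (hg : g ∈ G.tree) :
    0 ≤ (confGame G b play t).upper i g - (confGame G b play t).lower i g := by
  have hr := (b.pathBounds i).le hg
  simp only [confGame, slack]
  split_ifs
  · have := mul_nonneg (radius_nonneg (G := G) (play := play) t g) (sub_nonneg.2 hr)
    linarith
  · linarith
  · linarith

variable {σ : Fin n → I → A → ℝ}

theorem upperVal_sub_lowerVal (hplay : ∀ r, play r ∈ G.terminals)
    (hσ : ∀ j, σ j ∈ G.Strategy j) (t : ℕ) (i : Fin n) :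
    (confGame G b play t).upperVal G i σ - (confGame G b play t).lowerVal G i σ
      = ∑ g ∈ (confGame G b play t).nodes G, G.reach (empirical play t) σ g *
        ((confGame G b play t).upper i g - (confGame G b play t).lower i g) := by
  have hP := confGame_proper (b := b) hplay hσ t
  rw [Pseudogame.upperVal, Pseudogame.lowerVal, hP.value_eq, hP.value_eq,
    ← Finset.sum_sub_distrib]
  exact Finset.sum_congr rfl fun g _ => (mul_sub _ _ _).symm

/-- No action of nature has been much more frequent than expected. -/
def Tempered (G : Game n A I) (play : ℕ → List A) (l x : ℝ) (t : ℕ) : Prop :=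
  ∀ h ∈ G.tree, G.IsChance h → ∀ a ∈ G.actions h,
    l * visits play t (a :: h) - visits play t h * (G.chance h a * (Real.exp l - 1)) ≤ x

/-- Divide the tempering inequality by `l` times the visit count and use `exp l - 1 ≤ l * (1 + l)`
for `l ≤ 1`. The error is multiplicative plus `1 / visits`; an additive `1 / √visits` error
multiplied by the size of the game would spoil the rate. -/
theorem Tempered.empirical_le {l x : ℝ} {t : ℕ} (hl0 : 0 < l) (hl1 : l ≤ 1) (hx : 0 ≤ x)
    (hG : Tempered G play l x (t + 1)) {h : List A} (hh : h ∈ expandedNodes G play (t + 1))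
    (hc : G.IsChance h) {a : A} (ha : a ∈ G.actions h) :
    empirical play (t + 1) h a
      ≤ (1 + l) * G.chance h a + x / l * (1 / ((max 1 (visits play t h) : ℕ) : ℝ)) := by
  have hp : 0 ≤ G.chance h a := G.chance_nonneg h hc.1 hc.2.2 a ha
  have hv : ((max 1 (visits play t h) : ℕ) : ℝ) ≤ visits play (t + 1) h := by
    have h1 := visits_pos_of_expanded hh
    have h2 := visits_mono (play := play) (Nat.le_succ t) h
    exact_mod_cast max_le h1 h2
  have hv0 : (0 : ℝ) < (max 1 (visits play t h) : ℕ) := by positivity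
  have hv1 : (0 : ℝ) < visits play (t + 1) h := hv0.trans_le hv
  have hexp : Real.exp l - 1 ≤ l * (1 + l) := by
    have := (abs_le.1 (Real.abs_exp_sub_one_sub_id_le
      (by rw [abs_of_pos hl0]; exact hl1 : |l| ≤ 1))).2
    nlinarith
  have h1 := hG h hc.1 hc a ha
  have h2 : (visits play (t + 1) h : ℝ) * (G.chance h a * (Real.exp l - 1))
      ≤ visits play (t + 1) h * (G.chance h a * (l * (1 + l))) := by gcongr
  have h3 : empirical play (t + 1) h a
      ≤ (1 + l) * G.chance h a + x / l * (1 / (visits play (t + 1) h : ℝ)) := by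
    rw [empirical, div_le_iff₀ hv1]
    have : ((1 + l) * G.chance h a + x / l * (1 / (visits play (t + 1) h : ℝ)))
        * visits play (t + 1) h
        = (visits play (t + 1) h * (G.chance h a * (l * (1 + l))) + x) / l := by
      field_simp
    rw [this, le_div_iff₀ hl0]
    linarith
  refine h3.trans (add_le_add_right ?_ _)
  exact mul_le_mul_of_nonneg_left (one_div_le_one_div_of_le hv0 hv) (by positivity)

/-- The reach under empirical frequencies is at most a bit more than the true reach. -/
theorem Tempered.reach_le {l x : ℝ} {t : ℕ} (hl0 : 0 < l) (hl1 : l ≤ 1) (hx : 0 ≤ x)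
    (hG : Tempered G play l x (t + 1)) (hplay : ∀ r, play r ∈ G.terminals)
    (hσ : ∀ j, σ j ∈ G.Strategy j) {f : List A → ℝ}
    (hf : ∀ h, f h = G.reach G.chance σ h * (x / l * (1 / ((max 1 (visits play t h) : ℕ) : ℝ))))
    (g : List A) (hg : g ∈ (confGame G b play (t + 1)).nodes G) :
    G.reach (empirical play (t + 1)) σ g
      ≤ (1 + l) ^ g.length * (G.reach G.chance σ g + (G.along f [] g - f g)) := by
  have hf0 : ∀ h ∈ G.tree, 0 ≤ f h := fun h hh => by
    rw [hf]
    exact mul_nonneg (reach_nonneg hσ hh) (by positivity)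
  induction g with
  | nil => simp [Game.reach, G.along_self f G.root_mem]
  | cons a h ih =>
    obtain ⟨ha, hh⟩ := Pseudogame.cons_mem_nodes.1 hg
    have hP := confGame_proper (b := b) hplay hσ (t + 1)
    have hhn := hP.expanded_subset hh
    have hht : h ∈ G.tree := Pseudogame.nodes_subset hhn
    have hr := reach_nonneg hσ hht
    have hE : 0 ≤ G.along f [] h - f h := by
      cases h with
      | nil => simp [G.along_self f G.root_mem]
      | cons c h =>
        rw [G.along_cons_right f hht List.nil_suffix, add_sub_cancel_left]
        exact Finset.sum_nonneg fun g hg => hf0 g (Finset.mem_filter.1 hg).1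
    rw [G.along_cons_right f (G.mem_actions.1 ha) List.nil_suffix, add_sub_cancel_left,
      G.reach_cons, G.reach_cons, List.length_cons, pow_succ]
    have hs0 : 0 ≤ G.step (empirical play (t + 1)) σ h a := hP.nonneg h hh a ha
    have hs1 : G.step (empirical play (t + 1)) σ h a ≤ 1 := hP.step_le_one hh ha
    -- A step of nature costs one factor `1 + l` and the additive term `f h`; a step of a player
    -- costs nothing. Errors inherited from ancestors are only multiplied by a probability, so they
    -- accumulate additively along the path.
    have hstep : G.reach G.chance σ h * G.step (empirical play (t + 1)) σ h a
        ≤ (1 + l) * (G.reach G.chance σ h * G.step G.chance σ h a) + f h := by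
      rcases hp : G.player h with _ | j
      · rw [G.step_of_chance _ _ a hp, G.step_of_chance _ _ a hp, hf]
        have := mul_le_mul_of_nonneg_left
          (hG.empirical_le hl0 hl1 hx hh ⟨hht, ⟨a, ha⟩, hp⟩ ha) hr
        linarith
      · rw [G.step_of_player _ _ a hp] at hs0
        rw [G.step_of_player _ _ a hp, G.step_of_player _ _ a hp]
        have := mul_nonneg hl0.le (mul_nonneg hr hs0)
        linarith [hf0 h hht]
    have hpow : (0 : ℝ) ≤ (1 + l) ^ h.length := by positivity
    calc G.reach (empirical play (t + 1)) σ h * G.step (empirical play (t + 1)) σ h a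
        ≤ (1 + l) ^ h.length * (G.reach G.chance σ h + (G.along f [] h - f h)) *
            G.step (empirical play (t + 1)) σ h a := mul_le_mul_of_nonneg_right (ih hhn) hs0
      _ = (1 + l) ^ h.length * (G.reach G.chance σ h * G.step (empirical play (t + 1)) σ h a +
            (G.along f [] h - f h) * G.step (empirical play (t + 1)) σ h a) := by ring
      _ ≤ (1 + l) ^ h.length * ((1 + l) * (G.reach G.chance σ h * G.step G.chance σ h a) + f h +
            (G.along f [] h - f h)) :=
          mul_le_mul_of_nonneg_left (add_le_add hstep (mul_le_of_le_one_right hE hs1)) hpow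
      _ ≤ (1 + l) ^ h.length * (1 + l) *
            (G.reach G.chance σ h * G.step G.chance σ h a + G.along f [] h) := by
          rw [mul_assoc]
          refine mul_le_mul_of_nonneg_left ?_ hpow
          have : 0 ≤ l * G.along f [] h := by
            have := hf0 h hht
            exact mul_nonneg hl0.le (by linarith)
          linarith

end Bound

/-! ### The width of the confidence sequence in one round -/

section Bound

variable {n : ℕ} {A : Type u} {I : Type v} {G : Game n A I} {b : Bounds G} {play : ℕ → List A}
  {σ : Fin n → I → A → ℝ}

/-- The contribution to the expected width of a visit to `g` after `v` earlier visits. -/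
def visitWidth (G : Game n A I) (T : ℕ) (g : List A) (v : ℕ) : ℝ :=
  3 * nodeWidth G T g v + 30 * (G.tree.card : ℝ) ^ 2 * (G.depth + 1) * Real.log T ^ 2 *
    (1 / ((max 1 v : ℕ) : ℝ))

theorem visitWidth_nonneg (T : ℕ) (g : List A) (v : ℕ) : 0 ≤ visitWidth G T g v := by
  have := nodeWidth_nonneg (G := G) T g v
  unfold visitWidth
  positivity

/-- With `l = 1 / (depth + 1)` the multiplicative errors along a path stay below 3. The additive
errors of all ancestors, bounded by a sum over the whole tree, multiply a crude bound on the local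
width and are then charged to the nodes that cause them. -/
theorem conf_width_le_of_tempered {T t : ℕ} (hT : 1 ≤ Real.log T) (hG : G.tree.card * n ≤ T)
    (ht : t < T) (i : Fin n) (hplay : ∀ r, play r ∈ G.terminals) (hσ : ∀ j, σ j ∈ G.Strategy j)
    (htemp : Tempered G play (1 / (G.depth + 1)) (2 * Real.log T) (t + 1)) :
    (confGame G b play (t + 1)).upperVal G i σ - (confGame G b play (t + 1)).lowerVal G i σ
      ≤ ∑ g ∈ G.tree, G.reach G.chance σ g * visitWidth G T g (visits play t g) := by
  set D : ℝ := (G.depth : ℝ) + 1 with hD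
  have hD1 : 1 ≤ D := by rw [hD]; linarith [(Nat.cast_nonneg G.depth : (0 : ℝ) ≤ G.depth)]
  have hD0 : 0 < D := by linarith
  set f : List A → ℝ := fun h => G.reach G.chance σ h *
    (2 * Real.log T / (1 / D) * (1 / ((max 1 (visits play t h) : ℕ) : ℝ))) with hf
  have hf0 : ∀ h ∈ G.tree, 0 ≤ f h := fun h hh =>
    mul_nonneg (reach_nonneg hσ hh) (by positivity)
  set F := ∑ h ∈ G.tree, f h with hF
  have hF0 : 0 ≤ F := Finset.sum_nonneg hf0
  have hP := confGame_proper (b := b) hplay hσ (t + 1)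
  -- The length of a path is at most `D`, so the power is at most `exp 1`.
  have hpow : ∀ g ∈ G.tree, (1 + 1 / D) ^ g.length ≤ 3 := by
    intro g hg
    have h1 : (g.length : ℝ) ≤ D := by
      have : (g.length : ℝ) ≤ G.depth := by exact_mod_cast G.length_le_depth hg
      linarith
    calc (1 + 1 / D) ^ g.length ≤ Real.exp (1 / D) ^ g.length := by
          gcongr
          rw [add_comm]
          exact Real.add_one_le_exp _
      _ = Real.exp (g.length * (1 / D)) := (Real.exp_nat_mul _ _).symm
      _ ≤ Real.exp 1 := by
          refine Real.exp_le_exp.2 ?_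
          rw [mul_one_div, div_le_one hD0]
          exact h1
      _ ≤ 3 := Real.exp_one_lt_three.le
  have hreach : ∀ g ∈ (confGame G b play (t + 1)).nodes G,
      G.reach (empirical play (t + 1)) σ g ≤ 3 * (G.reach G.chance σ g + F) := by
    intro g hg
    have hgt := Pseudogame.nodes_subset hg
    refine (htemp.reach_le (b := b) (by positivity) ((div_le_one hD0).2 hD1) (by linarith) hplay hσ
      (f := f) (fun h => rfl) g hg).trans ?_
    have h1 : G.along f [] g ≤ F :=
      Finset.sum_le_sum_of_subset_of_nonneg (Finset.filter_subset _ _) fun h hh _ => hf0 h hh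
    have h2 := reach_nonneg hσ hgt
    have h3 : G.reach G.chance σ g + (G.along f [] g - f g) ≤ G.reach G.chance σ g + F := by
      linarith [hf0 g hgt]
    calc (1 + 1 / D) ^ g.length * (G.reach G.chance σ g + (G.along f [] g - f g))
        ≤ (1 + 1 / D) ^ g.length * (G.reach G.chance σ g + F) :=
          mul_le_mul_of_nonneg_left h3 (by positivity)
      _ ≤ 3 * (G.reach G.chance σ g + F) :=
          mul_le_mul_of_nonneg_right (hpow g hgt) (by linarith)
  rw [upperVal_sub_lowerVal hplay hσ]
  -- Charging `3 * F * C` at each of at most `|tree|` nodes, with `F` a sum of terms `2 * log T * D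
  -- / max 1 visits` weighted by reach, produces the coefficient 30 in `visitWidth`.
  set C := 5 * (G.tree.card : ℝ) * Real.log T with hC
  calc ∑ g ∈ (confGame G b play (t + 1)).nodes G, G.reach (empirical play (t + 1)) σ g *
        ((confGame G b play (t + 1)).upper i g - (confGame G b play (t + 1)).lower i g)
      ≤ ∑ g ∈ (confGame G b play (t + 1)).nodes G,
        (3 * (G.reach G.chance σ g * nodeWidth G T g (visits play t g)) + 3 * (F * C)) := by
        refine Finset.sum_le_sum fun g hg => ?_
        have hgt := Pseudogame.nodes_subset hg
        have h1 := upper_sub_lower_le (b := b) (play := play) hT hG ht i hgt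
        have h2 := upper_sub_lower_nonneg (b := b) (play := play) (t + 1) i hgt
        have h3 := reach_nonneg hσ hgt
        calc _ ≤ 3 * (G.reach G.chance σ g + F) * nodeWidth G T g (visits play t g) :=
              mul_le_mul (hreach g hg) h1 h2 (by linarith)
          _ = 3 * (G.reach G.chance σ g * nodeWidth G T g (visits play t g))
              + 3 * (F * nodeWidth G T g (visits play t g)) := by ring
          _ ≤ _ := by
              have := mul_le_mul_of_nonneg_left (nodeWidth_le (G := G) hT g (visits play t g)) hF0
              linarith
    _ ≤ ∑ g ∈ G.tree,
        (3 * (G.reach G.chance σ g * nodeWidth G T g (visits play t g)) + 3 * (F * C)) := by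
        refine Finset.sum_le_sum_of_subset_of_nonneg Pseudogame.nodes_subset fun g hg _ => ?_
        have h1 := mul_nonneg (reach_nonneg hσ hg) (nodeWidth_nonneg (G := G) T g (visits play t g))
        have h2 : 0 ≤ C := by positivity
        have h3 := mul_nonneg hF0 h2
        linarith
    _ = _ := by
        rw [Finset.sum_add_distrib, Finset.sum_const, nsmul_eq_mul, hF]
        have : (G.tree.card : ℝ) * (3 * ((∑ h ∈ G.tree, f h) * C))
            = ∑ h ∈ G.tree, G.tree.card * 3 * C * f h := by
          rw [← Finset.mul_sum]; ring
        rw [this, ← Finset.sum_add_distrib]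
        refine Finset.sum_congr rfl fun g _ => ?_
        simp only [hf, hC, visitWidth, hD]
        field_simp
        ring

/-- A deterministic bound for the rare rounds in which the frequencies are not tempered. Its factor
`|tree| ^ 2` does no harm there. -/
theorem conf_width_le {T t : ℕ} (hT : 1 ≤ Real.log T) (hG : G.tree.card * n ≤ T)
    (ht : t < T) (i : Fin n) (hplay : ∀ r, play r ∈ G.terminals) (hσ : ∀ j, σ j ∈ G.Strategy j) :
    (confGame G b play (t + 1)).upperVal G i σ - (confGame G b play (t + 1)).lowerVal G i σ
      ≤ 5 * (G.tree.card : ℝ) ^ 2 * Real.log T := by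
  have hP := confGame_proper (b := b) hplay hσ (t + 1)
  rw [upperVal_sub_lowerVal hplay hσ]
  calc ∑ g ∈ (confGame G b play (t + 1)).nodes G, G.reach (empirical play (t + 1)) σ g *
        ((confGame G b play (t + 1)).upper i g - (confGame G b play (t + 1)).lower i g)
      ≤ ∑ g ∈ (confGame G b play (t + 1)).nodes G, 1 * (5 * G.tree.card * Real.log T) := by
        refine Finset.sum_le_sum fun g hg => ?_
        have hgt := Pseudogame.nodes_subset hg
        exact mul_le_mul (hP.reach_le_one hg)
          ((upper_sub_lower_le hT hG ht i hgt).trans (nodeWidth_le hT g _))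
          (upper_sub_lower_nonneg (t + 1) i hgt) zero_le_one
    _ = ((confGame G b play (t + 1)).nodes G).card * (5 * G.tree.card * Real.log T) := by
        rw [Finset.sum_const, nsmul_eq_mul, one_mul]
    _ ≤ G.tree.card * (5 * G.tree.card * Real.log T) := by
        gcongr
        exact Pseudogame.nodes_subset
    _ = _ := by ring

theorem sum_visitWidth_le {T : ℕ} (hT : 1 ≤ Real.log T) :
    ∑ g ∈ G.tree, ∑ m ∈ Finset.range (visits play T g), visitWidth G T g m
      ≤ 39 * Real.sqrt T * Real.log T * numNodes G b play T
        + 120 * (G.tree.card : ℝ) ^ 3 * (G.depth + 1) * Real.log T ^ 3 := by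
  simp only [visitWidth, Finset.sum_add_distrib, ← Finset.mul_sum]
  refine add_le_add ?_ ?_
  · have := sum_tree_nodeWidth_le (b := b) (play := play) hT
    linarith
  · calc 30 * (G.tree.card : ℝ) ^ 2 * (G.depth + 1) * Real.log T ^ 2 *
          ∑ g ∈ G.tree, ∑ m ∈ Finset.range (visits play T g), 1 / ((max 1 m : ℕ) : ℝ)
        ≤ 30 * (G.tree.card : ℝ) ^ 2 * (G.depth + 1) * Real.log T ^ 2 *
          ∑ g ∈ G.tree, 4 * Real.log T := by
          gcongr with g hg
          exact sum_inv_le (visits_le T g) hT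
      _ = _ := by
          rw [Finset.sum_const, nsmul_eq_mul]; ring

end Bound

/-! ### The expected total width -/

namespace Run

variable {n : ℕ} {A : Type u} {I : Type v} {G : Game n A I} {b : Bounds G}
  {Ω : Type w} [mΩ : MeasurableSpace Ω] {μ : Measure Ω} (R : Run G b μ) [IsProbabilityMeasure μ]

/-- The level `2 * log T` makes each Chernoff tail `1 / T ^ 2`, and there are at most `|tree| ^ 2`
pairs of a chance node and an action. -/
theorem measureReal_not_tempered_le {T : ℕ} (hT : 0 < T) (t : ℕ) (l : ℝ) :
    μ.real {ω | ¬ Tempered G (fun r => R.play r ω) l (2 * Real.log T) t}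
      ≤ (G.tree.card : ℝ) ^ 2 / T ^ 2 := by
  have hT0 : (0 : ℝ) < T := by exact_mod_cast hT
  have hcover : {ω | ¬ Tempered G (fun r => R.play r ω) l (2 * Real.log T) t}
      ⊆ ⋃ h ∈ G.tree.filter G.IsChance, ⋃ a ∈ G.actions h,
        {ω | 2 * Real.log T ≤ l * visits (fun r => R.play r ω) t (a :: h)
          - visits (fun r => R.play r ω) t h * (G.chance h a * (Real.exp l - 1))} := by
    intro ω hω
    simp only [Tempered, Set.mem_ofPred_eq, not_forall, not_le] at hω
    obtain ⟨h, hh, hc, a, ha, hlt⟩ := hω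
    simp only [Set.mem_iUnion]
    exact ⟨h, Finset.mem_filter.2 ⟨hh, hc⟩, a, ha, hlt.le⟩
  have hexp : Real.exp (-(2 * Real.log T)) = 1 / T ^ 2 := by
    have : 2 * Real.log T = Real.log (T ^ 2) := by rw [Real.log_pow]; norm_num
    rw [this, Real.exp_neg, Real.exp_log (by positivity), one_div]
  calc _ ≤ _ := measureReal_mono hcover (measure_ne_top _ _)
    _ ≤ ∑ h ∈ G.tree.filter G.IsChance, ∑ a ∈ G.actions h, 1 / (T : ℝ) ^ 2 := by
        refine (measureReal_biUnion_finset_le _ _).trans (Finset.sum_le_sum fun h hh => ?_)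
        refine (measureReal_biUnion_finset_le _ _).trans (Finset.sum_le_sum fun a ha => ?_)
        rw [← hexp]
        exact R.measureReal_frequent_le (Finset.mem_filter.1 hh).2 ha t l _
    _ ≤ ∑ h ∈ G.tree, (G.tree.card : ℝ) * (1 / (T : ℝ) ^ 2) := by
        refine (Finset.sum_le_sum_of_subset_of_nonneg (Finset.filter_subset _ _)
          fun h _ _ => Finset.sum_nonneg fun _ _ => by positivity).trans
          (Finset.sum_le_sum fun h _ => ?_)
        rw [Finset.sum_const, nsmul_eq_mul]
        gcongr
        exact card_actions_le h
    _ = _ := by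
        rw [Finset.sum_const, nsmul_eq_mul]; ring

theorem integrable_conf_value (T : ℕ) (f : Pseudogame n A → List A → ℝ)
    {τ : Ω → Fin n → I → A → ℝ} (hτ : ∀ ω j, τ ω j ∈ G.Strategy j)
    (hmeas : ∀ nat z, Measurable fun ω => G.reach nat (τ ω) z) :
    Integrable (fun ω => (R.conf T ω).value G (f (R.conf T ω)) (τ ω)) μ := by
  obtain ⟨C, hC⟩ := R.exists_bound (t := T)
    (F := fun p => ∑ z ∈ G.tree, |G.along (f (confGame G b p T)) [] z|)
    fun p p' hp => by simp only [confGame_congr b hp]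
  refine integrable_of_bounded (C := C) ?_ fun ω => ?_
  · refine measurable_of_history (t := T) R.play_mem (fun r _ z => R.measurableSet_play r z)
      (F := fun p ω => (confGame G b p T).value G (f (confGame G b p T)) (τ ω)) (fun p => ?_)
      fun p p' hp => by rw [confGame_congr b hp]
    unfold Pseudogame.value
    exact Finset.measurable_sum _ fun z _ => (hmeas _ z).mul_const _
  · refine le_trans ?_ ((le_abs_self _).trans (hC ω))
    have hP := confGame_proper (b := b) (fun r => R.play_mem r ω) (hτ ω) T
    refine (Finset.abs_sum_le_sum_abs _ _).trans ?_
    refine le_trans (Finset.sum_le_sum fun z hz => ?_)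
      (Finset.sum_le_sum_of_subset_of_nonneg
        (fun z hz => Pseudogame.nodes_subset (Pseudogame.mem_leaves.1 hz).1)
        fun _ _ _ => abs_nonneg _)
    have hz' := (Pseudogame.mem_leaves.1 hz).1
    rw [abs_mul]
    refine mul_le_of_le_one_left (abs_nonneg _) ?_
    exact abs_le.2 ⟨le_trans (by norm_num) (hP.reach_nonneg hz'), hP.reach_le_one hz'⟩

/-- the width of the confidence sequence after round `t`, for the profile of that round -/
def selfWidth (i : Fin n) (t : ℕ) (ω : Ω) : ℝ :=
  (R.conf (t + 1) ω).upperVal G i (R.σ t ω) - (R.conf (t + 1) ω).lowerVal G i (R.σ t ω)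

theorem integrable_upperVal (T t : ℕ) (i : Fin n) :
    Integrable (fun ω => (R.conf T ω).upperVal G i (R.σ t ω)) μ :=
  R.integrable_conf_value T (fun P => P.upper i) (R.σ_mem t)
    fun nat z => (R.measurable_reach t nat z).mono (R.ℱ.le t) le_rfl

theorem integrable_lowerVal (T t : ℕ) (i : Fin n) :
    Integrable (fun ω => (R.conf T ω).lowerVal G i (R.σ t ω)) μ :=
  R.integrable_conf_value T (fun P => P.lower i) (R.σ_mem t)
    fun nat z => (R.measurable_reach t nat z).mono (R.ℱ.le t) le_rfl

theorem integrable_upperVal_update (T t : ℕ) (i : Fin n) {s : I → A → ℝ} (hs : s ∈ G.Strategy i) :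
    Integrable (fun ω => (R.conf T ω).upperVal G i (Function.update (R.σ t ω) i s)) μ :=
  R.integrable_conf_value T (fun P => P.upper i) (fun ω => update_mem (R.σ_mem t ω) hs)
    fun nat z => (R.measurable_reach_update t i s nat z).mono (R.ℱ.le t) le_rfl

theorem integrable_selfWidth (i : Fin n) (t : ℕ) : Integrable (R.selfWidth i t) μ :=
  (R.integrable_upperVal (t + 1) t i).sub (R.integrable_lowerVal (t + 1) t i)

theorem integrable_history {T : ℕ} {F : (ℕ → List A) → ℝ}
    (hdep : ∀ p p' : ℕ → List A, (∀ r < T, p r = p' r) → F p = F p') :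
    Integrable (fun ω => F fun r => R.play r ω) μ := by
  obtain ⟨C, hC⟩ := R.exists_bound hdep
  exact integrable_of_bounded (C := C) ((R.measurable_history (F := fun p _ => F p)
    (fun p => measurable_const) fun p p' h => funext fun _ => hdep p p' h).mono
    (R.ℱ.le T) le_rfl) hC

theorem integrable_N (T : ℕ) : Integrable (R.N T) μ :=
  R.integrable_history (T := T) (F := fun p => (numNodes G b p T : ℝ))
    fun p p' hp => by rw [numNodes_congr b hp]

theorem one_le_integral_N (T : ℕ) : 1 ≤ ∫ ω, R.N T ω ∂μ := by
  have := integral_mono (μ := μ) (integrable_const (1 : ℝ)) (R.integrable_N T) fun ω => by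
    change (1 : ℝ) ≤ (numNodes G b (fun r => R.play r ω) T : ℝ)
    exact_mod_cast one_le_numNodes T
  simpa using this

/-- The expected widths of the confidence sequence are small on average. -/
theorem sum_integral_selfWidth_le {T : ℕ} (hT : 1 ≤ Real.log T) (hG : G.tree.card * n ≤ T)
    (hbig : (120 * (G.tree.card : ℝ) ^ 3 * (G.depth + 1) + 5 * (G.tree.card : ℝ) ^ 4) *
      Real.log T ^ 3 ≤ Real.sqrt T) (i : Fin n) :
    ∑ t ∈ Finset.range T, ∫ ω, R.selfWidth i t ω ∂μ
      ≤ 40 * Real.sqrt T * Real.log T * ∫ ω, R.N T ω ∂μ := by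
  have hT1 : 0 < T := by
    rcases Nat.eq_zero_or_pos T with rfl | h
    · norm_num at hT
    · exact h
  have hT0 : (0 : ℝ) < T := by exact_mod_cast hT1
  set l : ℝ := 1 / (G.depth + 1) with hl
  set C : ℝ := 5 * (G.tree.card : ℝ) ^ 2 * Real.log T with hC
  have hC0 : 0 ≤ C := by positivity
  -- The cost of a visit depends only on playthroughs before round `t`, so it is known when the
  -- profile of that round is chosen.
  set k : ℕ → List A → (ℕ → List A) → ℝ := fun t g p => visitWidth G T g (visits p t g) with hk
  have hkdep : ∀ t g (p p' : ℕ → List A), (∀ r < t, p r = p' r) → k t g p = k t g p' := by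
    intro t g p p' hp
    simp only [hk, visits_congr hp]
  have hkint : ∀ t g, Integrable (fun ω => k t g fun r => R.play r ω) μ :=
    fun t g => R.integrable_history (hkdep t g)
  set bad : ℕ → Set Ω := fun t =>
    {ω | ¬ Tempered G (fun r => R.play r ω) l (2 * Real.log T) (t + 1)} with hbad
  have hbadm : ∀ t, MeasurableSet (bad t) := by
    intro t
    have h1 : Measurable fun ω => if Tempered G (fun r => R.play r ω) l (2 * Real.log T) (t + 1)
        then (0 : ℝ) else 1 :=
      (R.measurable_history (t := t + 1) (F := fun p _ => if Tempered G p l (2 * Real.log T) (t + 1)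
        then (0 : ℝ) else 1) (fun p => measurable_const)
        fun p p' h => by
          have : Tempered G p l (2 * Real.log T) (t + 1) = Tempered G p' l (2 * Real.log T) (t + 1) :=
            by simp only [Tempered, visits_congr h]
          simp only [this]).mono (R.ℱ.le _) le_rfl
    have h2 : bad t = (fun ω => if Tempered G (fun r => R.play r ω) l (2 * Real.log T) (t + 1)
        then (0 : ℝ) else 1) ⁻¹' {1} := by
      ext ω
      simp only [hbad, Set.mem_ofPred_eq, Set.mem_preimage, Set.mem_singleton_iff]
      split_ifs with h <;> simp [h]
    rw [h2]
    exact h1 (measurableSet_singleton 1)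
  have hterm : ∀ g ∈ G.tree, ∀ t, Integrable (fun ω => G.reach G.chance (R.σ t ω) g *
      k t g fun r => R.play r ω) μ := fun g hg t =>
    (hkint t g).bdd_mul (c := 1)
      ((R.measurable_reach t G.chance g).mono (R.ℱ.le t) le_rfl).aestronglyMeasurable
      (Filter.Eventually.of_forall fun ω => abs_le.2
        ⟨by linarith [reach_nonneg (R.σ_mem t ω) hg], reach_le_one (R.σ_mem t ω) hg⟩)
  -- On the good event the width is a reach-weighted sum of visit costs; on the bad event the crude
  -- bound applies.
  have hround : ∀ t ∈ Finset.range T, ∫ ω, R.selfWidth i t ω ∂μ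
      ≤ ∑ g ∈ G.tree, (∫ ω, (if g <:+ R.play t ω then k t g (fun r => R.play r ω) else 0) ∂μ)
        + C * ((G.tree.card : ℝ) ^ 2 / T ^ 2) := by
    intro t ht
    have htT := Finset.mem_range.1 ht
    have h1 : ∀ ω, R.selfWidth i t ω ≤ ∑ g ∈ G.tree, G.reach G.chance (R.σ t ω) g *
        k t g (fun r => R.play r ω) + C * (bad t).indicator 1 ω := by
      intro ω
      have h2 : 0 ≤ ∑ g ∈ G.tree, G.reach G.chance (R.σ t ω) g *
          k t g (fun r => R.play r ω) := Finset.sum_nonneg fun g hg =>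
        mul_nonneg (reach_nonneg (R.σ_mem t ω) hg) (visitWidth_nonneg _ _ _)
      by_cases hb : ω ∈ bad t
      · rw [Set.indicator_of_mem hb, Pi.one_apply, mul_one]
        have := conf_width_le (b := b) hT hG htT i (fun r => R.play_mem r ω) (R.σ_mem t ω)
        exact this.trans (by linarith)
      · rw [Set.indicator_of_notMem hb, mul_zero, add_zero]
        exact conf_width_le_of_tempered hT hG htT i (fun r => R.play_mem r ω) (R.σ_mem t ω)
          (not_not.1 hb)
    have hind : Integrable ((bad t).indicator (1 : Ω → ℝ)) μ :=
      (integrable_const (1 : ℝ)).indicator (hbadm t)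
    refine (integral_mono (R.integrable_selfWidth i t)
      ((integrable_finsetSum _ fun g hg => hterm g hg t).add (hind.const_mul C)) h1).trans ?_
    rw [integral_add' (integrable_finsetSum _ fun g hg => hterm g hg t) (hind.const_mul C),
      integral_const_mul, integral_indicator_one (hbadm t),
      integral_finsetSum _ fun g hg => hterm g hg t]
    refine add_le_add (Finset.sum_le_sum fun g hg => ?_)
      (mul_le_mul_of_nonneg_left (R.measureReal_not_tempered_le hT1 (t + 1) l) hC0)
    obtain ⟨K, hK⟩ := R.exists_bound (hkdep t g)
    -- Expected reach times a known cost is the expected cost of an actual visit. Summed over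
    -- rounds, this is the cost of the visits that occurred, bounded on every sample path.
    exact (R.integral_reach t hg (R.measurable_history (F := fun p _ => k t g p)
      (fun p => measurable_const) fun p p' h => funext fun _ => hkdep t g p p' h) hK).le
  have hvis : ∀ g t, Integrable (fun ω =>
      if g <:+ R.play t ω then k t g (fun r => R.play r ω) else 0) μ := fun g t =>
    R.integrable_history (T := t + 1) (F := fun p => if g <:+ p t then k t g p else 0)
      fun p p' hp => by
        rw [hkdep t g p p' fun r hr => hp r (by omega), hp t (by omega)]
  have hsum : ∑ t ∈ Finset.range T, ∑ g ∈ G.tree,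
      (∫ ω, (if g <:+ R.play t ω then k t g (fun r => R.play r ω) else 0) ∂μ)
      ≤ 39 * Real.sqrt T * Real.log T * ∫ ω, R.N T ω ∂μ
        + 120 * (G.tree.card : ℝ) ^ 3 * (G.depth + 1) * Real.log T ^ 3 := by
    have h1 : ∑ t ∈ Finset.range T, ∑ g ∈ G.tree,
        (∫ ω, (if g <:+ R.play t ω then k t g (fun r => R.play r ω) else 0) ∂μ)
        = ∫ ω, ∑ t ∈ Finset.range T, ∑ g ∈ G.tree,
          (if g <:+ R.play t ω then k t g (fun r => R.play r ω) else 0) ∂μ := by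
      rw [integral_finsetSum _ fun t _ => integrable_finsetSum _ fun g _ => hvis g t]
      refine Finset.sum_congr rfl fun t _ => ?_
      rw [integral_finsetSum _ fun g _ => hvis g t]
    rw [h1]
    refine (integral_mono (integrable_finsetSum _ fun t _ => integrable_finsetSum _
      fun g _ => hvis g t) (((R.integrable_N T).const_mul (39 * Real.sqrt T * Real.log T)).add
      (integrable_const (120 * (G.tree.card : ℝ) ^ 3 * (G.depth + 1) * Real.log T ^ 3)))
      fun ω => ?_).trans (le_of_eq ?_)
    · have h2 := sum_visitWidth_le (b := b) (play := fun r => R.play r ω) hT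
      refine le_trans (le_of_eq ?_) h2
      rw [Finset.sum_comm]
      refine Finset.sum_congr rfl fun g _ => ?_
      exact sum_visited (fun r => R.play r ω) g (visitWidth G T g) T
    · rw [integral_add' ((R.integrable_N T).const_mul _) (integrable_const _), integral_const_mul]
      simp
  -- The bad events contribute `C * |tree| ^ 2 / T ^ 2` in each of `T` rounds. Together with the `1
  -- / visits` errors this is at most `√T` by `hbig`, which turns the constant 39 into 40.
  have hlow : (T : ℝ) * (C * ((G.tree.card : ℝ) ^ 2 / T ^ 2))
      ≤ 5 * (G.tree.card : ℝ) ^ 4 * Real.log T ^ 3 := by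
    have hT2 : (1 : ℝ) ≤ T := by exact_mod_cast hT1
    have h1 : (T : ℝ) * (C * ((G.tree.card : ℝ) ^ 2 / T ^ 2))
        = 5 * (G.tree.card : ℝ) ^ 4 * Real.log T / T := by
      rw [hC]; field_simp
    rw [h1]
    refine (div_le_self (by positivity) hT2).trans ?_
    refine mul_le_mul_of_nonneg_left ?_ (by positivity)
    nlinarith [one_le_pow₀ hT (n := 2)]
  have hN := R.one_le_integral_N (μ := μ) T
  have hend : Real.sqrt T ≤ Real.sqrt T * Real.log T * ∫ ω, R.N T ω ∂μ := by
    rw [mul_assoc]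
    exact le_mul_of_one_le_right (Real.sqrt_nonneg _) (one_le_mul_of_one_le_of_one_le hT hN)
  refine (Finset.sum_le_sum hround).trans ?_
  rw [Finset.sum_add_distrib, Finset.sum_const, Finset.card_range, nsmul_eq_mul]
  linarith

end Run

theorem integrable_sup' {Ω : Type w} [MeasurableSpace Ω] {μ : Measure Ω} {ι : Type*}
    {J : Finset ι} (hJ : J.Nonempty) {f : ι → Ω → ℝ} (hf : ∀ j ∈ J, Integrable (f j) μ) :
    Integrable (fun ω => J.sup' hJ fun j => f j ω) μ := by
  have h1 : Integrable (J.sup' hJ f) μ :=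
    Finset.sup'_induction (p := fun g : Ω → ℝ => Integrable g μ) hJ f (fun _ h₁ _ h₂ => Integrable.sup h₁ h₂) hf
  have h2 : J.sup' hJ f = fun ω => J.sup' hJ fun j => f j ω :=
    funext fun ω => Finset.sup'_apply hJ f ω
  rwa [h2] at h1

/-! ### The expected certified gap -/

namespace Run

variable {n : ℕ} {A : Type u} {I : Type v} {G : Game n A I} {b : Bounds G}
  {Ω : Type w} [mΩ : MeasurableSpace Ω] {μ : Measure Ω} (R : Run G b μ)

theorem isLinear_regret (i : Fin n) (T : ℕ) (ω : Ω) :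
    G.IsLinear i fun s => ∑ t ∈ Finset.range T,
      (-linVal G i (R.est t ω i) (R.σ t ω i) - -linVal G i (R.est t ω i) s) := by
  refine Game.IsLinear.sum fun t _ => (Game.isLinear_const _).sub ?_
  simpa using (Game.isLinear_linVal (i := i) (R.est t ω i)).const_mul (-1)

theorem playerRegret_eq (i : Fin n) (T : ℕ) (ω : Ω) : R.playerRegret i T ω
    = (G.choices i).sup' (G.choices_nonempty i) fun π => ∑ t ∈ Finset.range T,
      (-linVal G i (R.est t ω i) (R.σ t ω i) - -linVal G i (R.est t ω i) (G.pure π)) :=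
  (R.isLinear_regret i T ω).sSup_eq

/-- the estimated width for the profile that is played -/
def estSelfWidth (i : Fin n) (t : ℕ) (ω : Ω) : ℝ := R.estWidth i (R.σ t ω i) t ω

/-- The estimated gap in terms of the regret. -/
theorem epsTilde_le (c : ℝ) (i : Fin n) (T : ℕ) (ω : Ω) : R.epsTilde c i T ω
    ≤ (1 / (T : ℝ)) * (R.playerRegret i T ω + ∑ t ∈ Finset.range T, R.estSelfWidth i t ω)
      + c * R.M T ω i * Real.sqrt (Real.log T / T) := by
  refine add_le_add_left ((R.isLinear_estimate i T ω).sSup_le fun π hπ => ?_) _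
  refine mul_le_mul_of_nonneg_left ?_ (by positivity)
  have h1 := (R.isLinear_regret i T ω).le_sSup (G.pure_mem hπ)
  have h2 : ∑ t ∈ Finset.range T, (linVal G i (R.est t ω i) (G.pure π) - R.estLow t ω i)
      = ∑ t ∈ Finset.range T,
        (-linVal G i (R.est t ω i) (R.σ t ω i) - -linVal G i (R.est t ω i) (G.pure π))
        + ∑ t ∈ Finset.range T, R.estSelfWidth i t ω := by
    rw [← Finset.sum_add_distrib]
    refine Finset.sum_congr rfl fun t _ => ?_
    rw [estSelfWidth, estWidth]
    ring
  rw [h2]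
  exact add_le_add_left h1 _

theorem measurable_weight (i : Fin n) (t : ℕ) (π : ∀ l ∈ G.infosets i, A) :
    Measurable[R.ℱ t] fun ω => G.weight (R.σ t ω i) π :=
  Finset.measurable_prod _ fun l _ => R.σ_meas t i l.1 (π l.1 l.2)

theorem abs_weight_le (i : Fin n) (t : ℕ) {π : ∀ l ∈ G.infosets i, A} (hπ : π ∈ G.choices i)
    (ω : Ω) : |G.weight (R.σ t ω i) π| ≤ 1 :=
  abs_le.2 ⟨le_trans (by norm_num) (G.weight_nonneg (R.σ_mem t ω i) hπ),
    G.weight_le_one (R.σ_mem t ω i) hπ⟩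

theorem integrable_weight_mul (i : Fin n) (t : ℕ) {π : ∀ l ∈ G.infosets i, A}
    (hπ : π ∈ G.choices i) {X : Ω → ℝ} (hX : Integrable X μ) :
    Integrable (fun ω => G.weight (R.σ t ω i) π * X ω) μ :=
  hX.bdd_mul (c := 1) ((R.measurable_weight i t π).mono (R.ℱ.le t) le_rfl).aestronglyMeasurable
    (Filter.Eventually.of_forall (R.abs_weight_le i t hπ))

theorem linVal_self_eq (i : Fin n) (t : ℕ) (ω : Ω) : linVal G i (R.est t ω i) (R.σ t ω i)
    = ∑ π ∈ G.choices i, G.weight (R.σ t ω i) π * linVal G i (R.est t ω i) (G.pure π) :=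
  Game.isLinear_linVal (R.est t ω i) _ (R.σ_mem t ω i)

theorem integrable_linVal_self (i : Fin n) (t : ℕ) :
    Integrable (fun ω => linVal G i (R.est t ω i) (R.σ t ω i)) μ := by
  simp only [R.linVal_self_eq]
  exact integrable_finsetSum _ fun π hπ =>
    R.integrable_weight_mul i t hπ (R.est_int t i _ (G.pure_mem hπ))

theorem integrable_estSelfWidth (i : Fin n) (t : ℕ) : Integrable (R.estSelfWidth i t) μ :=
  (R.integrable_linVal_self i t).sub (R.estLow_int t i)

theorem integrable_playerRegret (i : Fin n) (T : ℕ) : Integrable (R.playerRegret i T) μ := by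
  rw [funext (R.playerRegret_eq i T)]
  exact integrable_sup' _ fun π hπ => integrable_finsetSum _ fun t _ =>
    (R.integrable_linVal_self i t).neg.sub (R.est_int t i _ (G.pure_mem hπ)).neg

theorem integrable_epsTilde (c : ℝ) (i : Fin n) (T : ℕ)
    (hM : Integrable (fun ω => R.M T ω i) μ) : Integrable (R.epsTilde c i T) μ := by
  have h1 : R.epsTilde c i T = fun ω => ((G.choices i).sup' (G.choices_nonempty i) fun π =>
      (1 / (T : ℝ)) * ∑ t ∈ Finset.range T,
        (linVal G i (R.est t ω i) (G.pure π) - R.estLow t ω i))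
      + c * R.M T ω i * Real.sqrt (Real.log T / T) := by
    ext ω
    rw [epsTilde, (R.isLinear_estimate i T ω).sSup_eq]
  rw [h1]
  refine Integrable.add (integrable_sup' _ fun π hπ => ?_) ((hM.const_mul c).mul_const _)
  exact (integrable_finsetSum _ fun t _ =>
    R.integrable_estWidth i (G.pure_mem hπ) t).const_mul _

variable [IsProbabilityMeasure μ]

/-- Unbiasedness is assumed for fixed strategies, while the played strategy is random. Writing it as
a mixture of pure strategies, with weights known before the estimates are drawn, reduces the claim
to finitely many fixed ones. -/
theorem integral_estSelfWidth (i : Fin n) (t : ℕ) :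
    ∫ ω, R.estSelfWidth i t ω ∂μ = ∫ ω, R.selfWidth i t ω ∂μ := by
  have h1 : ∫ ω, linVal G i (R.est t ω i) (R.σ t ω i) ∂μ
      = ∫ ω, (R.conf (t + 1) ω).upperVal G i (R.σ t ω) ∂μ := by
    have h2 : ∀ ω, (R.conf (t + 1) ω).upperVal G i (R.σ t ω)
        = ∑ π ∈ G.choices i, G.weight (R.σ t ω i) π *
          (R.conf (t + 1) ω).upperVal G i (Function.update (R.σ t ω) i (G.pure π)) := by
      intro ω
      have := Game.isLinear_value (R.conf (t + 1) ω) ((R.conf (t + 1) ω).upper i) (R.σ t ω) i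
        _ (R.σ_mem t ω i)
      simp only [Function.update_eq_self] at this
      exact this
    simp only [R.linVal_self_eq, h2]
    rw [integral_finsetSum _ fun π hπ =>
        R.integrable_weight_mul i t hπ (R.est_int t i _ (G.pure_mem hπ)),
      integral_finsetSum _ fun π hπ => R.integrable_weight_mul i t hπ
        (R.integrable_upperVal_update (t + 1) t i (G.pure_mem hπ))]
    refine Finset.sum_congr rfl fun π hπ => ?_
    exact integral_mul_of_condExp (R.mid_le_top t)
      ((R.measurable_weight i t π).mono (R.le_mid t) le_rfl) (R.abs_weight_le i t hπ)
      (R.est_int t i _ (G.pure_mem hπ)) (R.est_unbiased t i _ (G.pure_mem hπ))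
  have h3 : ∫ ω, R.estLow t ω i ∂μ = ∫ ω, (R.conf (t + 1) ω).lowerVal G i (R.σ t ω) ∂μ := by
    rw [← integral_condExp (R.mid_le_top t)]
    exact integral_congr_ae (R.estLow_unbiased t i)
  unfold estSelfWidth estWidth selfWidth
  rw [integral_sub (R.integrable_linVal_self i t) (R.estLow_int t i),
    integral_sub (R.integrable_upperVal (t + 1) t i) (R.integrable_lowerVal (t + 1) t i), h1, h3]

theorem integrable_eps (i : Fin n) (T : ℕ) : Integrable (R.eps i T) μ := by
  have h1 : R.eps i T = fun ω => ((G.choices i).sup' (G.choices_nonempty i) fun π =>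
      (1 / (T : ℝ)) * ∑ t ∈ Finset.range T,
        (R.conf T ω).upperVal G i (Function.update (R.σ t ω) i (G.pure π)))
      - (1 / (T : ℝ)) * ∑ t ∈ Finset.range T, (R.conf T ω).lowerVal G i (R.σ t ω) := by
    ext ω
    rw [eps, Pseudogame.gap, (isLinear_average (R.conf T ω) i (fun t => R.σ t ω) T).sSup_eq]
  rw [h1]
  refine Integrable.sub (integrable_sup' _ fun π hπ => ?_) ?_
  · exact (integrable_finsetSum _ fun t _ =>
      R.integrable_upperVal_update T t i (G.pure_mem hπ)).const_mul _
  · exact (integrable_finsetSum _ fun t _ => R.integrable_lowerVal T t i).const_mul _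

theorem integrable_M {T : ℕ} (hT : 0 < T) (i : Fin n) {C : ℝ}
    (hC : ∀ ω, R.M T ω i ≤ C * R.N T ω) : Integrable (fun ω => R.M T ω i) μ := by
  -- Measurability of `M` is only available at successor indices.
  obtain ⟨t, rfl⟩ : ∃ t, T = t + 1 := ⟨T - 1, by omega⟩
  refine Integrable.mono' ((R.integrable_N (t + 1)).const_mul C)
    ((R.M_meas t i).mono (R.mid_le_top t) le_rfl).aestronglyMeasurable
    (Filter.Eventually.of_forall fun ω => ?_)
  rw [Real.norm_eq_abs, abs_of_pos (R.M_pos _ ω i)]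
  exact hC ω

/-- The rate of convergence of the certified gap. -/
theorem integral_epsStar_le {T : ℕ} (hT : 1 ≤ Real.log T) (hG : G.tree.card * n ≤ T)
    (hbig : (120 * (G.tree.card : ℝ) ^ 3 * (G.depth + 1) + 5 * (G.tree.card : ℝ) ^ 4) *
      Real.log T ^ 3 ≤ Real.sqrt T) (i : Fin n) {B : ℝ} {p : ℕ}
    (hM : ∀ ω, R.M T ω i ≤ B * Real.log T ^ p * R.N T ω)
    (hreg : ∫ ω, R.playerRegret i T ω ∂μ
      ≤ B * Real.log T ^ p * Real.sqrt T * ∫ ω, R.N T ω ∂μ) :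
    Integrable (fun ω => R.epsStar 12 i T ω) μ ∧
      ∫ ω, R.epsStar 12 i T ω ∂μ
        ≤ (13 * B + 40) * Real.log T ^ (p + 1) / Real.sqrt T * ∫ ω, R.N T ω ∂μ := by
  have hT1 : 0 < T := by
    rcases Nat.eq_zero_or_pos T with rfl | h
    · norm_num at hT
    · exact h
  have hT0 : (0 : ℝ) < T := by exact_mod_cast hT1
  have hMint := R.integrable_M (μ := μ) hT1 i hM
  have htilde := R.integrable_epsTilde (μ := μ) 12 i T hMint
  have hstar : Integrable (fun ω => R.epsStar 12 i T ω) μ := (R.integrable_eps i T).inf htilde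
  refine ⟨hstar, ?_⟩
  set E := ∫ ω, R.N T ω ∂μ with hE
  have hE1 : 1 ≤ E := R.one_le_integral_N T
  set L := Real.log T with hL
  have hLp : 1 ≤ L ^ p := one_le_pow₀ hT
  -- A negative `B` would contradict `M ≥ 1`.
  have hB : 0 ≤ B := by
    obtain ⟨ω⟩ := μ.nonempty_of_neZero
    have h1 := (R.M_pos T ω i).trans_le (hM ω)
    by_contra h
    have h2 : B * L ^ p ≤ 0 := mul_nonpos_of_nonpos_of_nonneg (not_le.1 h).le (by linarith)
    have h3 : (0 : ℝ) ≤ R.N T ω := Nat.cast_nonneg _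
    linarith [mul_nonpos_of_nonpos_of_nonneg h2 h3]
  have hMle : ∫ ω, R.M T ω i ∂μ ≤ B * L ^ p * E := by
    have := integral_mono hMint ((R.integrable_N T).const_mul (B * L ^ p)) hM
    rwa [integral_const_mul] at this
  have hwidth := R.sum_integral_selfWidth_le (μ := μ) hT hG hbig i
  -- The rate comes from `ε̃` alone; the other member of the minimum only has to be integrable. The
  -- regret and the widths give `B + 40`, and the term with `M` gives `12 * B`.
  have hmain : ∫ ω, R.epsStar 12 i T ω ∂μ ≤ (1 / (T : ℝ)) * (∫ ω, R.playerRegret i T ω ∂μ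
      + ∑ t ∈ Finset.range T, ∫ ω, R.selfWidth i t ω ∂μ)
      + 12 * (∫ ω, R.M T ω i ∂μ) * Real.sqrt (L / T) := by
    have hs : Integrable (fun ω => ∑ t ∈ Finset.range T, R.estSelfWidth i t ω) μ :=
      integrable_finsetSum _ fun t _ => R.integrable_estSelfWidth i t
    have hr := R.integrable_playerRegret (μ := μ) i T
    have h1 : Integrable (fun ω => (1 / (T : ℝ)) * (R.playerRegret i T ω
        + ∑ t ∈ Finset.range T, R.estSelfWidth i t ω)) μ := (hr.add hs).const_mul _
    have h2 : Integrable (fun ω => 12 * R.M T ω i * Real.sqrt (L / T)) μ :=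
      (hMint.const_mul 12).mul_const _
    have h3 : ∫ ω, R.epsStar 12 i T ω ∂μ ≤ ∫ ω, ((1 / (T : ℝ)) * (R.playerRegret i T ω
        + ∑ t ∈ Finset.range T, R.estSelfWidth i t ω)
        + 12 * R.M T ω i * Real.sqrt (L / T)) ∂μ :=
      integral_mono hstar (h1.add h2) fun ω =>
        (min_le_right _ _).trans (R.epsTilde_le 12 i T ω)
    rw [integral_add h1 h2, integral_const_mul, integral_add hr hs, integral_mul_const,
      integral_const_mul, integral_finsetSum _ fun t _ => R.integrable_estSelfWidth i t] at h3
    simpa only [R.integral_estSelfWidth] using h3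
  have hsT : 0 < Real.sqrt T := Real.sqrt_pos.2 hT0
  have hsq : Real.sqrt (L / T) ≤ L / Real.sqrt T := by
    rw [Real.sqrt_div (by linarith)]
    exact div_le_div_of_nonneg_right (sqrt_log_le hT) hsT.le
  have hpow : L ^ (p + 1) = L ^ p * L := pow_succ L p
  have hinv : 1 / (T : ℝ) * Real.sqrt T = 1 / Real.sqrt T := by
    rw [one_div_mul_eq_div, Real.sqrt_div_self']
  have hterm1 : (1 / (T : ℝ)) * (∫ ω, R.playerRegret i T ω ∂μ
      + ∑ t ∈ Finset.range T, ∫ ω, R.selfWidth i t ω ∂μ)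
      ≤ (B + 40) * L ^ (p + 1) / Real.sqrt T * E := by
    have h1 : ∫ ω, R.playerRegret i T ω ∂μ + ∑ t ∈ Finset.range T, ∫ ω, R.selfWidth i t ω ∂μ
        ≤ (B + 40) * L ^ (p + 1) * Real.sqrt T * E := by
      have h2 : B * L ^ p * Real.sqrt T * E ≤ B * L ^ (p + 1) * Real.sqrt T * E := by
        gcongr
        omega
      have h3 : 40 * Real.sqrt T * L * E ≤ 40 * Real.sqrt T * L ^ (p + 1) * E := by
        gcongr
        rw [hpow]
        exact le_mul_of_one_le_left (by linarith) hLp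
      linarith
    calc _ ≤ (1 / (T : ℝ)) * ((B + 40) * L ^ (p + 1) * Real.sqrt T * E) :=
          mul_le_mul_of_nonneg_left h1 (by positivity)
      _ = (B + 40) * L ^ (p + 1) * (1 / (T : ℝ) * Real.sqrt T) * E := by ring
      _ = _ := by rw [hinv]; ring
  have hterm2 : 12 * (∫ ω, R.M T ω i ∂μ) * Real.sqrt (L / T)
      ≤ 12 * B * L ^ (p + 1) / Real.sqrt T * E := by
    calc 12 * (∫ ω, R.M T ω i ∂μ) * Real.sqrt (L / T)
        ≤ 12 * (B * L ^ p * E) * (L / Real.sqrt T) := by gcongr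
      _ = _ := by rw [hpow]; ring
  refine hmain.trans ((add_le_add hterm1 hterm2).trans (le_of_eq ?_))
  ring

end Run

end
end EFG

/-! ### Choice of the constants and of the game-dependent threshold -/

theorem corollary2 :
    ∃ c K : ℝ, 0 < c ∧ 0 < K ∧
      -- correctness with probability `1 - O(1/√T)`, for all players at once
      (∀ (n : ℕ) (A : Type u) (I : Type v) (G : EFG.Game n A I) (b : EFG.Bounds G),
        ∃ T₀ : ℕ, ∀ (Ω : Type w) [MeasurableSpace Ω] (μ : Measure Ω) [IsProbabilityMeasure μ]
          (R : EFG.Run G b μ) (T : ℕ), T₀ ≤ T →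
          μ.real {ω | ¬ ∀ i : Fin n,
              (EFG.fullGame G).gap G i (fun t => R.σ t ω) T ≤ R.epsStar c i T ω ∧
              (b.Nested → (R.exact T ω).gap G i (fun t => R.σ t ω) T ≤ R.epsStar c i T ω)}
            ≤ K / Real.sqrt T) ∧
      -- the rate `Õ(N_T/√T)`, for regret `Õ(N_T √T)` and estimates of norm `Õ(N_T)`
      (∀ (B : ℝ) (p : ℕ), ∃ (K' : ℝ) (q : ℕ),
        ∀ (n : ℕ) (A : Type u) (I : Type v) (G : EFG.Game n A I) (b : EFG.Bounds G),
        ∃ T₀ : ℕ, ∀ (Ω : Type w) [MeasurableSpace Ω] (μ : Measure Ω) [IsProbabilityMeasure μ]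
          (R : EFG.Run G b μ) (i : Fin n) (T : ℕ), T₀ ≤ T →
          (∀ ω, R.M T ω i ≤ B * Real.log T ^ p * R.N T ω) →
          (∫ ω, R.playerRegret i T ω ∂μ
            ≤ B * Real.log T ^ p * Real.sqrt T * ∫ ω, R.N T ω ∂μ) →
          Integrable (fun ω => R.epsStar c i T ω) μ ∧
          ∫ ω, R.epsStar c i T ω ∂μ
            ≤ K' * Real.log T ^ q / Real.sqrt T * ∫ ω, R.N T ω ∂μ) := by
  have hlog : Filter.Tendsto (fun T : ℕ => Real.log T) Filter.atTop Filter.atTop :=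
    Real.tendsto_log_atTop.comp tendsto_natCast_atTop_atTop
  -- The constants do not depend on the game, and `K'` and `q` depend only on `B` and `p`. The size
  -- of the game enters only through `T₀`.
  refine ⟨12, 2, by norm_num, by norm_num, fun n A I G b => ?_,
    fun B p => ⟨13 * B + 40, p + 1, fun n A I G b => ?_⟩⟩
  · have h1 : ∀ᶠ T : ℕ in Filter.atTop, 1 < T ∧ 1 ≤ Real.log T ∧
        2 * (G.tree.card : ℝ) ≤ Real.sqrt (Real.log T) ∧
        4 * ((∑ i, (G.choices i).card : ℕ) : ℝ) ≤ Real.sqrt T := by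
      filter_upwards [Filter.eventually_gt_atTop 1, hlog.eventually_ge_atTop 1,
        (Real.tendsto_sqrt_atTop.comp hlog).eventually_ge_atTop (2 * (G.tree.card : ℝ)),
        (Real.tendsto_sqrt_atTop.comp tendsto_natCast_atTop_atTop).eventually_ge_atTop
          (4 * ((∑ i, (G.choices i).card : ℕ) : ℝ))] with T h1 h2 h3 h4
      exact ⟨h1, h2, h3, h4⟩
    obtain ⟨T₀, hT₀⟩ := Filter.eventually_atTop.1 h1
    refine ⟨T₀, fun Ω _ μ _ R T hT => ?_⟩
    obtain ⟨h1, h2, h3, h4⟩ := hT₀ T hT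
    exact R.correctness_failure_le h1
      (one_le_mul_of_one_le_of_one_le (by exact_mod_cast h1.le) h2) h3 h4
  · set C : ℝ := 120 * (G.tree.card : ℝ) ^ 3 * (G.depth + 1) + 5 * (G.tree.card : ℝ) ^ 4 with hC
    have hC0 : 0 < C := by
      have := EFG.one_le_card_tree (G := G)
      positivity
    -- Powers of the logarithm are negligible against `√x`, so the game-dependent polylogarithmic
    -- terms eventually fall below `√T`.
    have hsmall : ∀ᶠ x : ℝ in Filter.atTop, C * Real.log x ^ 3 ≤ Real.sqrt x := by
      have h1 := (isLittleO_log_rpow_rpow_atTop (s := 1 / 2) 3 (by norm_num)).def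
        (inv_pos.2 hC0)
      filter_upwards [h1, Filter.eventually_gt_atTop 1] with x h2 h3
      have h4 := Real.log_pos h3
      rw [Real.norm_of_nonneg (by positivity), Real.norm_of_nonneg (by positivity),
        ← Real.sqrt_eq_rpow] at h2
      rw [← le_inv_mul_iff₀ hC0]
      exact_mod_cast h2
    have h1 : ∀ᶠ T : ℕ in Filter.atTop, 1 ≤ Real.log T ∧ G.tree.card * n ≤ T ∧
        C * Real.log T ^ 3 ≤ Real.sqrt T := by
      filter_upwards [hlog.eventually_ge_atTop 1, Filter.eventually_ge_atTop (G.tree.card * n),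
        tendsto_natCast_atTop_atTop.eventually hsmall] with T h2 h3 h4
      exact ⟨h2, h3, h4⟩
    obtain ⟨T₀, hT₀⟩ := Filter.eventually_atTop.1 h1
    refine ⟨T₀, fun Ω _ μ _ R i T hT hM hreg => ?_⟩
    obtain ⟨h2, h3, h4⟩ := hT₀ T hT
    exact R.integral_epsStar_le h2 h3 h4 i hM hreg
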